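/- **Lemma (screening current Ward identity in genus one).** *Lie algebra.* Let $\mathfrak g$ be a finite-dimensional simple complex Lie algebra, $\mathfrak h$ a Cartan subalgebra, $\Delta_+$ the positive roots for a choice of simple roots, $e_\alpha\in\mathfrak g_\alpha\setminus\{0\}$ ($\alpha\in\Delta_+$) root vectors, and $[e_\alpha,e_\beta]=f_{\alpha,\beta}^{\alpha+\beta}e_{\alpha+\beta}$ if $\alpha,\beta,\alpha+\beta\in\Delta_+$. Let $\mathfrak n_+=\bigoplus_{\alpha\in\Delta_+}\mathfrak g_\alpha$ and $N_+=\exp\mathfrak n_+$, with coordinates $x=(x^\alpha)_{\alpha\in\Delta_+}\mapsto \exp(x^{\beta_1}e_{\beta_1})\cdots\exp(x^{\beta_s}e_{\beta_s})$ for a fixed enumeration $\beta_1,\dots,\beta_s$ of $\Delta_+$. For $\alpha\in\Delta_+$, the infinitesimal left translation $(\mathrm{Scr}_\alpha f)(a)=\frac{d}{d\varepsilon}\big|_{\varepsilon=0}f(\exp(-\varepsilon e_\alpha)a)$ is a polynomial vector field $\mathrm{Scr}_\alpha=\sum_{\delta}S_{\alpha,\delta}(x)\,\partial/\partial x^\delta$.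 *Ghosts.* Let $\beta_\alpha[m],\gamma^\alpha[m]$ ($\alpha\in\Delta_+$, $m\in\mathbb Z$) satisfy $[\beta_\alpha[m],\gamma^{\alpha'}[n]]=\delta_{\alpha\alpha'}\delta_{m+n,0}$, all other commutators being zero, and let $\mathcal F$ be the Fock space generated by a vacuum killed by $\beta_\alpha[m]$ ($m\ge0$) and $\gamma^\alpha[n]$ ($n>0$). Put $\beta_\alpha(z)=\sum_m z^{-m-1}\beta_\alpha[m]$, $\gamma^\alpha(z)=\sum_m z^{-m}\gamma^\alpha[m]$, $\mathrm{Scr}_\alpha(z)=\sum_\delta {:}S_{\alpha,\delta}(\gamma(z))\beta_\delta(z){:}$ (normal ordering puts the operators which kill the vacuum to the right), and, for $H\in\mathfrak h$, $T[0]=\sum_{\alpha,m}m\,{:}\gamma^\alpha[-m]\beta_\alpha[m]{:}$, $H[0]=-\sum_{\alpha,m}\alpha(H)\,{:}\gamma^\alpha[-m]\beta_\alpha[m]{:}$. *Correlators.* Let $q=e^{2\pi i\tau}$ with $\operatorname{Im}\tau>0$. For $P_1,\dots,P_n\in\mathbb C[x]$ and $\alpha(1),\dots,\alpha(m)\in\Delta_+$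 ($n,m\ge0$), the correlator $$\langle P_1(\gamma(z_1))\cdots P_n(\gamma(z_n))\,\mathrm{Scr}_{\alpha(1)}(t_1)\cdots\mathrm{Scr}_{\alpha(m)}(t_m)\rangle_{q,H}$$ is the analytic function of $(H,z,t)$ on the connected domain where $e^{\beta(H)}\notin q^{\mathbb Z}$ for all $\beta\in\Delta_+$ and $z_1,\dots,z_n,t_1,\dots,t_m\in\mathbb C^\times$ are pairwise distinct modulo $q^{\mathbb Z}$, which equals $\operatorname{Tr}_{\mathcal F}\bigl(P_1(\gamma(z_1))\cdots P_n(\gamma(z_n))\mathrm{Scr}_{\alpha(1)}(t_1)\cdots\mathrm{Scr}_{\alpha(m)}(t_m)\,q^{T[0]}e^{H[0]}\bigr)$ where $1<|e^{\beta(H)}|<|q|^{-1}$ for all $\beta\in\Delta_+$ and the list $p=(z_1,\dots,z_n,t_1,\dots,t_m)$ satisfies $|q\,p_i|<|p_j|<|p_i|$ for $i<j$. *Kernel.* With $\theta_{11}(e^{2\pi i x};q)=\sum_{n\in\mathbb Z}e^{(n+1/2)^2\pi i\tau+2\pi i(n+1/2)(x+1/2)}$ and $\theta_{11}'=\frac{d}{dz}\theta_{11}(z;q)$,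 put $$w_c(w,z)=\frac{\theta_{11}'(1;q)}{\theta_{11}(e^{-c};q)}\,\frac{\theta_{11}(e^{-c}z/w;q)}{w\,\theta_{11}(z/w;q)}$$ (the choices of logarithms do not matter if $\log(e^{-c}z/w)=-c+\log(z/w)$ and $\log e^{-c}=-c$). *Claim.* On the region above where they have to equal the traces, these traces converge absolutely (as sums over the monomial basis of $\mathcal F$ and over the modes of the inserted fields), and the analytic continuations exist. For all $P_1,\dots,P_n\in\mathbb C[x]$, all $\alpha,\alpha(1),\dots,\alpha(m)\in\Delta_+$, all $H$ with $e^{\beta(H)}\notin q^{\mathbb Z}$ for every $\beta\in\Delta_+$, and all $z_1,\dots,z_n,t,t_1,\dots,t_m\in\mathbb C^\times$ that are pairwise distinct modulo $q^{\mathbb Z}$, $$\begin{aligned} &\langle P_1(\gamma(z_1))\cdots P_n(\gamma(z_n))\,\mathrm{Scr}_\alpha(t)\,\mathrm{Scr}_{\alpha(1)}(t_1)\cdots\mathrm{Scr}_{\alpha(m)}(t_m)\rangle_{q,H}\\ &=\sum_{a=1}^n\bigl(-w_{\alpha(H)}(t,z_a)\bigr)\langle P_1(\gamma(z_1))\cdots(\mathrm{Scr}_\alpha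 P_a)(\gamma(z_a))\cdots P_n(\gamma(z_n))\,\mathrm{Scr}_{\alpha(1)}(t_1)\cdots\mathrm{Scr}_{\alpha(m)}(t_m)\rangle_{q,H}\\ &\quad+\sum_{j=1}^m\bigl(-w_{\alpha(H)}(t,t_j)\bigr)f_{\alpha,\alpha(j)}^{\alpha+\alpha(j)}\langle P_1(\gamma(z_1))\cdots P_n(\gamma(z_n))\,\mathrm{Scr}_{\alpha(1)}(t_1)\cdots\mathrm{Scr}_{\alpha+\alpha(j)}(t_j)\cdots\mathrm{Scr}_{\alpha(m)}(t_m)\rangle_{q,H}, \end{aligned}$$ where the $j$-th term of the last sum is zero if $\alpha+\alpha(j)$ is not a root. -/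

import Mathlib

namespace GenusOneWard

open Complex

noncomputable section

/-! ### Theta function and the kernel `w_c(w, z)` -/

/-- The theta function with characteristic `(1/2, 1/2)`, in additive notation:
`θ₁₁(x; τ) = ∑ₙ exp ((n + 1/2)² π i τ + 2 π i (n + 1/2) (x + 1/2))`. -/
def theta11 (x τ : ℂ) : ℂ :=
  ∑' n : ℤ, cexp (((n : ℂ) + 1 / 2) ^ 2 * (Real.pi * I * τ)
    + 2 * Real.pi * I * ((n : ℂ) + 1 / 2) * (x + 1 / 2))

/-- `w_c(w, z) = θ₁₁'(1; q) / θ₁₁(e^{-c}; q) * θ₁₁(e^{-c} z / w; q) / (w θ₁₁(z / w; q))`, where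
`θ₁₁(ζ; q) = θ₁₁(x; τ)` for `ζ = exp (2 π i x)`, `q = exp (2 π i τ)` and the prime is `d/dζ`.
Replacing `log (z / w)` by another logarithm of `z / w` changes numerator and denominator by the
same sign, so the value does not depend on the branch. -/
def wardKernel (τ c w z : ℂ) : ℂ :=
  deriv (fun ζ : ℂ => theta11 (log ζ / (2 * Real.pi * I)) τ) 1
      / theta11 (-c / (2 * Real.pi * I)) τ
    * (theta11 ((-c + log (z / w)) / (2 * Real.pi * I)) τ
      / (w * theta11 (log (z / w) / (2 * Real.pi * I)) τ))

/-! ### Bosonic ghosts: modes, Fock space, fields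

`R` is the set of positive roots. -/

/-- The ghost Fock space. It is the polynomial ring in the creation operators: the variable
`(α, k)` is `γ^α[-k]` if `k ≥ 0` and `β_α[k]` if `k < 0`, and the vacuum is `1`. -/
abbrev GhostFock (R : Type*) := MvPolynomial (R × ℤ) ℂ

variable {R : Type*}

/-- The mode `β_α[m]` acting on the ghost Fock space. -/
def betaMode (α : R) (m : ℤ) : Module.End ℂ (GhostFock R) :=
  if 0 ≤ m then (MvPolynomial.pderiv (α, m)).toLinearMap
  else LinearMap.mulLeft ℂ (MvPolynomial.X (α, m))

/-- The mode `γ^α[m]` acting on the ghost Fock space. -/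
def gammaMode (α : R) (m : ℤ) : Module.End ℂ (GhostFock R) :=
  if m ≤ 0 then LinearMap.mulLeft ℂ (MvPolynomial.X (α, -m))
  else -(MvPolynomial.pderiv (α, -m)).toLinearMap

theorem ghost_pderiv_comm (i j : R × ℤ) (p : GhostFock R) :
    MvPolynomial.pderiv i (MvPolynomial.pderiv j p)
      = MvPolynomial.pderiv j (MvPolynomial.pderiv i p) := by
  classical
  have h : ⁅(MvPolynomial.pderiv i : Derivation ℂ (GhostFock R) (GhostFock R)),
      (MvPolynomial.pderiv j : Derivation ℂ (GhostFock R) (GhostFock R))⁆ = 0 := by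
    refine MvPolynomial.derivation_ext fun k => ?_
    rw [Derivation.commutator_apply, MvPolynomial.pderiv_X, MvPolynomial.pderiv_X]
    by_cases hi : k = i <;> by_cases hj : k = j <;> simp [Pi.single_apply, hi, hj] <;>
      split_ifs <;> simp
  have h2 : ⁅(MvPolynomial.pderiv i : Derivation ℂ (GhostFock R) (GhostFock R)),
      (MvPolynomial.pderiv j : Derivation ℂ (GhostFock R) (GhostFock R))⁆ p = 0 := by
    rw [h, Derivation.zero_apply]
  rwa [Derivation.commutator_apply, sub_eq_zero] at h2

/-- The canonical commutation relations `[β_α[m], γ^{α'}[n]] = δ_{α α'} δ_{m + n, 0}`. -/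
theorem betaMode_gammaMode [DecidableEq R] (α α' : R) (m n : ℤ) :
    betaMode α m * gammaMode α' n - gammaMode α' n * betaMode α m
      = if α = α' ∧ m + n = 0 then 1 else 0 := by
  refine LinearMap.ext fun p => ?_
  have key : (α = α' ∧ m + n = 0) ↔ ((α', -n) : R × ℤ) = (α, m) := by
    rw [Prod.mk.injEq]
    constructor
    · rintro ⟨rfl, h⟩
      exact ⟨rfl, by omega⟩
    · rintro ⟨rfl, h⟩
      exact ⟨rfl, by omega⟩
  by_cases hm : 0 ≤ m <;> by_cases hn : n ≤ 0
  · by_cases h : ((α', -n) : R × ℤ) = (α, m)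
    · simp [betaMode, gammaMode, hm, hn, key.2 h, h]
    · rw [if_neg (fun h' => h (key.1 h'))]
      simp [betaMode, gammaMode, hm, hn, MvPolynomial.pderiv_X_of_ne h]
  · rw [if_neg (by rintro ⟨-, h⟩; omega)]
    simp [betaMode, gammaMode, hm, hn, ghost_pderiv_comm (α, m) (α', -n)]
  · rw [if_neg (by rintro ⟨-, h⟩; omega)]
    simp [betaMode, gammaMode, hm, hn, mul_left_comm]
  · by_cases h : ((α', -n) : R × ℤ) = (α, m)
    · simp [betaMode, gammaMode, hm, hn, key.2 h, h]
    · rw [if_neg (fun h' => h (key.1 h'))]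
      simp [betaMode, gammaMode, hm, hn, MvPolynomial.pderiv_X_of_ne (Ne.symm h)]

/-- The coefficient of `z^{-m}` in `γ^{α₁}(z) ⋯ γ^{αᵣ}(z)`, where `γ^α(z) = ∑ₖ z^{-k} γ^α[k]`.
Applied to a fixed vector, all sums have finitely many nonzero terms. -/
def gammaWord : List R → ℤ → GhostFock R → GhostFock R
  | [], m, v => if m = 0 then v else 0
  | α :: l, m, v => ∑ᶠ k : ℤ, gammaMode α k (gammaWord l (m - k) v)

/-- The coefficient of `z^{-m}` in `P(γ(z))`. -/
def gammaPoly (P : MvPolynomial R ℂ) (m : ℤ) (v : GhostFock R) : GhostFock R :=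
  ∑ s ∈ P.support, P.coeff s • gammaWord (Finsupp.toMultiset s).toList m v

/-- The coefficient of `z^{-m-1}` in the normally ordered field `∑_δ :S_δ(γ(z)) β_δ(z):` which
bosonizes the polynomial vector field `∑_δ S_δ(x) ∂/∂x^δ`; here
`β_δ(z) = ∑ₖ z^{-k-1} β_δ[k]`, and the modes `β_δ[k]` with `k ≥ 0` are put to the right, those
with `k < 0` to the left. -/
def currentMode [Fintype R] (S : R → MvPolynomial R ℂ) (m : ℤ) (v : GhostFock R) : GhostFock R :=
  ∑ δ, ∑ᶠ k : ℤ, if 0 ≤ k then gammaPoly (S δ) (m - k) (betaMode δ k v)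
    else betaMode δ k (gammaPoly (S δ) (m - k) v)

/-- The action of the polynomial vector field `∑_δ S_δ ∂/∂x^δ` on polynomials. -/
def vectorFieldApply [Fintype R] (S : R → MvPolynomial R ℂ) (P : MvPolynomial R ℂ) :
    MvPolynomial R ℂ :=
  ∑ δ, S δ * MvPolynomial.pderiv δ P

/-- The normally ordered product `:γ^α[-m] β_α[m]:`. -/
def ghostNumber (α : R) (m : ℤ) : Module.End ℂ (GhostFock R) :=
  if 0 ≤ m then gammaMode α (-m) * betaMode α m else betaMode α m * gammaMode α (-m)

/-- The zero mode `T^gh[0]` of `T^gh(z) = ∑_α :∂γ^α(z) β_α(z):`. -/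
def ghostT0 [Fintype R] (v : GhostFock R) : GhostFock R :=
  ∑ α : R, ∑ᶠ m : ℤ, (m : ℂ) • ghostNumber α m v

/-- The zero mode `H^gh[0]` of `H^gh(z) = -∑_α α(H) :γ^α(z) β_α(z):`, where `wt α = α(H)`. -/
def ghostH0 [Fintype R] (wt : R → ℂ) (v : GhostFock R) : GhostFock R :=
  -∑ α : R, wt α • ∑ᶠ m : ℤ, ghostNumber α m v

/-- The eigenvalue of `T^gh[0]` on a monomial in the creation operators. -/
def ghostEnergy (s : R × ℤ →₀ ℕ) : ℕ := s.sum fun p k => k * p.2.natAbs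

/-- The eigenvalue of `H^gh[0]` on a monomial in the creation operators. -/
def ghostCharge (wt : R → ℂ) (s : R × ℤ →₀ ℕ) : ℂ :=
  s.sum fun p k => (k : ℂ) * if 0 ≤ p.2 then -wt p.1 else wt p.1

theorem ghostNumber_monomial (α : R) (m : ℤ) (s : R × ℤ →₀ ℕ) :
    ghostNumber α m (MvPolynomial.monomial s 1)
      = ((if 0 ≤ m then (s (α, m) : ℂ) else -(s (α, m) : ℂ))) •
        (MvPolynomial.monomial s 1 : GhostFock R) := by
  by_cases hm : 0 ≤ m
  · simp only [ghostNumber, gammaMode, betaMode, if_pos hm, neg_neg, Module.End.mul_apply,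
      if_pos (show -m ≤ 0 by omega), LinearMap.mulLeft_apply]
    change MvPolynomial.X (α, m) * MvPolynomial.pderiv (α, m) _ = _
    rw [MvPolynomial.X_mul_pderiv_monomial, Nat.cast_smul_eq_nsmul]
  · simp only [ghostNumber, gammaMode, betaMode, if_neg hm, neg_neg, Module.End.mul_apply,
      if_neg (show ¬ -m ≤ 0 by omega), LinearMap.mulLeft_apply, LinearMap.neg_apply, mul_neg]
    change -(MvPolynomial.X (α, m) * MvPolynomial.pderiv (α, m) _) = _
    rw [MvPolynomial.X_mul_pderiv_monomial, neg_smul, Nat.cast_smul_eq_nsmul]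

theorem finsupp_sum_prod_eq [Fintype R] (s : R × ℤ →₀ ℕ) (f : R → ℤ → ℕ → ℂ)
    (hf : ∀ α m, f α m 0 = 0) :
    (s.sum fun p k => f p.1 p.2 k) = ∑ α, ∑ᶠ m, f α m (s (α, m)) := by
  classical
  have h : ∀ α : R, ∑ᶠ m, f α m (s (α, m))
      = ∑ m ∈ s.support.image Prod.snd, f α m (s (α, m)) := by
    intro α
    refine finsum_eq_sum_of_support_subset _ fun m hm => ?_
    have : s (α, m) ≠ 0 := fun h0 => hm (by simp only [h0, hf])
    exact Finset.mem_coe.2 (Finset.mem_image.2 ⟨(α, m), Finsupp.mem_support_iff.2 this, rfl⟩)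
  simp only [h]
  rw [← Finset.sum_product']
  refine Finset.sum_subset (fun p hp => Finset.mem_product.2
    ⟨Finset.mem_univ _, Finset.mem_image_of_mem _ hp⟩) fun p _ hp => ?_
  have : s p = 0 := by simpa using hp
  simp only [this, hf]

theorem ghostT0_monomial [Fintype R] (s : R × ℤ →₀ ℕ) :
    ghostT0 (MvPolynomial.monomial s 1)
      = (ghostEnergy s : ℂ) • (MvPolynomial.monomial s 1 : GhostFock R) := by
  have h1 : (ghostEnergy s : ℂ) = s.sum fun p k =>
      (p.2 : ℂ) * (if 0 ≤ p.2 then (k : ℂ) else -(k : ℂ)) := by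
    rw [ghostEnergy, Finsupp.sum, Finsupp.sum, Nat.cast_sum]
    refine Finset.sum_congr rfl fun p _ => ?_
    rw [Nat.cast_mul, Nat.cast_natAbs]
    split_ifs with h
    · rw [abs_of_nonneg h, mul_comm]
    · rw [abs_of_neg (not_le.1 h)]
      push_cast
      ring
  rw [h1, finsupp_sum_prod_eq s (fun _ m k => (m : ℂ) * (if 0 ≤ m then (k : ℂ) else -(k : ℂ)))
    (by simp), Finset.sum_smul, ghostT0]
  refine Finset.sum_congr rfl fun α _ => ?_
  simp only [ghostNumber_monomial, smul_smul]
  rw [finsum_smul]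

theorem ghostH0_monomial [Fintype R] (wt : R → ℂ) (s : R × ℤ →₀ ℕ) :
    ghostH0 wt (MvPolynomial.monomial s 1)
      = ghostCharge wt s • (MvPolynomial.monomial s 1 : GhostFock R) := by
  rw [ghostCharge, finsupp_sum_prod_eq s
    (fun α m k => (k : ℂ) * if 0 ≤ m then -wt α else wt α) (by simp), ghostH0,
    ← Finset.sum_neg_distrib, Finset.sum_smul]
  refine Finset.sum_congr rfl fun α _ => ?_
  simp only [ghostNumber_monomial]
  rw [← finsum_smul, smul_smul, ← neg_smul, ← smul_eq_mul,
    smul_finsum, ← finsum_neg_distrib]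
  congr 1
  refine finsum_congr fun m => ?_
  split_ifs <;> simp [mul_comm]

/-! ### Ghost one-loop correlation functions -/

/-- The composition `f₁ ∘ ⋯ ∘ fₙ`. -/
def composeFin {V : Type*} {n : ℕ} (f : Fin n → V → V) : V → V :=
  (List.ofFn f).foldr (fun g h => g ∘ h) id

/-- The contribution of the basis vector `x^s` and of the modes `k`, `r` of the fields to
`Tr (P₁(γ(z₁)) ⋯ Pₙ(γ(zₙ)) J₁(t₁) ⋯ Jₘ(tₘ) q^{T^gh[0]} e^{H^gh[0]})`, where `Jⱼ` is the field
which bosonizes the vector field `S j`. -/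
def traceTerm [Fintype R] (q : ℂ) (wt : R → ℂ) {n m : ℕ} (P : Fin n → MvPolynomial R ℂ)
    (S : Fin m → R → MvPolynomial R ℂ) (z : Fin n → ℂ) (t : Fin m → ℂ)
    (s : R × ℤ →₀ ℕ) (k : Fin n → ℤ) (r : Fin m → ℤ) : ℂ :=
  MvPolynomial.coeff s
      (composeFin (fun a => gammaPoly (P a) (k a))
        (composeFin (fun j => currentMode (S j) (r j)) (MvPolynomial.monomial s 1)))
    * ((∏ a, z a ^ (-k a)) * ∏ j, t j ^ (-r j - 1))
    * (q ^ ghostEnergy s * cexp (ghostCharge wt s))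

/-- The trace
`Tr (P₁(γ(z₁)) ⋯ Pₙ(γ(zₙ)) J₁(t₁) ⋯ Jₘ(tₘ) q^{T^gh[0]} e^{H^gh[0]})` over the ghost Fock space
converges absolutely, with value `y`. -/
def HasGhostTrace [Fintype R] (q : ℂ) (wt : R → ℂ) {n m : ℕ} (P : Fin n → MvPolynomial R ℂ)
    (S : Fin m → R → MvPolynomial R ℂ) (z : Fin n → ℂ) (t : Fin m → ℂ) (y : ℂ) : Prop :=
  HasSum (fun x : (R × ℤ →₀ ℕ) × (Fin n → ℤ) × (Fin m → ℤ) =>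
    traceTerm q wt P S z t x.1 x.2.1 x.2.2) y

/-- Radially ordered insertion points, `|p₁| > |p₂| > ⋯ > |p_N| > |q p₁|`, and
`1 < |e^{α(H)}| < |q|⁻¹` for all positive roots `α`: the trace converges. -/
def InConvergenceRegion (q : ℂ) (wt : R → ℂ) {N : ℕ} (p : Fin N → ℂ) : Prop :=
  (∀ α, 1 < ‖cexp (wt α)‖ ∧ ‖q * cexp (wt α)‖ < 1) ∧ (∀ i, p i ≠ 0) ∧
    ∀ i j, i < j → ‖p j‖ < ‖p i‖ ∧ ‖q * p i‖ < ‖p j‖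

/-- The insertion points are nonzero and distinct modulo `q^ℤ`, and `e^{α(H)} ∉ q^ℤ` for all
positive roots `α`. -/
def InGhostDomain (q : ℂ) (wt : R → ℂ) {N : ℕ} (p : Fin N → ℂ) : Prop :=
  (∀ α, ∀ k : ℤ, cexp (wt α) ≠ q ^ k) ∧ (∀ i, p i ≠ 0) ∧
    ∀ i j, i ≠ j → ∀ k : ℤ, p i ≠ q ^ k * p j

/-- `F` is the one-loop correlation function
`⟨P₁(γ(z₁)) ⋯ Pₙ(γ(zₙ)) J₁(t₁) ⋯ Jₘ(tₘ)⟩_{q,H}` as a function of `(ξ, z, t)`, where `ξ` are linear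
coordinates of `H` and `wt ξ α = α(H)`: the analytic function on the (connected) domain above
which equals the trace wherever the trace converges. -/
def IsGhostCorrelator [Fintype R] (q : ℂ) {l : ℕ} (wt : (Fin l → ℂ) → R → ℂ) {n m : ℕ}
    (P : Fin n → MvPolynomial R ℂ) (S : Fin m → R → MvPolynomial R ℂ)
    (F : (Fin l → ℂ) × (Fin n → ℂ) × (Fin m → ℂ) → ℂ) : Prop :=
  AnalyticOnNhd ℂ F {x | InGhostDomain q (wt x.1) (Fin.append x.2.1 x.2.2)} ∧
    ∀ x, InConvergenceRegion q (wt x.1) (Fin.append x.2.1 x.2.2) →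
      HasGhostTrace q (wt x.1) P S x.2.1 x.2.2 (F x)

/-- The ghost one-loop correlation function
`⟨P₁(γ(z₁)) ⋯ Pₙ(γ(zₙ)) J₁(t₁) ⋯ Jₘ(tₘ)⟩_{q,H}`. -/
def ghostCorrelator [Fintype R] (q : ℂ) {l : ℕ} (wt : (Fin l → ℂ) → R → ℂ) {n m : ℕ}
    (P : Fin n → MvPolynomial R ℂ) (S : Fin m → R → MvPolynomial R ℂ) :
    (Fin l → ℂ) × (Fin n → ℂ) × (Fin m → ℂ) → ℂ :=
  Classical.epsilon (IsGhostCorrelator q wt P S)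

end

/-! ### The Lie algebra and the vector fields of the left action of `N₊` -/

noncomputable section

open LieAlgebra LieAlgebra.IsKilling

variable {L : Type*} [LieRing L] [LieAlgebra ℂ L] [FiniteDimensional ℂ L] [LieAlgebra.IsSimple ℂ L]
  {𝔥 : LieSubalgebra ℂ L} [𝔥.IsCartanSubalgebra]

/-- The positive roots with respect to a base (a choice of simple roots). -/
abbrev PosRoot (b : (rootSystem 𝔥).Base) := {i : 𝔥.root // b.IsPos i}

instance PosRoot.instFintype (b : (rootSystem 𝔥).Base) : Fintype (PosRoot b) := Fintype.ofFinite _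

/-- A positive root as a linear functional on `𝔥`. -/
def PosRoot.toDual {b : (rootSystem 𝔥).Base} (α : PosRoot b) : Module.Dual ℂ 𝔥 :=
  (rootSystem 𝔥).root α.1

/-- `e` consists of root vectors: `0 ≠ e α ∈ 𝔤_α` for all positive roots `α`. -/
def IsRootVectors {b : (rootSystem 𝔥).Base} (e : PosRoot b → L) : Prop :=
  ∀ α : PosRoot b, e α ∈ rootSpace 𝔥 (α.1 : LieModule.Weight ℂ 𝔥 L) ∧ e α ≠ 0

/-- `f_{α,β}^γ`: if `γ = α + β`, the scalar with `[e_α, e_β] = f_{α,β}^{α+β} e_{α+β}`; otherwise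
`0`. -/
def structureConstant {b : (rootSystem 𝔥).Base} (e : PosRoot b → L) (α β γ : PosRoot b) : ℂ :=
  open Classical in
  if γ.toDual = α.toDual + β.toDual then Classical.epsilon fun c : ℂ => ⁅e α, e β⁆ = c • e γ
  else 0

/-- `exp (ad X)` for `ad`-nilpotent `X`, as a finite sum: `(ad X)^{dim 𝔤} = 0`. -/
def expAd (X : L) : Module.End ℂ L :=
  ∑ k ∈ Finset.range (Module.finrank ℂ L), ((k.factorial : ℂ)⁻¹) • (LieAlgebra.ad ℂ L X) ^ k

/-- The coordinates on `N₊`, which is represented faithfully on `𝔤` by the adjoint action: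
`x ↦ exp (x^{β₁} e_{β₁}) ⋯ exp (x^{βₛ} e_{βₛ})`, where `β₁, …, βₛ` is an enumeration of the
positive roots. -/
def nilpotentGroupElement {b : (rootSystem 𝔥).Base} (e : PosRoot b → L) {s : ℕ}
    (ord : Fin s ≃ PosRoot b) (x : PosRoot b → ℂ) : Module.End ℂ L :=
  (List.ofFn fun i => expAd (x (ord i) • e (ord i))).prod

/-- `∑_δ S_δ(x) ∂/∂x^δ` is the vector field by which `X ∈ 𝔫₊` acts on functions on `N₊`, when
`N₊` acts on itself from the left: `(X f)(a) = d/dε f(exp(-ε X) a)` at `ε = 0`. That is, moving the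
coordinates `x` with velocity `S(x)` moves the group element `a` with velocity `-X a`. -/
def IsLeftActionField {b : (rootSystem 𝔥).Base} (e : PosRoot b → L) {s : ℕ}
    (ord : Fin s ≃ PosRoot b) (X : L) (S : PosRoot b → MvPolynomial (PosRoot b) ℂ) : Prop :=
  ∀ (x : PosRoot b → ℂ) (y : L) (φ : Module.Dual ℂ L),
    HasDerivAt
      (fun ε : ℂ => φ (nilpotentGroupElement e ord
        (fun δ => x δ + ε * MvPolynomial.eval x (S δ)) y))
      (φ (-⁅X, nilpotentGroupElement e ord x y⁆)) 0

/-- The coefficients of `Scr(X; x, ∂ₓ) = ∑_δ S_δ(x) ∂/∂x^δ`: the (unique) polynomial vector field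
of the left action of `X`. -/
def screeningField {b : (rootSystem 𝔥).Base} (e : PosRoot b → L) {s : ℕ}
    (ord : Fin s ≃ PosRoot b) (X : L) : PosRoot b → MvPolynomial (PosRoot b) ℂ :=
  Classical.epsilon (IsLeftActionField e ord X)

/-- The values `α(H)` of the positive roots at the point `H` with coordinates `ξ` with respect to a
basis of `𝔥`. -/
def rootValues (b : (rootSystem 𝔥).Base) {l : ℕ} (hb : Module.Basis (Fin l) ℂ 𝔥)
    (ξ : Fin l → ℂ) (α : PosRoot b) : ℂ :=
  α.toDual (∑ i, ξ i • hb i)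

/-- The ghost one-loop correlation function
`⟨P₁(γ(z₁)) ⋯ Pₙ(γ(zₙ)) Scr_{α(1)}(t₁) ⋯ Scr_{α(m)}(tₘ)⟩_{q,H}` with `H = ∑ ξᵢ Hᵢ` and
`q = exp (2 π i τ)`, as a function of `(ξ, z, t)`. -/
def screeningCorrelator {b : (rootSystem 𝔥).Base} (e : PosRoot b → L) {s : ℕ}
    (ord : Fin s ≃ PosRoot b) {l : ℕ} (hb : Module.Basis (Fin l) ℂ 𝔥) (τ : ℂ) {n m : ℕ}
    (P : Fin n → MvPolynomial (PosRoot b) ℂ) (α : Fin m → PosRoot b) :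
    (Fin l → ℂ) × (Fin n → ℂ) × (Fin m → ℂ) → ℂ :=
  ghostCorrelator (cexp (2 * Real.pi * I * τ)) (rootValues b hb) P
    (fun j => screeningField e ord (e (α j)))

end

end GenusOneWard

/-! Consider Tr(A J[r] B q^{T[0]} e^{H[0]}), where J[r] is a mode of the current of e_α, A is a
product of modes of the fields P_a(γ), and B is a product of modes of the other currents. Moving
J[r] to the far left through A, or to the far right through B, produces commutators. Cyclicity
identifies the two extreme positions up to the factor μ = e^{-α(H)} q^r by which J[r] fails to
commute with q^{T[0]} e^{H[0]}. Hence (1 - μ) Tr(A J[r] B) equals μ times the traces with a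
commutator inside A, plus the traces with a commutator inside B (`wtrace_ward`). Dividing by 1 - μ
and summing against t^{-r-1} leaves the series ∑ z^r t^{-r-1} μ/(1 - μ) for the points with |z| >
|t|, and ∑ z^r t^{-r-1}/(1 - μ) for those with |z| < |t|. By Kronecker's formula both are expansions
of the same function -w_{α(H)}(t, z), on two adjacent annuli (`hasSum_negKernel_of_gt`,
`hasSum_negKernel_of_lt`).

The commutators come from the group. In coordinates of the second kind, the matrix expressing the
velocity a'a⁻¹ through the coordinate velocities is polynomial and unitriangular with respect to
height, so its inverse is polynomial too (`leftFieldMatrix_mul`). This gives existence and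
uniqueness of the left action fields and shows that S_{α,δ} is homogeneous of weight δ - α. By
height, S_{α,δ} does not involve x^δ, so normal ordering is vacuous. Moreover, of ∂_δ S_ε and ∂_ε
S'_δ at least one always vanishes, so there are no double contractions: the currents bracket exactly
like the vector fields, without a central term (`fieldBracket_currentField`).

The analysis rests on weighted ℓ¹ norms on the Fock space. A field at radius x is summable over its
modes as an operator between norms whose oscillator radii r' < 1/x < r enclose 1/x. Radial ordering
of the points makes these bounds composable. The conditions |q p_i| < |p_j| and 1 < |e^{β(H)}| <
|q|⁻¹ leave enough room for the weighted trace to converge absolutely (`traceDominated_oscRadius`,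
`tsum_composeFin_le`, `wtrace_cyclic`).

Finally, the identity is read as a recursion defining a function on the whole domain
(`wardCorrelator`). Without currents only the constant terms of the P_a survive, multiplied by the
partition function. By induction this function is analytic on the domain and equals the trace on the
convergence region. The domain is connected, being the complement of countably many complex
hyperplanes, so every other correlator agrees with it (`IsGhostCorrelator.eqOn`), and the Ward
identity holds by construction. -/

namespace GenusOneWard

open Complex Filter Topology

noncomputable section

/-! ### The theta function as a Laurent series -/

/-- The Laurent coefficients `(-1)ⁿ q^{n (n + 1) / 2}` of the theta function. -/
def thetaCoeff (τ : ℂ) (n : ℤ) : ℂ := cexp (Real.pi * I * n + Real.pi * I * (n * (n + 1)) * τ)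

/-- The theta function `∑ₙ (-1)ⁿ q^{n (n + 1) / 2} xⁿ` in the multiplicative variable. -/
def mulTheta (τ x : ℂ) : ℂ := ∑' n : ℤ, thetaCoeff τ n * x ^ n

/-- The nome `q = exp (2 π i τ)`. -/
def nome (τ : ℂ) : ℂ := cexp (2 * Real.pi * I * τ)

theorem nome_ne_zero (τ : ℂ) : nome τ ≠ 0 := exp_ne_zero _

theorem norm_nome_lt_one {τ : ℂ} (hτ : 0 < τ.im) : ‖nome τ‖ < 1 := by
  rw [nome, Complex.norm_exp, Real.exp_lt_one_iff]
  have : (2 * Real.pi * I * τ).re = -(2 * Real.pi * τ.im) := by simp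
  rw [this]
  have := Real.pi_pos
  have : 0 < 2 * Real.pi * τ.im := by positivity
  linarith

theorem norm_nome_pos (τ : ℂ) : 0 < ‖nome τ‖ := norm_pos_iff.2 (nome_ne_zero τ)

theorem nome_zpow (τ : ℂ) (n : ℤ) : nome τ ^ n = cexp (2 * Real.pi * I * n * τ) := by
  rw [nome, ← Complex.exp_int_mul]
  congr 1
  ring

theorem thetaCoeff_add_one (τ : ℂ) (n : ℤ) :
    thetaCoeff τ (n + 1) = -(nome τ ^ (n + 1) * thetaCoeff τ n) := by
  rw [nome_zpow, thetaCoeff, thetaCoeff, ← Complex.exp_add, ← neg_one_mul, ← Complex.exp_pi_mul_I,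
    ← Complex.exp_add]
  congr 1
  push_cast
  ring

theorem thetaCoeff_zero (τ : ℂ) : thetaCoeff τ 0 = 1 := by simp [thetaCoeff]

theorem thetaCoeff_reflect (τ : ℂ) (n : ℤ) : thetaCoeff τ (-1 - n) = -thetaCoeff τ n := by
  have h : thetaCoeff τ (-1 - n) * cexp ((2 * n + 1 : ℤ) * (Real.pi * I)) = thetaCoeff τ n := by
    rw [thetaCoeff, thetaCoeff, ← Complex.exp_add]
    congr 1
    push_cast
    ring
  rw [Complex.exp_int_mul, Complex.exp_pi_mul_I, Odd.neg_one_zpow ⟨n, rfl⟩] at h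
  rw [← h]
  ring

theorem thetaCoeff_mul_exp (τ u : ℂ) (n : ℤ) :
    thetaCoeff τ n * cexp (2 * Real.pi * I * u) ^ n
      = jacobiTheta₂_term n (u + 1 / 2 + τ / 2) τ := by
  rw [thetaCoeff, ← Complex.exp_int_mul, ← Complex.exp_add, jacobiTheta₂_term]
  congr 1
  ring

theorem mulTheta_exp (τ u : ℂ) :
    mulTheta τ (cexp (2 * Real.pi * I * u)) = jacobiTheta₂ (u + 1 / 2 + τ / 2) τ :=
  tsum_congr fun n => thetaCoeff_mul_exp τ u n

theorem exists_exp_two_pi_eq {x : ℂ} (hx : x ≠ 0) : ∃ u, cexp (2 * Real.pi * I * u) = x := by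
  refine ⟨log x / (2 * Real.pi * I), ?_⟩
  rw [mul_div_cancel₀ _ (by simp [Real.pi_ne_zero]), exp_log hx]

theorem summable_mulTheta {τ x : ℂ} (hτ : 0 < τ.im) (hx : x ≠ 0) :
    Summable fun n : ℤ => thetaCoeff τ n * x ^ n := by
  obtain ⟨u, rfl⟩ := exists_exp_two_pi_eq hx
  simp only [thetaCoeff_mul_exp]
  exact (summable_jacobiTheta₂_term_iff _ _).2 hτ

/-- The substitution n ↦ -1 - n changes the sign of every coefficient and fixes the value of the
series at 1. -/
theorem mulTheta_one (τ : ℂ) : mulTheta τ 1 = 0 := by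
  have h : mulTheta τ 1 = -mulTheta τ 1 := by
    conv_lhs => rw [mulTheta, ← (Equiv.subLeft (-1 : ℤ)).tsum_eq]
    rw [mulTheta, ← tsum_neg]
    refine tsum_congr fun n => ?_
    simp [Equiv.subLeft_apply, thetaCoeff_reflect]
  exact self_eq_neg.1 h

theorem mulTheta_nome_mul (τ : ℂ) {x : ℂ} (hx : x ≠ 0) :
    mulTheta τ (nome τ * x) = -(nome τ * x)⁻¹ * mulTheta τ x := by
  conv_rhs => rw [mulTheta, ← (Equiv.addRight (1 : ℤ)).tsum_eq]
  rw [mulTheta, ← tsum_mul_left]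
  refine tsum_congr fun n => ?_
  have hq := nome_ne_zero τ
  rw [Equiv.coe_addRight, thetaCoeff_add_one, mul_zpow, zpow_add₀ hq, zpow_add₀ hx]
  field_simp

theorem mulTheta_nome (τ : ℂ) : mulTheta τ (nome τ) = 0 := by
  simpa [mulTheta_one] using mulTheta_nome_mul τ one_ne_zero

/-! ### Kronecker's formula -/

/-- The decay in the second bound is what lets the Lerch series converge down to the inner radius
|q|. -/
theorem exists_bound_kronecker {τ a : ℂ} (hτ : 0 < τ.im) (ha0 : a ≠ 0)
    (ha : ∀ k : ℤ, a ≠ nome τ ^ k) :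
    ∃ C : ℝ, 0 < C ∧ (∀ r : ℤ, ‖(1 - a * nome τ ^ r)⁻¹‖ ≤ C) ∧
      (∀ r : ℕ, ‖(1 - a * nome τ ^ (-(r : ℤ)))⁻¹‖ ≤ C * ‖nome τ‖ ^ r) := by
  have hq := nome_ne_zero τ
  have hq1 := norm_nome_lt_one hτ
  have hp : Tendsto (fun r : ℕ => nome τ ^ r) atTop (𝓝 0) :=
    tendsto_pow_atTop_nhds_zero_of_norm_lt_one hq1
  have h1 : Tendsto (fun r : ℕ => (1 - a * nome τ ^ r)⁻¹) atTop (𝓝 (1 - a * 0)⁻¹) :=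
    ((hp.const_mul a).const_sub 1).inv₀ (by simp)
  have h2 : Tendsto (fun r : ℕ => (nome τ ^ r - a)⁻¹) atTop (𝓝 (0 - a)⁻¹) :=
    (hp.sub_const a).inv₀ (by simpa using ha0)
  obtain ⟨C₁, hC₁⟩ := (Metric.isBounded_range_of_tendsto _ h1).exists_norm_le
  obtain ⟨C₂, hC₂⟩ := (Metric.isBounded_range_of_tendsto _ h2).exists_norm_le
  -- For negative exponents q^r is pulled out; the remaining factor tends to -1/a, hence is bounded.
  have key : ∀ r : ℕ, (1 - a * nome τ ^ (-(r : ℤ)))⁻¹ = nome τ ^ r * (nome τ ^ r - a)⁻¹ := by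
    intro r
    have h3 : nome τ ^ r - a ≠ 0 := fun h => ha r (by rw [zpow_natCast]; exact (sub_eq_zero.1 h).symm)
    have hqr : nome τ ^ r ≠ 0 := pow_ne_zero _ hq
    rw [zpow_neg, zpow_natCast, show 1 - a * (nome τ ^ r)⁻¹ = (nome τ ^ r - a) * (nome τ ^ r)⁻¹ by
      field_simp, mul_inv, inv_inv, mul_comm]
  have hb : ∀ r : ℕ, ‖(1 - a * nome τ ^ (-(r : ℤ)))⁻¹‖ ≤ max 1 (max C₁ C₂) * ‖nome τ‖ ^ r := by
    intro r
    rw [key, norm_mul, norm_pow, mul_comm]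
    gcongr
    exact (hC₂ _ ⟨r, rfl⟩).trans ((le_max_right _ _).trans (le_max_right _ _))
  refine ⟨max 1 (max C₁ C₂), by positivity, fun r => ?_, hb⟩
  obtain ⟨n, rfl | rfl⟩ := r.eq_nat_or_neg
  · rw [zpow_natCast]
    exact (hC₁ _ ⟨n, rfl⟩).trans ((le_max_left _ _).trans (le_max_right _ _))
  · refine (hb n).trans (mul_le_of_le_one_right (by positivity) (pow_le_one₀ (norm_nonneg _) hq1.le))

/-- The Lerch-type series `∑_r x^r / (1 - a q^r)`. -/
def kroneckerSeries (τ a x : ℂ) : ℂ := ∑' r : ℤ, x ^ r * (1 - a * nome τ ^ r)⁻¹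

theorem summable_kroneckerSeries {τ a x : ℂ} (hτ : 0 < τ.im) (ha0 : a ≠ 0)
    (ha : ∀ k : ℤ, a ≠ nome τ ^ k) (hx1 : ‖nome τ‖ < ‖x‖) (hx2 : ‖x‖ < 1) :
    Summable fun r : ℤ => x ^ r * (1 - a * nome τ ^ r)⁻¹ := by
  obtain ⟨C, hC, h1, h2⟩ := exists_bound_kronecker hτ ha0 ha
  have hxpos : 0 < ‖x‖ := (norm_nonneg _).trans_lt hx1
  refine Summable.of_nat_of_neg ?_ ?_
  · refine Summable.of_norm_bounded (g := fun r : ℕ => C * ‖x‖ ^ r)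
      ((summable_geometric_of_lt_one (norm_nonneg _) hx2).mul_left C) fun r => ?_
    rw [norm_mul, zpow_natCast, norm_pow, mul_comm]
    gcongr
    exact h1 _
  · refine Summable.of_norm_bounded (g := fun r : ℕ => C * (‖nome τ‖ / ‖x‖) ^ r)
      ((summable_geometric_of_lt_one (by positivity) ((div_lt_one hxpos).2 hx1)).mul_left C)
      fun r => ?_
    rw [norm_mul, norm_zpow, zpow_neg, zpow_natCast, div_pow]
    calc (‖x‖ ^ r)⁻¹ * ‖(1 - a * nome τ ^ (-(r : ℤ)))⁻¹‖
        ≤ (‖x‖ ^ r)⁻¹ * (C * ‖nome τ‖ ^ r) := by gcongr; exact h2 r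
      _ = C * (‖nome τ‖ ^ r / ‖x‖ ^ r) := by ring

theorem ne_zero_of_norm_nome_lt {τ x : ℂ} (hx : ‖nome τ‖ < ‖x‖) : x ≠ 0 :=
  norm_pos_iff.1 ((norm_nonneg _).trans_lt hx)

/-- The coefficients of `θ(x) ∑_r x^r / (1 - a q^r)`. -/
def kroneckerCoeff (τ a : ℂ) (N : ℤ) : ℂ :=
  ∑' r : ℤ, thetaCoeff τ (N - r) * (1 - a * nome τ ^ r)⁻¹

theorem summable_kroneckerCoeff {τ a : ℂ} (hτ : 0 < τ.im) (ha0 : a ≠ 0)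
    (ha : ∀ k : ℤ, a ≠ nome τ ^ k) (N : ℤ) :
    Summable fun r : ℤ => thetaCoeff τ (N - r) * (1 - a * nome τ ^ r)⁻¹ := by
  obtain ⟨C, hC, h1, h2⟩ := exists_bound_kronecker hτ ha0 ha
  have h := (Equiv.subLeft N).summable_iff.2 (summable_mulTheta hτ one_ne_zero).norm
  refine Summable.of_norm_bounded (h.mul_right C) fun r => ?_
  simp only [Function.comp, Equiv.subLeft_apply, one_zpow, mul_one, norm_mul]
  gcongr
  exact h1 r

/-- Insert the recursion of the theta coefficients and use q^{-r}/(1 - a q^r) = q^{-r} + a/(1 - a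
q^r). The first summand contributes a multiple of θ(q) = 0. -/
theorem kroneckerCoeff_add_one {τ a : ℂ} (hτ : 0 < τ.im) (ha0 : a ≠ 0)
    (ha : ∀ k : ℤ, a ≠ nome τ ^ k) (N : ℤ) :
    kroneckerCoeff τ a (N + 1) = -(nome τ ^ (N + 1) * a) * kroneckerCoeff τ a N := by
  have hq := nome_ne_zero τ
  have h0 : HasSum (fun r : ℤ => thetaCoeff τ (N - r) * nome τ ^ (-r)) 0 := by
    have h := (summable_mulTheta hτ hq).hasSum
    rw [← mulTheta, mulTheta_nome] at h
    have h' := ((Equiv.subLeft N).hasSum_iff.2 h).mul_left (nome τ ^ (-N))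
    rw [mul_zero] at h'
    refine h'.congr_fun ?_
    intro r
    simp only [Function.comp, Equiv.subLeft_apply]
    rw [mul_left_comm, ← zpow_add₀ hq]
    congr 2
    ring
  have h1 := (h0.add ((summable_kroneckerCoeff hτ ha0 ha N).hasSum.mul_left a)).mul_left
    (-nome τ ^ (N + 1))
  rw [← kroneckerCoeff, zero_add] at h1
  have h2 : -nome τ ^ (N + 1) * (a * kroneckerCoeff τ a N)
      = -(nome τ ^ (N + 1) * a) * kroneckerCoeff τ a N := by ring
  rw [← h2, ← h1.tsum_eq, kroneckerCoeff]
  refine tsum_congr fun r => ?_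
  have h3 : 1 - a * nome τ ^ r ≠ 0 := fun h => ha (-r) (by
    rw [zpow_neg]
    exact eq_inv_of_mul_eq_one_left (sub_eq_zero.1 h).symm)
  have h4 : thetaCoeff τ (N + 1 - r)
      = -(nome τ ^ (N + 1) * nome τ ^ (-r) * thetaCoeff τ (N - r)) := by
    rw [show N + 1 - r = N - r + 1 by ring, thetaCoeff_add_one, ← zpow_add₀ hq,
      show N + 1 + -r = N - r + 1 by ring]
  have h5 : nome τ ^ (-r) * nome τ ^ r = 1 := by rw [← zpow_add₀ hq]; simp
  rw [h4]
  field_simp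
  linear_combination (-thetaCoeff τ (N - r) * a) * h5

/-- The Laurent coefficients of θ(ax) obey the same first-order recursion, so the two sequences are
proportional. -/
theorem kroneckerCoeff_eq {τ a : ℂ} (hτ : 0 < τ.im) (ha0 : a ≠ 0)
    (ha : ∀ k : ℤ, a ≠ nome τ ^ k) (N : ℤ) :
    kroneckerCoeff τ a N = kroneckerCoeff τ a 0 * (thetaCoeff τ N * a ^ N) := by
  have hq := nome_ne_zero τ
  have step : ∀ N : ℤ, kroneckerCoeff τ a N = kroneckerCoeff τ a 0 * (thetaCoeff τ N * a ^ N) ↔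
      kroneckerCoeff τ a (N + 1) = kroneckerCoeff τ a 0 * (thetaCoeff τ (N + 1) * a ^ (N + 1)) := by
    intro N
    rw [kroneckerCoeff_add_one hτ ha0 ha, thetaCoeff_add_one, zpow_add_one₀ ha0,
      show kroneckerCoeff τ a 0 * (-(nome τ ^ (N + 1) * thetaCoeff τ N) * (a ^ N * a))
        = -(nome τ ^ (N + 1) * a) * (kroneckerCoeff τ a 0 * (thetaCoeff τ N * a ^ N)) by ring]
    exact (mul_right_inj' (neg_ne_zero.2 (mul_ne_zero (zpow_ne_zero _ hq) ha0))).symm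
  induction N using Int.induction_on with
  | zero => simp [thetaCoeff_zero]
  | succ n ih => exact (step _).1 ih
  | pred n ih =>
    refine (step _).2 ?_
    rwa [sub_add_cancel]

theorem hasSum_mul_shear {f g : ℤ → ℂ} (hf : Summable f) (hg : Summable g) :
    HasSum (fun p : ℤ × ℤ => f p.2 * g (p.1 - p.2)) ((∑' n, f n) * ∑' n, g n) :=
  ((Equiv.prodComm ℤ ℤ).trans
    (Equiv.prodShear (Equiv.refl ℤ) fun r => Equiv.subRight r)).hasSum_iff.2
      (hf.hasSum.mul hg.hasSum (summable_mul_of_summable_norm (f := f) (g := g) hf.norm hg.norm))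

/-- Both factors converge absolutely on |q| < |x| < 1, so their product may be collected by total
degree in x. -/
theorem kroneckerSeries_mul_mulTheta {τ a x : ℂ} (hτ : 0 < τ.im) (ha0 : a ≠ 0)
    (ha : ∀ k : ℤ, a ≠ nome τ ^ k) (hx1 : ‖nome τ‖ < ‖x‖) (hx2 : ‖x‖ < 1) :
    kroneckerSeries τ a x * mulTheta τ x = kroneckerCoeff τ a 0 * mulTheta τ (a * x) := by
  have hx0 := ne_zero_of_norm_nome_lt hx1
  have hF := summable_kroneckerSeries hτ ha0 ha hx1 hx2
  have hT := summable_mulTheta hτ hx0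
  have h2 := hasSum_mul_shear (f := fun r : ℤ => x ^ r * (1 - a * nome τ ^ r)⁻¹)
    (g := fun n : ℤ => thetaCoeff τ n * x ^ n) hF hT
  have h3 := h2.prod_fiberwise (g := fun N => kroneckerCoeff τ a 0 * (thetaCoeff τ N * (a * x) ^ N))
    (fun N => by
      have h4 := ((summable_kroneckerCoeff hτ ha0 ha N).hasSum).mul_right (x ^ N)
      rw [← kroneckerCoeff, kroneckerCoeff_eq hτ ha0 ha N] at h4
      rw [mul_zpow, show kroneckerCoeff τ a 0 * (thetaCoeff τ N * (a ^ N * x ^ N))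
        = kroneckerCoeff τ a 0 * (thetaCoeff τ N * a ^ N) * x ^ N by ring]
      refine h4.congr_fun fun r => ?_
      rw [zpow_sub₀ hx0]
      have := zpow_ne_zero r hx0
      field_simp)
  have h3' := h3.tsum_eq.symm
  rw [tsum_mul_left] at h3'
  exact h3'

end

end GenusOneWard

/-! ### The residue at x = 1 and the zeros of theta -/

namespace GenusOneWard

open Complex Filter Topology

noncomputable section

theorem analyticAt_jacobiTheta₂ {τ : ℂ} (hτ : 0 < τ.im) (u : ℂ) :
    AnalyticAt ℂ (fun v => jacobiTheta₂ v τ) u :=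
  Differentiable.analyticAt (fun v => differentiableAt_jacobiTheta₂_fst v hτ) u

/-- Near x the additive variable is recovered through log(y/x), which is centred at 1 and so avoids
the branch cut. -/
theorem analyticAt_mulTheta {τ x : ℂ} (hτ : 0 < τ.im) (hx : x ≠ 0) :
    AnalyticAt ℂ (mulTheta τ) x := by
  obtain ⟨u, hu⟩ := exists_exp_two_pi_eq hx
  have hpi : (2 * Real.pi * I : ℂ) ≠ 0 := by simp [Real.pi_ne_zero]
  have hlog : AnalyticAt ℂ (fun y : ℂ => log (y / x)) x := by
    refine AnalyticAt.clog (by fun_prop (disch := exact hx)) ?_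
    rw [div_self hx]
    exact one_mem_slitPlane
  have h : AnalyticAt ℂ (fun y : ℂ => jacobiTheta₂
      (u + log (y / x) / (2 * Real.pi * I) + 1 / 2 + τ / 2) τ) x :=
    AnalyticAt.fun_comp (analyticAt_jacobiTheta₂ hτ _)
      (((analyticAt_const.add (hlog.div analyticAt_const hpi)).add analyticAt_const).add
        analyticAt_const)
  refine h.congr ?_
  filter_upwards [eventually_ne_nhds hx] with y hy
  rw [← mulTheta_exp, mul_add, Complex.exp_add, hu, mul_div_cancel₀ _ hpi,
    exp_log (div_ne_zero hy hx), mul_div_cancel₀ _ hx]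

/-- The singularity at 1 comes from the terms with r ≥ 0 alone. Subtracting the geometric series
replaces (1 - a q^r)⁻¹ by a q^r/(1 - a q^r), which is summable uniformly in x. -/
theorem norm_kroneckerSeries_sub_le {τ a : ℂ} (hτ : 0 < τ.im) (ha0 : a ≠ 0)
    (ha : ∀ k : ℤ, a ≠ nome τ ^ k) :
    ∃ K : ℝ, ∀ x : ℝ, (1 + ‖nome τ‖) / 2 < x → x < 1 →
      ‖kroneckerSeries τ a x - (1 - (x : ℂ))⁻¹‖ ≤ K := by
  obtain ⟨C, hC, h1, h2⟩ := exists_bound_kronecker hτ ha0 ha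
  have hq1 := norm_nome_lt_one hτ
  have hq0 := norm_nome_pos τ
  -- The midpoint of |q| and 1: staying above it gives the terms with r < 0 the fixed geometric
  -- ratio |q|/x₀.
  set x₀ : ℝ := (1 + ‖nome τ‖) / 2 with hx₀
  have hx₀0 : 0 < x₀ := by positivity
  have hqx₀ : ‖nome τ‖ / x₀ < 1 := (div_lt_one hx₀0).2 (by linarith)
  have hs1 : Summable fun r : ℕ => ‖a‖ * C * ‖nome τ‖ ^ r :=
    (summable_geometric_of_lt_one hq0.le hq1).mul_left _
  have hs2 : Summable fun r : ℕ => C * (‖nome τ‖ / x₀) ^ (r + 1) :=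
    (((summable_geometric_of_lt_one (by positivity) hqx₀).comp_injective
      (add_left_injective 1))).mul_left C
  refine ⟨(∑' r : ℕ, ‖a‖ * C * ‖nome τ‖ ^ r) + ∑' r : ℕ, C * (‖nome τ‖ / x₀) ^ (r + 1),
    fun x hx hx1 => ?_⟩
  have hxpos : 0 < x := hx₀0.trans hx
  have hnx : ‖(x : ℂ)‖ = x := by simp [abs_of_pos hxpos]
  have hF := summable_kroneckerSeries hτ ha0 ha (x := x) (by rw [hnx]; linarith) (by rwa [hnx])
  have hnat : Summable fun r : ℕ => (x : ℂ) ^ (r : ℤ) * (1 - a * nome τ ^ (r : ℤ))⁻¹ :=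
    hF.comp_injective Nat.cast_injective
  have hneg : Summable fun r : ℕ =>
      (x : ℂ) ^ (-((r : ℤ) + 1)) * (1 - a * nome τ ^ (-((r : ℤ) + 1)))⁻¹ :=
    hF.comp_injective (i := fun r : ℕ => -((r : ℤ) + 1)) fun r s h => by simpa using h
  have hgeo : HasSum (fun r : ℕ => (x : ℂ) ^ r) (1 - (x : ℂ))⁻¹ :=
    hasSum_geometric_of_norm_lt_one (by rwa [hnx])
  have hsplit : kroneckerSeries τ a x
      = (∑' r : ℕ, (x : ℂ) ^ (r : ℤ) * (1 - a * nome τ ^ (r : ℤ))⁻¹)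
        + ∑' r : ℕ, (x : ℂ) ^ (-((r : ℤ) + 1)) * (1 - a * nome τ ^ (-((r : ℤ) + 1)))⁻¹ :=
    tsum_of_nat_of_neg_add_one hnat hneg
  rw [hsplit, add_sub_right_comm, ← hgeo.tsum_eq, ← hnat.tsum_sub hgeo.summable]
  refine (norm_add_le _ _).trans (add_le_add ?_ ?_)
  · refine tsum_of_norm_bounded hs1.hasSum fun r => ?_
    have h3 : 1 - a * nome τ ^ (r : ℤ) ≠ 0 := fun h => ha (-r) (by
      rw [zpow_neg]
      exact eq_inv_of_mul_eq_one_left (sub_eq_zero.1 h).symm)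
    have h4 : (x : ℂ) ^ (r : ℤ) * (1 - a * nome τ ^ (r : ℤ))⁻¹ - (x : ℂ) ^ r
        = x ^ r * (a * (1 - a * nome τ ^ (r : ℤ))⁻¹ * nome τ ^ r) := by
      rw [zpow_natCast, zpow_natCast] at *
      field_simp
      ring
    rw [h4, norm_mul, norm_pow, hnx, norm_mul, norm_mul, norm_pow]
    refine (mul_le_of_le_one_left (by positivity) (pow_le_one₀ hxpos.le hx1.le)).trans ?_
    gcongr
    exact h1 r
  · refine tsum_of_norm_bounded hs2.hasSum fun r => ?_
    have h5 := h2 (r + 1)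
    rw [norm_mul, norm_zpow, hnx, zpow_neg]
    push_cast at h5
    refine (mul_le_mul_of_nonneg_left h5 (by positivity)).trans ?_
    rw [mul_left_comm, div_pow, div_eq_inv_mul]
    have : (x ^ ((r : ℤ) + 1))⁻¹ ≤ (x₀ ^ (r + 1))⁻¹ := by
      rw [← Nat.cast_succ, zpow_natCast]
      gcongr
    gcongr

theorem tendsto_ofReal_nhdsLT_one : Tendsto (fun x : ℝ => (x : ℂ)) (𝓝[<] 1) (𝓝[≠] 1) := by
  refine tendsto_nhdsWithin_iff.2 ⟨?_, ?_⟩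
  · have : Tendsto (fun x : ℝ => (x : ℂ)) (𝓝 1) (𝓝 ((1 : ℝ) : ℂ)) :=
      continuous_ofReal.tendsto 1
    rw [ofReal_one] at this
    exact this.mono_left nhdsWithin_le_nhds
  · filter_upwards [self_mem_nhdsWithin] with x hx
    simpa using (ne_of_lt hx : x ≠ 1)

theorem tendsto_one_sub_mul_kroneckerSeries {τ a : ℂ} (hτ : 0 < τ.im) (ha0 : a ≠ 0)
    (ha : ∀ k : ℤ, a ≠ nome τ ^ k) :
    Tendsto (fun x : ℝ => (1 - (x : ℂ)) * kroneckerSeries τ a x) (𝓝[<] 1) (𝓝 1) := by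
  obtain ⟨K, hK⟩ := norm_kroneckerSeries_sub_le hτ ha0 ha
  have hq1 := norm_nome_lt_one hτ
  have hev : ∀ᶠ x : ℝ in 𝓝[<] 1, (1 + ‖nome τ‖) / 2 < x ∧ x < 1 :=
    (Ioo_mem_nhdsLT (by linarith))
  have h0 : Tendsto (fun x : ℝ => 1 - (x : ℂ)) (𝓝[<] 1) (𝓝 0) := by
    have := (tendsto_ofReal_nhdsLT_one.mono_right nhdsWithin_le_nhds).const_sub (1 : ℂ)
    simpa using this
  have h1 : Tendsto (fun x : ℝ => (1 - (x : ℂ)) * (kroneckerSeries τ a x - (1 - (x : ℂ))⁻¹))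
      (𝓝[<] 1) (𝓝 0) := by
    refine h0.zero_mul_isBoundedUnder_le ⟨K, ?_⟩
    rw [eventually_map]
    filter_upwards [hev] with x hx using hK x hx.1 hx.2
  have h2 := h1.const_add (1 : ℂ)
  rw [add_zero] at h2
  refine h2.congr' ?_
  filter_upwards [hev] with x hx
  have : (1 - (x : ℂ)) ≠ 0 := by
    rw [sub_ne_zero]
    exact_mod_cast (ne_of_gt hx.2 : (1 : ℝ) ≠ x)
  field_simp
  ring

theorem eventually_annulus_nhdsLT_one {τ : ℂ} (hτ : 0 < τ.im) :
    ∀ᶠ x : ℝ in 𝓝[<] 1, ‖nome τ‖ < ‖(x : ℂ)‖ ∧ ‖(x : ℂ)‖ < 1 := by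
  have hq0 := norm_nome_pos τ
  filter_upwards [Ioo_mem_nhdsLT (norm_nome_lt_one hτ)] with x hx
  rw [norm_real, Real.norm_eq_abs, abs_of_pos (hq0.trans hx.1)]
  exact hx

/-- Let x → 1 from the left in the product formula: (1 - x) times the Lerch series tends to 1, while
θ(x)/(1 - x) tends to -θ'(1). -/
theorem kroneckerCoeff_mul_mulTheta {τ a : ℂ} (hτ : 0 < τ.im) (ha0 : a ≠ 0)
    (ha : ∀ k : ℤ, a ≠ nome τ ^ k) :
    kroneckerCoeff τ a 0 * mulTheta τ a = -deriv (mulTheta τ) 1 := by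
  have hd := (analyticAt_mulTheta hτ one_ne_zero).differentiableAt.hasDerivAt
  have h1 := (hasDerivAt_iff_tendsto_slope.1 hd).comp tendsto_ofReal_nhdsLT_one
  have h2 := ((tendsto_one_sub_mul_kroneckerSeries hτ ha0 ha).mul h1).neg
  rw [one_mul] at h2
  have h3 : Tendsto (fun x : ℝ => kroneckerCoeff τ a 0 * mulTheta τ (a * x)) (𝓝[<] 1)
      (𝓝 (kroneckerCoeff τ a 0 * mulTheta τ a)) := by
    refine Tendsto.const_mul _ ?_
    refine (analyticAt_mulTheta hτ ha0).continuousAt.tendsto.comp ?_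
    simpa using (tendsto_ofReal_nhdsLT_one.mono_right nhdsWithin_le_nhds).const_mul a
  refine tendsto_nhds_unique h3 (h2.congr' ?_)
  filter_upwards [eventually_annulus_nhdsLT_one hτ, self_mem_nhdsWithin] with x hx hx1
  rw [← kroneckerSeries_mul_mulTheta hτ ha0 ha hx.1 hx.2]
  have h4 : (x : ℂ) - 1 ≠ 0 := by
    rw [sub_ne_zero]
    simpa using (ne_of_lt hx1 : x ≠ 1)
  simp only [Function.comp, slope_def_field, mulTheta_one]
  field_simp
  ring

/-- The integral extracts the zeroth Laurent coefficient. It serves to show that θ is not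
identically zero. -/
theorem integral_mulTheta {τ : ℂ} (hτ : 0 < τ.im) (s : ℂ) :
    ∫ u in (0 : ℝ)..1, mulTheta τ (cexp (2 * Real.pi * I * (u + s))) = 1 := by
  have hterm : ∀ (u : ℝ) (n : ℤ), thetaCoeff τ n * cexp (2 * Real.pi * I * (u + s)) ^ n
      = thetaCoeff τ n * cexp (2 * Real.pi * I * s) ^ n * cexp ((2 * Real.pi * I * n) * u) := by
    intro u n
    rw [mul_add, Complex.exp_add, mul_zpow, ← Complex.exp_int_mul (2 * Real.pi * I * u)]
    rw [show (n : ℂ) * (2 * Real.pi * I * u) = 2 * Real.pi * I * n * u by ring]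
    ring
  have hnorm : ∀ (u : ℝ) (n : ℤ), ‖cexp ((2 * Real.pi * I * n) * u)‖ = 1 := by
    intro u n
    rw [Complex.norm_exp]
    simp
  have hsum := summable_mulTheta hτ (exp_ne_zero (2 * Real.pi * I * s))
  have h := intervalIntegral.hasSum_integral_of_dominated_convergence
    (μ := MeasureTheory.volume) (a := 0) (b := 1)
    (F := fun (n : ℤ) (u : ℝ) => thetaCoeff τ n * cexp (2 * Real.pi * I * s) ^ n *
      cexp ((2 * Real.pi * I * n) * u))
    (f := fun u : ℝ => mulTheta τ (cexp (2 * Real.pi * I * (u + s))))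
    (fun n _ => ‖thetaCoeff τ n * cexp (2 * Real.pi * I * s) ^ n‖)
    (fun n => (Continuous.aestronglyMeasurable (by fun_prop)))
    (fun n => Eventually.of_forall fun u _ => by rw [norm_mul, hnorm, mul_one])
    (Eventually.of_forall fun u _ => hsum.norm)
    (by simp)
    (Eventually.of_forall fun u _ => by
      simp only [← hterm]
      exact (summable_mulTheta hτ (exp_ne_zero _)).hasSum)
  rw [← h.tsum_eq, tsum_eq_single 0]
  · simp [thetaCoeff_zero]
  · intro n hn
    rw [intervalIntegral.integral_const_mul, integral_exp_mul_complex]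
    · have : cexp (2 * Real.pi * I * n * (1 : ℝ)) = 1 := by
        rw [show 2 * Real.pi * I * n * ((1 : ℝ) : ℂ) = n * (2 * Real.pi * I) by push_cast; ring]
        exact exp_int_mul_two_pi_mul_I n
      rw [this]
      simp
    · simpa [Real.pi_ne_zero] using hn

theorem exists_mulTheta_ne_zero {τ : ℂ} (hτ : 0 < τ.im) :
    ∃ a, ‖nome τ‖ < ‖a‖ ∧ ‖a‖ < 1 ∧ mulTheta τ a ≠ 0 := by
  by_contra! h
  -- The shift τ/2 places the circle of integration at |x| = |q|^{1/2}, inside the annulus.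
  have h1 := integral_mulTheta hτ (τ / 2)
  rw [intervalIntegral.integral_congr (g := fun _ => 0)] at h1
  · simp at h1
  · intro u _
    have hpi := Real.pi_pos
    refine h _ ?_ ?_
    · rw [nome, Complex.norm_exp, Complex.norm_exp, Real.exp_lt_exp]
      simp
      nlinarith
    · rw [Complex.norm_exp, Real.exp_lt_one_iff]
      simp
      positivity

theorem zpow_ne_of_annulus {τ a : ℂ} (hτ : 0 < τ.im) (h1 : ‖nome τ‖ < ‖a‖) (h2 : ‖a‖ < 1) (k : ℤ) :
    a ≠ nome τ ^ k := by
  rintro rfl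
  have hq0 := norm_nome_pos τ
  have hq1 := norm_nome_lt_one hτ
  rw [norm_zpow] at h1 h2
  have h3 : 0 < k := by
    by_contra! hk
    exact absurd h2 (not_lt.2 (one_le_zpow_of_nonpos₀ hq0 hq1.le hk))
  have h4 : ‖nome τ‖ ^ k ≤ ‖nome τ‖ ^ (1 : ℤ) := zpow_le_zpow_right_of_le_one₀ hq0 hq1.le h3
  rw [zpow_one] at h4
  linarith

/-- If θ'(1) = 0, choose a with θ(a) ≠ 0; then the Kronecker constant vanishes, and so does the
product of θ with the Lerch series. The latter is nonzero near its pole at 1, so θ vanishes on a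
segment ending at 1, hence identically, a contradiction. -/
theorem deriv_mulTheta_one_ne_zero {τ : ℂ} (hτ : 0 < τ.im) : deriv (mulTheta τ) 1 ≠ 0 := by
  intro hd
  obtain ⟨a, ha1, ha2, hane⟩ := exists_mulTheta_ne_zero hτ
  have ha0 := ne_zero_of_norm_nome_lt ha1
  have ha := zpow_ne_of_annulus hτ ha1 ha2
  have hc := kroneckerCoeff_mul_mulTheta hτ ha0 ha
  rw [hd, neg_zero, mul_eq_zero, or_iff_left hane] at hc
  have hz : ∀ᶠ x : ℝ in 𝓝[<] 1, mulTheta τ x = 0 := by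
    have h1 := (tendsto_one_sub_mul_kroneckerSeries hτ ha0 ha).eventually_ne one_ne_zero
    filter_upwards [eventually_annulus_nhdsLT_one hτ, h1] with x hx hx'
    have h2 := kroneckerSeries_mul_mulTheta hτ ha0 ha hx.1 hx.2
    rw [hc, zero_mul, mul_eq_zero] at h2
    exact h2.resolve_left (right_ne_zero_of_mul hx')
  have hf : ∃ᶠ x in 𝓝[≠] (1 : ℂ), mulTheta τ x = 0 :=
    tendsto_ofReal_nhdsLT_one.frequently hz.frequently
  have hpre : IsPreconnected ({0}ᶜ : Set ℂ) :=
    (isConnected_compl_singleton_of_one_lt_rank (by simp) 0).isPreconnected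
  have han : AnalyticOnNhd ℂ (mulTheta τ) {0}ᶜ := fun x hx => analyticAt_mulTheta hτ hx
  exact hane (han.eqOn_zero_of_preconnected_of_frequently_eq_zero hpre
    (by simp : (1 : ℂ) ∈ ({0}ᶜ : Set ℂ)) hf ha0)

/-- This locates the zeros without counting them: for a outside q^ℤ, θ(a) divides the nonzero number
θ'(1). -/
theorem mulTheta_ne_zero {τ a : ℂ} (hτ : 0 < τ.im) (ha0 : a ≠ 0)
    (ha : ∀ k : ℤ, a ≠ nome τ ^ k) : mulTheta τ a ≠ 0 := fun h =>
  deriv_mulTheta_one_ne_zero hτ (by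
    have := kroneckerCoeff_mul_mulTheta hτ ha0 ha
    rw [h, mul_zero] at this
    exact neg_eq_zero.1 this.symm)

/-! ### The kernel in terms of the multiplicative theta function -/

/-- The kernel `-w_c(w, z)` as a function of `a = e^{-c}`, `z` and `w`. -/
def negKernel (τ a w z : ℂ) : ℂ :=
  -(deriv (mulTheta τ) 1 * mulTheta τ (a * (z / w)) / (mulTheta τ a * (w * mulTheta τ (z / w))))

theorem theta11_eq {τ : ℂ} (x : ℂ) :
    theta11 x τ = cexp (Real.pi * I * τ / 4 + Real.pi * I * (x + 1 / 2)) *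
      mulTheta τ (cexp (2 * Real.pi * I * x)) := by
  rw [mulTheta, theta11, ← tsum_mul_left]
  refine tsum_congr fun n => ?_
  rw [thetaCoeff_mul_exp, jacobiTheta₂_term, ← Complex.exp_add]
  congr 1
  ring

/-- As θ(1) = 0, the derivative of the exponential prefactor does not contribute. -/
theorem deriv_theta11_log {τ : ℂ} (hτ : 0 < τ.im) :
    deriv (fun ζ : ℂ => theta11 (log ζ / (2 * Real.pi * I)) τ) 1
      = cexp (Real.pi * I * τ / 4 + Real.pi * I * (1 / 2)) * deriv (mulTheta τ) 1 := by
  have hpi : (2 * Real.pi * I : ℂ) ≠ 0 := by simp [Real.pi_ne_zero]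
  have h1 : (fun ζ : ℂ => theta11 (log ζ / (2 * Real.pi * I)) τ) =ᶠ[𝓝 1]
      fun ζ => cexp (Real.pi * I * τ / 4 + Real.pi * I * (log ζ / (2 * Real.pi * I) + 1 / 2)) *
        mulTheta τ ζ := by
    filter_upwards [eventually_ne_nhds one_ne_zero] with ζ hζ
    rw [theta11_eq, mul_div_cancel₀ _ hpi, exp_log hζ]
  rw [h1.deriv_eq]
  have hd := (analyticAt_mulTheta hτ one_ne_zero).differentiableAt.hasDerivAt
  have he : DifferentiableAt ℂ (fun ζ : ℂ => cexp (Real.pi * I * τ / 4 +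
      Real.pi * I * (log ζ / (2 * Real.pi * I) + 1 / 2))) 1 := by
    have : DifferentiableAt ℂ log 1 := differentiableAt_log one_mem_slitPlane
    fun_prop
  rw [(he.hasDerivAt.fun_mul hd).deriv]
  simp [mulTheta_one]

/-- The prefactors relating θ₁₁ to θ are exponentials of affine functions of the logarithms and
cancel between numerator and denominator; this removes the dependence on the branch. -/
theorem neg_wardKernel {τ c w z : ℂ} (hτ : 0 < τ.im) (hw : w ≠ 0) (hz : z ≠ 0) :
    -wardKernel τ c w z = negKernel τ (cexp (-c)) w z := by
  have hpi : (2 * Real.pi * I : ℂ) ≠ 0 := by simp [Real.pi_ne_zero]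
  have hzw : z / w ≠ 0 := div_ne_zero hz hw
  rw [wardKernel, negKernel, deriv_theta11_log hτ, theta11_eq, theta11_eq, theta11_eq,
    mul_div_cancel₀ _ hpi, mul_div_cancel₀ _ hpi, mul_div_cancel₀ _ hpi, Complex.exp_add (-c),
    exp_log hzw]
  congr 1
  set A := cexp (Real.pi * I * τ / 4 + Real.pi * I * (1 / 2)) with hA
  have hA0 : A ≠ 0 := exp_ne_zero _
  have e1 : ∀ y : ℂ, cexp (Real.pi * I * τ / 4 + Real.pi * I * (y + 1 / 2))
      = A * cexp (Real.pi * I * y) := by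
    intro y
    rw [hA, ← Complex.exp_add]
    congr 1
    ring
  rw [e1, e1, e1, add_div, mul_add (Real.pi * I), Complex.exp_add (Real.pi * I * (-c / _))]
  have h2 := exp_ne_zero (Real.pi * I * (-c / (2 * Real.pi * I)))
  have h3 := exp_ne_zero (Real.pi * I * (log (z / w) / (2 * Real.pi * I)))
  set B := cexp (Real.pi * I * (-c / (2 * Real.pi * I)))
  set D := cexp (Real.pi * I * (log (z / w) / (2 * Real.pi * I)))
  rw [mul_assoc A B, mul_assoc A D, mul_assoc A (B * D), mul_left_comm w A, mul_left_comm w D,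
    mul_div_mul_left _ _ hA0, mul_div_mul_left _ _ hA0]
  rw [mul_comm B D, mul_assoc D B, mul_div_mul_left _ _ h3, div_mul_div_comm,
    mul_left_comm _ B, mul_assoc B, mul_div_mul_left _ _ h2]

theorem analyticAt_negKernel {E : Type*} [NormedAddCommGroup E] [NormedSpace ℂ E] {τ : ℂ}
    (hτ : 0 < τ.im) {a w z : E → ℂ} {x : E} (ha : AnalyticAt ℂ a x) (hw : AnalyticAt ℂ w x)
    (hz : AnalyticAt ℂ z x) (ha0 : a x ≠ 0) (hw0 : w x ≠ 0) (hz0 : z x ≠ 0)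
    (haq : ∀ k : ℤ, a x ≠ nome τ ^ k) (hzq : ∀ k : ℤ, z x / w x ≠ nome τ ^ k) :
    AnalyticAt ℂ (fun y => negKernel τ (a y) (w y) (z y)) x := by
  have hzw : AnalyticAt ℂ (fun y => z y / w y) x := hz.div hw hw0
  have hzw0 : z x / w x ≠ 0 := div_ne_zero hz0 hw0
  have h1 : AnalyticAt ℂ (fun y => mulTheta τ (a y * (z y / w y))) x :=
    AnalyticAt.fun_comp (analyticAt_mulTheta hτ (mul_ne_zero ha0 hzw0)) (ha.mul hzw)
  have h2 : AnalyticAt ℂ (fun y => mulTheta τ (a y)) x :=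
    AnalyticAt.fun_comp (analyticAt_mulTheta hτ ha0) ha
  have h3 : AnalyticAt ℂ (fun y => mulTheta τ (z y / w y)) x :=
    AnalyticAt.fun_comp (analyticAt_mulTheta hτ hzw0) hzw
  exact ((analyticAt_const.mul h1).div (h2.mul (hw.mul h3)) (mul_ne_zero
    (mulTheta_ne_zero hτ ha0 haq) (mul_ne_zero hw0 (mulTheta_ne_zero hτ hzw0 hzq)))).neg

theorem negKernel_eq {τ a w z : ℂ} (hτ : 0 < τ.im) (ha0 : a ≠ 0)
    (ha : ∀ k : ℤ, a ≠ nome τ ^ k) :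
    negKernel τ a w z
      = w⁻¹ * (kroneckerCoeff τ a 0 * mulTheta τ (a * (z / w)) / mulTheta τ (z / w)) := by
  rw [negKernel, ← neg_div, ← neg_mul, ← kroneckerCoeff_mul_mulTheta hτ ha0 ha]
  have := mulTheta_ne_zero hτ ha0 ha
  rw [mul_right_comm, mul_comm, mul_div_mul_left _ _ this, mul_comm w, div_mul_eq_div_div]
  field_simp

/-- Kronecker's formula at x = z/w. -/
theorem hasSum_negKernel_of_lt {τ a w z : ℂ} (hτ : 0 < τ.im) (ha0 : a ≠ 0)
    (ha : ∀ k : ℤ, a ≠ nome τ ^ k) (hw : w ≠ 0) (h1 : ‖nome τ * w‖ < ‖z‖) (h2 : ‖z‖ < ‖w‖) :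
    HasSum (fun r : ℤ => z ^ r * w ^ (-r - 1) * (1 - a * nome τ ^ r)⁻¹) (negKernel τ a w z) := by
  have hw' := norm_pos_iff.2 hw
  have hx1 : ‖nome τ‖ < ‖z / w‖ := by rwa [norm_div, lt_div_iff₀ hw', ← norm_mul]
  have hx2 : ‖z / w‖ < 1 := by rwa [norm_div, div_lt_one hw']
  have h := (summable_kroneckerSeries hτ ha0 ha hx1 hx2).hasSum.mul_left w⁻¹
  have hne := mulTheta_ne_zero hτ (ne_zero_of_norm_nome_lt hx1) (zpow_ne_of_annulus hτ hx1 hx2)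
  rw [negKernel_eq hτ ha0 ha, ← kroneckerSeries_mul_mulTheta hτ ha0 ha hx1 hx2,
    mul_div_cancel_right₀ _ hne]
  refine h.congr_fun fun r => ?_
  rw [div_zpow, zpow_sub₀ hw, zpow_neg, zpow_one]
  field_simp

/-- The point qz lies in the annulus of the previous expansion, and θ(ax)/θ(x) is multiplied by a⁻¹
under x ↦ qx. The two factors combine to a q^r in the numerator. -/
theorem hasSum_negKernel_of_gt {τ a w z : ℂ} (hτ : 0 < τ.im) (ha0 : a ≠ 0)
    (ha : ∀ k : ℤ, a ≠ nome τ ^ k) (hw : w ≠ 0) (h1 : ‖nome τ * z‖ < ‖w‖) (h2 : ‖w‖ < ‖z‖) :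
    HasSum (fun r : ℤ => z ^ r * w ^ (-r - 1) * (a * nome τ ^ r * (1 - a * nome τ ^ r)⁻¹))
      (negKernel τ a w z) := by
  have hq := nome_ne_zero τ
  have hz : z ≠ 0 := norm_pos_iff.1 ((norm_nonneg _).trans_lt h2)
  have h3 := hasSum_negKernel_of_lt hτ ha0 ha hw (z := nome τ * z)
    (by rw [norm_mul, norm_mul]; gcongr) h1
  have h4 : a * negKernel τ a w (nome τ * z) = negKernel τ a w z := by
    have hzw := div_ne_zero hz hw
    rw [negKernel_eq hτ ha0 ha, negKernel_eq hτ ha0 ha, mul_div_assoc (nome τ) z w, mul_left_comm a (nome τ),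
      mulTheta_nome_mul _ hzw, mulTheta_nome_mul _ (mul_ne_zero ha0 hzw)]
    have h5 : -(nome τ * (z / w))⁻¹ ≠ 0 := neg_ne_zero.2 (inv_ne_zero (mul_ne_zero hq hzw))
    rw [show -(nome τ * (a * (z / w)))⁻¹ = a⁻¹ * -(nome τ * (z / w))⁻¹ by
      rw [mul_left_comm, mul_inv]; ring]
    rw [mul_left_comm _ (a⁻¹ * _), mul_assoc a⁻¹, mul_div_assoc, mul_div_mul_left _ _ h5]
    field_simp
  rw [← h4]
  refine (h3.mul_left a).congr_fun fun r => ?_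
  rw [mul_zpow]
  ring

end

end GenusOneWard

namespace GenusOneWard

open Complex Filter Topology

open scoped ENNReal

noncomputable section

/-! ### Geometric series over finitely supported exponents -/

/-- Splitting off one exponent from a finitely supported family of exponents. -/
def finsuppInsertEquiv {ι : Type*} [DecidableEq ι] {i : ι} {I : Finset ι} (hi : i ∉ I) :
    ℕ × {s : ι →₀ ℕ // s.support ⊆ I} ≃ {s : ι →₀ ℕ // s.support ⊆ insert i I} where
  toFun p := ⟨Finsupp.single i p.1 + p.2.1, by
    refine Finsupp.support_add.trans (Finset.union_subset ?_ ?_)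
    · exact Finsupp.support_single_subset.trans (by simp)
    · exact p.2.2.trans (Finset.subset_insert _ _)⟩
  invFun s := (s.1 i, ⟨s.1.erase i, by
    rw [Finsupp.support_erase]
    intro j hj
    rw [Finset.mem_erase] at hj
    exact (Finset.mem_insert.1 (s.2 hj.2)).resolve_left hj.1⟩)
  left_inv p := by
    have h0 : p.2.1 i = 0 := Finsupp.notMem_support_iff.1 fun h => hi (p.2.2 h)
    refine Prod.ext ?_ (Subtype.ext ?_)
    · simp [h0]
    · ext j
      by_cases hj : j = i
      · subst hj
        simp [h0]
      · simp [Finsupp.erase_ne hj]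
  right_inv s := Subtype.ext (Finsupp.single_add_erase i s.1)

/-- The monomial `∏ xᵢ ^ sᵢ`. -/
def expProd {ι M : Type*} [CommMonoid M] (x : ι → M) (s : ι →₀ ℕ) : M := s.prod fun i k => x i ^ k

theorem expProd_zero {ι M : Type*} [CommMonoid M] (x : ι → M) : expProd x 0 = 1 :=
  Finsupp.prod_zero_index

theorem expProd_add {ι M : Type*} [CommMonoid M] (x : ι → M) (s t : ι →₀ ℕ) :
    expProd x (s + t) = expProd x s * expProd x t := by
  classical
  exact Finsupp.prod_add_index' (by simp) (fun i => pow_add (x i))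

theorem expProd_single {ι M : Type*} [CommMonoid M] (x : ι → M) (i : ι) (k : ℕ) :
    expProd x (Finsupp.single i k) = x i ^ k := by
  exact Finsupp.prod_single_index (h := fun i k => x i ^ k) (pow_zero _)

theorem map_expProd {ι M N F : Type*} [CommMonoid M] [CommMonoid N] [FunLike F M N]
    [MonoidHomClass F M N] (f : F) (x : ι → M) (s : ι →₀ ℕ) :
    f (expProd x s) = expProd (fun i => f (x i)) s := by
  simp [expProd, Finsupp.prod, map_prod]

theorem expProd_mul {ι M : Type*} [CommMonoid M] (x y : ι → M) (s : ι →₀ ℕ) :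
    expProd (fun i => x i * y i) s = expProd x s * expProd y s := by
  simp [expProd, Finsupp.prod, mul_pow, Finset.prod_mul_distrib]

theorem expProd_finsuppInsertEquiv {ι M : Type*} [DecidableEq ι] [CommMonoid M] (x : ι → M) {i : ι}
    {I : Finset ι} (hi : i ∉ I) (p : ℕ × {s : ι →₀ ℕ // s.support ⊆ I}) :
    expProd x (finsuppInsertEquiv hi p).1 = x i ^ p.1 * expProd x p.2.1 := by
  change expProd x (Finsupp.single i p.1 + p.2.1) = _
  rw [expProd_add, expProd_single]

instance uniqueSupportEmpty (ι : Type*) : Unique {s : ι →₀ ℕ // s.support ⊆ ∅} where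
  default := ⟨0, by simp⟩
  uniq s := Subtype.ext (Finsupp.support_eq_empty.1 (Finset.subset_empty.1 s.2))

/-- In extended nonnegative reals the product of geometric series can be expanded without any
convergence hypothesis. -/
theorem tsum_expProd_subset {ι : Type*} (x : ι → ℝ≥0∞) (I : Finset ι) :
    ∑' s : {s : ι →₀ ℕ // s.support ⊆ I}, expProd x s.1 = ∏ i ∈ I, (1 - x i)⁻¹ := by
  classical
  induction I using Finset.induction_on with
  | empty =>
    rw [tsum_eq_single default fun s hs => absurd (Subsingleton.elim _ _) hs, Finset.prod_empty]
    exact expProd_zero x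
  | insert i I hi ih =>
    rw [Finset.prod_insert hi, ← ih, ← (finsuppInsertEquiv hi).tsum_eq, ENNReal.tsum_prod',
      ← ENNReal.tsum_geometric, ← ENNReal.tsum_mul_right]
    refine tsum_congr fun k => ?_
    rw [← ENNReal.tsum_mul_left]
    exact tsum_congr fun s => expProd_finsuppInsertEquiv x hi _

theorem summable_div_one_sub {ι : Type*} {y : ι → ℝ} (h0 : ∀ i, 0 ≤ y i) (hs : Summable y) :
    Summable fun i => y i / (1 - y i) := by
  refine Summable.of_norm_bounded_eventually (g := fun i => 2 * y i) (hs.mul_left 2) ?_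
  have := hs.tendsto_cofinite_zero.eventually (gt_mem_nhds (by norm_num : (0 : ℝ) < 1 / 2))
  filter_upwards [this] with i hi
  rw [Real.norm_eq_abs, abs_of_nonneg (div_nonneg (h0 i) (by linarith)),
    div_le_iff₀ (by linarith)]
  nlinarith [h0 i]

/-- A finite set of exponents involves finitely many indices only, so its sum is at most a finite
product ∏ (1 - y_i)⁻¹; these products are bounded uniformly. -/
theorem summable_expProd_of_nonneg {ι : Type*} {y : ι → ℝ} (h0 : ∀ i, 0 ≤ y i) (h1 : ∀ i, y i < 1)
    (hs : Summable y) : Summable fun s : ι →₀ ℕ => expProd y s := by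
  classical
  have hpos : ∀ s : ι →₀ ℕ, 0 ≤ expProd y s :=
    fun s => Finset.prod_nonneg fun i _ => pow_nonneg (h0 i) _
  set K := Real.exp (∑' i, y i / (1 - y i)) with hK
  have hof : ∀ s : ι →₀ ℕ, ENNReal.ofReal (expProd y s) = expProd (fun i => ENNReal.ofReal (y i)) s := by
    intro s
    rw [expProd, Finsupp.prod, ENNReal.ofReal_prod_of_nonneg fun i _ => pow_nonneg (h0 i) _]
    exact Finset.prod_congr rfl fun i _ => ENNReal.ofReal_pow (h0 i) _
  have hbound : ∀ I : Finset ι, ∏ i ∈ I, (1 - ENNReal.ofReal (y i))⁻¹ ≤ ENNReal.ofReal K := by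
    intro I
    have h2 : ∀ i ∈ I, (1 - ENNReal.ofReal (y i))⁻¹ = ENNReal.ofReal (1 - y i)⁻¹ := by
      intro i _
      rw [ENNReal.ofReal_inv_of_pos (sub_pos.2 (h1 i)), ENNReal.ofReal_sub _ (h0 i),
        ENNReal.ofReal_one]
    have h3 : ∀ i, 0 < (1 - y i) := fun i => sub_pos.2 (h1 i)
    rw [Finset.prod_congr rfl h2, ← ENNReal.ofReal_prod_of_nonneg fun i _ => (inv_pos.2 (h3 i)).le]
    refine ENNReal.ofReal_le_ofReal ?_
    -- (1 - y)⁻¹ = 1 + y/(1 - y) ≤ exp(y/(1 - y)).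
    calc ∏ i ∈ I, (1 - y i)⁻¹ ≤ ∏ i ∈ I, Real.exp (y i / (1 - y i)) := by
          refine Finset.prod_le_prod (fun i _ => (inv_pos.2 (h3 i)).le) fun i _ => ?_
          refine le_trans (le_of_eq ?_) (Real.add_one_le_exp _)
          have := (h3 i).ne'
          field_simp
          ring
      _ = Real.exp (∑ i ∈ I, y i / (1 - y i)) := (Real.exp_sum _ _).symm
      _ ≤ K := Real.exp_le_exp.2 ((summable_div_one_sub h0 hs).sum_le_tsum _
          fun i _ => div_nonneg (h0 i) (h3 i).le)
  refine summable_of_sum_le hpos (c := K) fun T => ?_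
  rw [← ENNReal.ofReal_le_ofReal_iff (Real.exp_pos _).le,
    ENNReal.ofReal_sum_of_nonneg fun s _ => hpos s]
  refine le_trans ?_ (hbound (T.biUnion Finsupp.support))
  rw [← tsum_expProd_subset]
  have h4 : ∀ s : T, s.1.support ⊆ T.biUnion Finsupp.support :=
    fun s => Finset.subset_biUnion_of_mem _ s.2
  calc ∑ s ∈ T, ENNReal.ofReal (expProd y s)
      = ∑ s : T, expProd (fun i => ENNReal.ofReal (y i)) s.1 := by
        rw [Finset.univ_eq_attach, Finset.sum_attach T (fun s => expProd _ s)]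
        exact Finset.sum_congr rfl fun s _ => hof s
    _ = ∑' s : T, expProd (fun i => ENNReal.ofReal (y i)) s.1 := (tsum_fintype _).symm
    _ ≤ _ := ENNReal.tsum_comp_le_tsum_of_injective
        (f := fun s : T => (⟨s.1, h4 s⟩ : {s : ι →₀ ℕ // s.support ⊆ T.biUnion Finsupp.support}))
        (fun s t h => Subtype.ext (Subtype.mk.inj h)) fun s => expProd _ s.1

theorem norm_expProd {ι : Type*} (x : ι → ℂ) (s : ι →₀ ℕ) :
    ‖expProd x s‖ = expProd (fun i => ‖x i‖) s := map_expProd (normHom : ℂ →*₀ ℝ) x s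

theorem summable_norm_expProd {ι : Type*} {x : ι → ℂ} (h1 : ∀ i, ‖x i‖ < 1)
    (hs : Summable fun i => ‖x i‖) : Summable fun s : ι →₀ ℕ => ‖expProd x s‖ := by
  simp only [norm_expProd]
  exact summable_expProd_of_nonneg (fun i => norm_nonneg _) h1 hs

theorem hasSum_expProd_subset {ι : Type*} {x : ι → ℂ} (h1 : ∀ i, ‖x i‖ < 1)
    (hs : Summable fun i => ‖x i‖) (I : Finset ι) :
    HasSum (fun s : {s : ι →₀ ℕ // s.support ⊆ I} => expProd x s.1) (∏ i ∈ I, (1 - x i))⁻¹ := by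
  classical
  have hsum := summable_norm_expProd h1 hs
  induction I using Finset.induction_on with
  | empty =>
    rw [Finset.prod_empty, inv_one]
    convert hasSum_unique fun s : {s : ι →₀ ℕ // s.support ⊆ ∅} => expProd x s.1
    exact (expProd_zero x).symm
  | insert i I hi ih =>
    rw [Finset.prod_insert hi, mul_inv, ← (finsuppInsertEquiv hi).hasSum_iff]
    have hg := hasSum_geometric_of_norm_lt_one (h1 i)
    have hgn : Summable fun k : ℕ => ‖x i ^ k‖ := by
      simp only [norm_pow]
      exact summable_geometric_of_lt_one (norm_nonneg _) (h1 i)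
    have hin : Summable fun s : {s : ι →₀ ℕ // s.support ⊆ I} => ‖expProd x s.1‖ :=
      hsum.comp_injective Subtype.val_injective
    refine (hg.mul ih (summable_mul_of_summable_norm (f := fun k : ℕ => x i ^ k)
      (g := fun s : {s : ι →₀ ℕ // s.support ⊆ I} => expProd x s.1) hgn hin)).congr_fun fun p => ?_
    exact expProd_finsuppInsertEquiv x hi p

/-- Exhaust ι by finite sets I. The sums over exponents supported in I converge by dominated
convergence, and they equal partial products whose inverses converge to the infinite product. -/
theorem hasSum_expProd {ι : Type*} {x : ι → ℂ} (h1 : ∀ i, ‖x i‖ < 1)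
    (hs : Summable fun i => ‖x i‖) :
    HasSum (fun s : ι →₀ ℕ => expProd x s) (∏' i, (1 - x i))⁻¹ := by
  classical
  have hsum := summable_norm_expProd h1 hs
  have hs' : Summable fun i => ‖-x i‖ := by simpa using hs
  have hne : ∏' i, (1 + -x i) ≠ 0 := by
    refine tprod_one_add_ne_zero_of_summable (fun i h => ?_) hs'
    have : x i = 1 := by linear_combination -h
    exact absurd (h1 i) (by simp [this])
  have hmul := (multipliable_one_add_of_summable hs').hasProd
  simp only [← sub_eq_add_neg] at hmul hne
  have h2 : Tendsto (fun I : Finset ι => (∏ i ∈ I, (1 - x i))⁻¹) atTop (𝓝 (∏' i, (1 - x i))⁻¹) :=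
    Tendsto.inv₀ (show Tendsto (fun I => ∏ i ∈ I, (1 - x i)) atTop _ from hmul) hne
  have h3 : Tendsto (fun I : Finset ι => ∑' s : ι →₀ ℕ,
      if s.support ⊆ I then expProd x s else 0) atTop (𝓝 (∑' s : ι →₀ ℕ, expProd x s)) := by
    refine tendsto_tsum_of_dominated_convergence hsum (fun s => ?_) (Eventually.of_forall
      fun I s => ?_)
    · refine tendsto_const_nhds.congr' ?_
      filter_upwards [eventually_ge_atTop s.support] with I hI
      rw [if_pos hI]
    · split_ifs
      · exact le_rfl
      · simp
  have h4 : (fun I : Finset ι => ∑' s : ι →₀ ℕ, if s.support ⊆ I then expProd x s else 0)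
      = fun I : Finset ι => (∏ i ∈ I, (1 - x i))⁻¹ := by
    funext I
    rw [← (hasSum_expProd_subset h1 hs I).tsum_eq]
    exact (tsum_subtype {s : ι →₀ ℕ | s.support ⊆ I} (expProd x)).symm ▸
      tsum_congr fun s => by simp [Set.indicator_apply]
  rw [h4] at h3
  rw [← tendsto_nhds_unique h3 h2]
  exact hsum.of_norm.hasSum

end

end GenusOneWard

namespace GenusOneWard

open Complex Filter Topology

noncomputable section

/-! ### The partition function -/

/-- The eigenvalue of `q^{T[0]} e^{H[0]}` on the oscillator `p`. -/
def modeWeight {R : Type*} (q : ℂ) (wt : R → ℂ) (p : R × ℤ) : ℂ :=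
  q ^ p.2.natAbs * cexp (if 0 ≤ p.2 then -wt p.1 else wt p.1)

theorem expProd_modeWeight {R : Type*} (q : ℂ) (wt : R → ℂ) (s : R × ℤ →₀ ℕ) :
    expProd (modeWeight q wt) s = q ^ ghostEnergy s * cexp (ghostCharge wt s) := by
  rw [ghostEnergy, ghostCharge, Finsupp.sum, Finsupp.sum, Complex.exp_sum, ← Finset.prod_pow_eq_pow_sum,
    ← Finset.prod_mul_distrib]
  refine Finset.prod_congr rfl fun p _ => ?_
  simp only [modeWeight]
  rw [mul_pow, ← pow_mul, mul_comm p.2.natAbs, ← Complex.exp_nat_mul]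

/-- The oscillator weights as a function of `a = e^{α(H)}`. -/
def oscWeight (q a : ℂ) (k : ℤ) : ℂ := q ^ k.natAbs * if 0 ≤ k then a⁻¹ else a

theorem modeWeight_eq {R : Type*} (q : ℂ) (wt : R → ℂ) (p : R × ℤ) :
    modeWeight q wt p = oscWeight q (cexp (wt p.1)) p.2 := by
  rw [modeWeight, oscWeight]
  split_ifs <;> simp [Complex.exp_neg]

theorem summable_pow_natAbs {r : ℝ} (h0 : 0 ≤ r) (h1 : r < 1) :
    Summable fun k : ℤ => r ^ k.natAbs := by
  refine Summable.of_nat_of_neg ?_ ?_ <;> simpa using summable_geometric_of_lt_one h0 h1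

theorem norm_oscWeight_le {q a : ℂ} {B : ℝ} (h1 : ‖a‖ ≤ B) (h2 : ‖a‖⁻¹ ≤ B) (k : ℤ) :
    ‖oscWeight q a k‖ ≤ ‖q‖ ^ k.natAbs * B := by
  rw [oscWeight, norm_mul, norm_pow]
  gcongr
  split_ifs
  · rwa [norm_inv]
  · exact h1

theorem summable_norm_oscWeight {q : ℂ} (hq : ‖q‖ < 1) (a : ℂ) :
    Summable fun k => ‖oscWeight q a k‖ :=
  Summable.of_nonneg_of_le (fun _ => norm_nonneg _)
    (fun k => norm_oscWeight_le (le_max_left ‖a‖ ‖a‖⁻¹) (le_max_right _ _) k)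
    ((summable_pow_natAbs (norm_nonneg q) hq).mul_right _)

/-- The inverse of the partition function of one `βγ` pair. -/
def oscProduct (q a : ℂ) : ℂ := ∏' k : ℤ, (1 + -oscWeight q a k)

theorem analyticAt_oscProduct {q a : ℂ} (hq : ‖q‖ < 1) (ha : a ≠ 0) :
    AnalyticAt ℂ (oscProduct q) a := by
  have ha' := norm_pos_iff.2 ha
  -- On this ball both |b| and |b|⁻¹ are bounded, so one summable majorant serves all the factors.
  set U := Metric.ball a (‖a‖ / 2) with hU
  have hb : ∀ b ∈ U, ‖a‖ / 2 ≤ ‖b‖ ∧ ‖b‖ ≤ 2 * ‖a‖ := by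
    intro b hb
    rw [hU, Metric.mem_ball, dist_eq_norm] at hb
    have h1 := norm_sub_norm_le a b
    have h2 := norm_sub_norm_le b a
    rw [norm_sub_rev] at h1
    exact ⟨by linarith, by linarith⟩
  have hne : ∀ b ∈ U, b ≠ 0 := fun b h => norm_pos_iff.1 ((half_pos ha').trans_le (hb b h).1)
  have h := Summable.hasProdLocallyUniformlyOn_one_add (f := fun k b => -oscWeight q b k) (K := U)
    Metric.isOpen_ball
    (u := fun k : ℤ => ‖q‖ ^ k.natAbs * max (2 * ‖a‖) (‖a‖ / 2)⁻¹)
    ((summable_pow_natAbs (norm_nonneg q) hq).mul_right _)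
    (Eventually.of_forall fun k b hbU => by
      rw [norm_neg]
      refine norm_oscWeight_le ((hb b hbU).2.trans (le_max_left _ _)) (le_trans ?_ (le_max_right _ _)) k
      exact inv_anti₀ (half_pos ha') (hb b hbU).1)
    (fun k => by
      unfold oscWeight
      split_ifs
      · exact (continuousOn_const.mul (continuousOn_id.inv₀ hne)).neg
      · exact (continuousOn_const.mul continuousOn_id).neg)
  have hd : DifferentiableOn ℂ (oscProduct q) U := by
    refine h.differentiableOn (Eventually.of_forall fun I => ?_) Metric.isOpen_ball
    refine DifferentiableOn.fun_finsetProd (f := fun k b => 1 + -oscWeight q b k) fun k _ => ?_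
    unfold oscWeight
    split_ifs
    · exact (differentiableOn_const 1).add ((differentiableOn_const _).mul
        (differentiableOn_id.inv hne)).neg
    · exact (differentiableOn_const 1).add ((differentiableOn_const _).mul
        differentiableOn_id).neg
  exact hd.analyticAt (Metric.ball_mem_nhds _ (half_pos ha'))

/-- An absolutely convergent product vanishes only if a factor does, and the factors 1 - q^k/a for k
≥ 0 and 1 - q^k a for k ≥ 1 vanish only at powers of q. -/
theorem oscProduct_ne_zero {q a : ℂ} (hq0 : q ≠ 0) (hq : ‖q‖ < 1) (ha0 : a ≠ 0)
    (ha : ∀ k : ℤ, a ≠ q ^ k) :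
    oscProduct q a ≠ 0 := by
  refine tprod_one_add_ne_zero_of_summable (fun k h => ?_) (by simpa using summable_norm_oscWeight hq a)
  have h1 : oscWeight q a k = 1 := by linear_combination -h
  rw [oscWeight] at h1
  have hqk := pow_ne_zero k.natAbs hq0
  split_ifs at h1 with hk
  · refine ha k.natAbs ?_
    rw [zpow_natCast]
    field_simp at h1
    exact h1.symm
  · refine ha (-k.natAbs) ?_
    rw [zpow_neg, zpow_natCast]
    exact eq_inv_of_mul_eq_one_right h1

/-- The partition function `Tr q^{T[0]} e^{H[0]}` of the ghosts. -/
def partitionFunction {R : Type*} [Fintype R] (q : ℂ) (wt : R → ℂ) : ℂ :=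
  (∏ α, oscProduct q (cexp (wt α)))⁻¹

/-- The extreme oscillators are γ[0], of weight e^{-α(H)}, and β[-1], of weight q e^{α(H)}. They
account for the two inequalities on e^{α(H)}. -/
theorem norm_modeWeight_lt_one {R : Type*} {q : ℂ} {wt : R → ℂ} (hq : ‖q‖ < 1)
    (hwt : ∀ α, 1 < ‖cexp (wt α)‖ ∧ ‖q * cexp (wt α)‖ < 1) (p : R × ℤ) :
    ‖modeWeight q wt p‖ < 1 := by
  obtain ⟨h1, h2⟩ := hwt p.1
  have hpos : 0 < ‖cexp (wt p.1)‖ := zero_lt_one.trans h1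
  rw [modeWeight_eq, oscWeight, norm_mul, norm_pow]
  split_ifs with h
  · rw [norm_inv]
    exact mul_lt_one_of_nonneg_of_lt_one_right (pow_le_one₀ (norm_nonneg _) hq.le)
      (by positivity) (inv_lt_one_of_one_lt₀ h1)
  · have h3 : 1 ≤ p.2.natAbs := by omega
    refine lt_of_le_of_lt ?_ h2
    rw [norm_mul]
    gcongr
    calc ‖q‖ ^ p.2.natAbs ≤ ‖q‖ ^ 1 := pow_le_pow_of_le_one (norm_nonneg _) hq.le h3
      _ = ‖q‖ := pow_one _

theorem summable_norm_modeWeight {R : Type*} [Fintype R] {q : ℂ} (wt : R → ℂ) (hq : ‖q‖ < 1) :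
    Summable fun p => ‖modeWeight q wt p‖ := by
  rw [summable_prod_of_nonneg fun _ => norm_nonneg _]
  simp only [modeWeight_eq]
  exact ⟨fun α => summable_norm_oscWeight hq _, summable_of_hasFiniteSupport (Set.toFinite _)⟩

theorem tprod_prod_fintype {R : Type*} [Fintype R] {f : R × ℤ → ℂ} (h : Summable fun p => ‖f p‖) :
    ∏' p, (1 + f p) = ∏ α, ∏' k, (1 + f (α, k)) := by
  have hα : ∀ α, Summable fun k => ‖f (α, k)‖ := fun α =>
    h.comp_injective (i := fun k => (α, k)) fun _ _ h => (Prod.mk.inj h).2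
  have h1 := (multipliable_one_add_of_summable h).hasProd.prod_fiberwise
    fun α => (multipliable_one_add_of_summable (hα α)).hasProd
  rw [← h1.tprod_eq, tprod_fintype]

theorem hasSum_partitionFunction {R : Type*} [Fintype R] {q : ℂ} {wt : R → ℂ} (hq : ‖q‖ < 1)
    (hwt : ∀ α, 1 < ‖cexp (wt α)‖ ∧ ‖q * cexp (wt α)‖ < 1) :
    HasSum (fun s => expProd (modeWeight q wt) s) (partitionFunction q wt) := by
  have hs := summable_norm_modeWeight wt hq
  have h := hasSum_expProd (norm_modeWeight_lt_one hq hwt) hs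
  have h2 : ∏' p : R × ℤ, (1 - modeWeight q wt p) = ∏ α, oscProduct q (cexp (wt α)) := by
    simp only [sub_eq_add_neg]
    rw [tprod_prod_fintype (f := fun p => -modeWeight q wt p) (by simpa only [norm_neg] using hs)]
    refine Finset.prod_congr rfl fun α _ => tprod_congr fun k => ?_
    rw [modeWeight_eq]
  rw [h2] at h
  exact h

end

end GenusOneWard

namespace GenusOneWard

noncomputable section

/-! ### Convolution products of fields -/

section Fields

variable {V : Type*} [AddCommGroup V] [Module ℂ V]

/-- The modes of a field which kill a given vector are bounded. -/
def LowerBdd (O : ℤ → Module.End ℂ V) : Prop := ∀ v, ∃ K, ∀ k, K < k → O k v = 0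

/-- All modes of two fields commute. -/
def FComm (O O' : ℤ → Module.End ℂ V) : Prop := ∀ k l v, O k (O' l v) = O' l (O k v)

/-- The modes of the product of two fields are finite sums on each vector. -/
def GoodPair (O O' : ℤ → Module.End ℂ V) : Prop :=
  ∀ m v, (Function.support fun k => O k (O' (m - k) v)).Finite

open Classical in
/-- The product of two fields, mode by mode. -/
def conv (O O' : ℤ → Module.End ℂ V) (m : ℤ) : Module.End ℂ V :=
  if h : GoodPair O O' then
    { toFun := fun v => ∑ᶠ k, O k (O' (m - k) v)
      map_add' := fun v w => by
        simp only [map_add]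
        exact finsum_add_distrib (h m v) (h m w)
      map_smul' := fun c v => by
        simp only [map_smul, RingHom.id_apply]
        exact (smul_finsum c _).symm }
  else 0

theorem conv_apply {O O' : ℤ → Module.End ℂ V} (h : GoodPair O O') (m : ℤ) (v : V) :
    conv O O' m v = ∑ᶠ k, O k (O' (m - k) v) := by
  rw [conv, dif_pos h]
  rfl

/-- The identity field. -/
def unitField : ℤ → Module.End ℂ V := fun m => if m = 0 then 1 else 0

theorem FComm.symm {O O' : ℤ → Module.End ℂ V} (h : FComm O O') : FComm O' O :=
  fun k l v => (h l k v).symm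

theorem fcomm_zero (O : ℤ → Module.End ℂ V) : FComm O 0 := fun k l v => by simp

theorem fcomm_unitField (O : ℤ → Module.End ℂ V) : FComm O unitField := fun k l v => by
  by_cases h : l = 0 <;> simp [unitField, h]

theorem FComm.smul {O O₁ : ℤ → Module.End ℂ V} (h₁ : FComm O O₁) (c : ℂ) :
    FComm O (c • O₁) := fun k l v => by simp [h₁ k l v]

theorem FComm.neg {O O₁ : ℤ → Module.End ℂ V} (h₁ : FComm O O₁) : FComm O (-O₁) :=
  fun k l v => by simp [h₁ k l v]

theorem FComm.sum {ι : Type*} {O : ℤ → Module.End ℂ V} {O₁ : ι → ℤ → Module.End ℂ V} {I : Finset ι}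
    (h : ∀ i ∈ I, FComm O (O₁ i)) : FComm O (∑ i ∈ I, O₁ i) := fun k l v => by
  simp only [Finset.sum_apply, LinearMap.sum_apply, map_sum]
  exact Finset.sum_congr rfl fun i hi => h i hi k l v

theorem lowerBdd_zero : LowerBdd (0 : ℤ → Module.End ℂ V) := fun v => ⟨0, fun k _ => by simp⟩

theorem lowerBdd_unitField : LowerBdd (unitField : ℤ → Module.End ℂ V) := fun v =>
  ⟨0, fun k hk => by simp [unitField, hk.ne']⟩

theorem LowerBdd.add {O O' : ℤ → Module.End ℂ V} (h : LowerBdd O) (h' : LowerBdd O') :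
    LowerBdd (O + O') := fun v => by
  obtain ⟨K, hK⟩ := h v
  obtain ⟨K', hK'⟩ := h' v
  exact ⟨max K K', fun k hk => by
    simp [hK k ((le_max_left _ _).trans_lt hk), hK' k ((le_max_right _ _).trans_lt hk)]⟩

theorem LowerBdd.smul {O : ℤ → Module.End ℂ V} (h : LowerBdd O) (c : ℂ) :
    LowerBdd (c • O) := fun v => by
  obtain ⟨K, hK⟩ := h v
  exact ⟨K, fun k hk => by simp [hK k hk]⟩

theorem LowerBdd.neg {O : ℤ → Module.End ℂ V} (h : LowerBdd O) : LowerBdd (-O) := fun v => by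
  obtain ⟨K, hK⟩ := h v
  exact ⟨K, fun k hk => by simp [hK k hk]⟩

theorem LowerBdd.sum {ι : Type*} {O : ι → ℤ → Module.End ℂ V} {I : Finset ι}
    (h : ∀ i ∈ I, LowerBdd (O i)) : LowerBdd (∑ i ∈ I, O i) := by
  classical
  induction I using Finset.induction_on with
  | empty => simpa using lowerBdd_zero
  | insert i I hi ih =>
    rw [Finset.sum_insert hi]
    exact (h i (Finset.mem_insert_self i I)).add (ih fun j hj => h j (Finset.mem_insert_of_mem hj))

/-- Commutation allows either factor to act on v first, so one field bounds k from above and the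
other bounds m - k from above. -/
theorem FComm.goodPair {O O' : ℤ → Module.End ℂ V} (h : FComm O O') (hO : LowerBdd O)
    (hO' : LowerBdd O') : GoodPair O O' := by
  intro m v
  obtain ⟨K, hK⟩ := hO v
  obtain ⟨K', hK'⟩ := hO' v
  refine (Set.finite_Icc (m - K') K).subset fun k hk => ?_
  constructor
  · by_contra! hlt
    exact hk (by simp [hK' (m - k) (by omega)])
  · by_contra! hlt
    exact hk (by simp [h k, hK k hlt])

theorem conv_apply_of_fcomm {O O' : ℤ → Module.End ℂ V} (h : FComm O O') (hO : LowerBdd O)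
    (hO' : LowerBdd O') (m : ℤ) (v : V) : conv O O' m v = ∑ᶠ k, O k (O' (m - k) v) :=
  conv_apply (h.goodPair hO hO') m v

theorem LowerBdd.conv {O O' : ℤ → Module.End ℂ V} (hO : LowerBdd O) (hO' : LowerBdd O')
    (h : FComm O O') : LowerBdd (conv O O') := by
  intro v
  obtain ⟨K, hK⟩ := hO v
  obtain ⟨K', hK'⟩ := hO' v
  refine ⟨K + K', fun m hm => ?_⟩
  rw [conv_apply_of_fcomm h hO hO']
  refine finsum_eq_zero_of_forall_eq_zero fun k => ?_
  by_cases hk : K < k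
  · rw [h, hK k hk, map_zero]
  · rw [hK' (m - k) (by omega), map_zero]

theorem FComm.conv {P O O' : ℤ → Module.End ℂ V} (h : FComm P O) (h' : FComm P O') :
    FComm P (conv O O') := by
  intro k l v
  by_cases hg : GoodPair O O'
  · rw [conv_apply hg, conv_apply hg, ← LinearMap.toAddMonoidHom_coe,
      AddMonoidHom.map_finsum _ (hg l v)]
    refine finsum_congr fun j => ?_
    simp only [LinearMap.toAddMonoidHom_coe]
    rw [h, h']
  · simp [GenusOneWard.conv, hg]

theorem conv_comm {O O' : ℤ → Module.End ℂ V} (h : FComm O O') (hO : LowerBdd O)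
    (hO' : LowerBdd O') : conv O O' = conv O' O := by
  funext m
  refine LinearMap.ext fun v => ?_
  rw [conv_apply_of_fcomm h hO hO', conv_apply_of_fcomm h.symm hO' hO,
    ← finsum_comp_equiv (Equiv.subLeft m)]
  refine finsum_congr fun k => ?_
  rw [Equiv.subLeft_apply, h]
  simp

/-- Any of the three pairwise commuting factors can be made to act first. This bounds all three
indices, so the double sum is finite and may be rearranged. -/
theorem conv_assoc {O O' O'' : ℤ → Module.End ℂ V} (h : FComm O O') (h1 : FComm O O'')
    (h2 : FComm O' O'') (hO : LowerBdd O) (hO' : LowerBdd O') (hO'' : LowerBdd O'') :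
    conv (conv O O') O'' = conv O (conv O' O'') := by
  funext m
  refine LinearMap.ext fun v => ?_
  obtain ⟨K, hK⟩ := hO v
  obtain ⟨K', hK'⟩ := hO' v
  obtain ⟨K'', hK''⟩ := hO'' v
  have hL := conv_apply_of_fcomm (FComm.conv h1.symm h2.symm).symm (hO.conv hO' h) hO'' m v
  have hR := conv_apply_of_fcomm (FComm.conv h h1) hO (hO'.conv hO'' h2) m v
  rw [hL, hR]
  simp only [conv_apply_of_fcomm h hO hO', conv_apply_of_fcomm h2 hO' hO'']
  have hfin : (Function.support fun p : ℤ × ℤ =>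
      O p.1 (O' p.2 (O'' (m - p.1 - p.2) v))).Finite := by
    refine ((Set.finite_Icc (m - K' - K'') K).prod (Set.finite_Icc (m - K - K'') K')).subset ?_
    rintro ⟨i, j⟩ hij
    have e1 : i ≤ K := by
      by_contra! hlt
      refine hij ?_
      change O i (O' j (O'' (m - i - j) v)) = 0
      rw [h, h1, hK i hlt, map_zero, map_zero]
    have e2 : j ≤ K' := by
      by_contra! hlt
      refine hij ?_
      change O i (O' j (O'' (m - i - j) v)) = 0
      rw [h2, hK' j hlt, map_zero, map_zero]
    have e3 : m - i - j ≤ K'' := by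
      by_contra! hlt
      refine hij ?_
      change O i (O' j (O'' (m - i - j) v)) = 0
      rw [hK'' _ hlt, map_zero, map_zero]
    simp only [Set.mem_prod, Set.mem_Icc]
    omega
  have hRin : ∀ i, O i (∑ᶠ j, O' j (O'' (m - i - j) v))
      = ∑ᶠ j, O i (O' j (O'' (m - i - j) v)) := fun i => by
    have := AddMonoidHom.map_finsum (O i).toAddMonoidHom (h2.goodPair hO' hO'' (m - i) v)
    exact this
  simp only [hRin]
  rw [← finsum_curry (fun p : ℤ × ℤ => O p.1 (O' p.2 (O'' (m - p.1 - p.2) v))) hfin]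
  let e : ℤ × ℤ ≃ ℤ × ℤ :=
    (Equiv.prodComm ℤ ℤ).trans (Equiv.prodShear (Equiv.refl ℤ) fun r => Equiv.subRight r)
  have he : ∀ k j : ℤ, e (k, j) = (j, k - j) := fun k j => rfl
  rw [← finsum_comp_equiv e, finsum_curry]
  · refine finsum_congr fun k => finsum_congr fun j => ?_
    rw [he]
    simp only
    rw [show m - j - (k - j) = m - k by ring]
  · exact Set.Finite.preimage e.injective.injOn hfin

theorem unitField_conv (O : ℤ → Module.End ℂ V) (hO : LowerBdd O) : conv unitField O = O := by
  funext m
  refine LinearMap.ext fun v => ?_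
  rw [conv_apply_of_fcomm (fcomm_unitField O).symm lowerBdd_unitField hO, finsum_eq_single _ 0]
  · simp [unitField]
  · intro k hk
    simp [unitField, hk]

theorem GoodPair.add_left {O O₁ O' : ℤ → Module.End ℂ V} (h : GoodPair O O')
    (h₁ : GoodPair O₁ O') : GoodPair (O + O₁) O' := fun m v =>
  ((h m v).union (h₁ m v)).subset (Function.support_add _ _)

theorem conv_add_left {O O₁ O' : ℤ → Module.End ℂ V} (h : GoodPair O O') (h₁ : GoodPair O₁ O') :
    conv (O + O₁) O' = conv O O' + conv O₁ O' := by
  funext m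
  refine LinearMap.ext fun v => ?_
  rw [conv_apply (h.add_left h₁), Pi.add_apply, LinearMap.add_apply, conv_apply h, conv_apply h₁,
    ← finsum_add_distrib (h m v) (h₁ m v)]
  rfl

theorem goodPair_zero_left (O : ℤ → Module.End ℂ V) : GoodPair 0 O := fun m v => by
  simp [Function.support]

theorem conv_zero_left (O : ℤ → Module.End ℂ V) : conv 0 O = 0 := by
  funext m
  refine LinearMap.ext fun v => ?_
  rw [conv_apply (goodPair_zero_left O)]
  simp

theorem goodPair_zero_right (O : ℤ → Module.End ℂ V) : GoodPair O 0 := fun m v => by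
  simp [Function.support]

theorem conv_zero_right (O : ℤ → Module.End ℂ V) : conv O 0 = 0 := by
  funext m
  refine LinearMap.ext fun v => ?_
  rw [conv_apply (goodPair_zero_right O)]
  simp

theorem GoodPair.smul_left {O O' : ℤ → Module.End ℂ V} (h : GoodPair O O') (c : ℂ) :
    GoodPair (c • O) O' := fun m v =>
  (h m v).subset fun k hk => fun h0 => hk (by
    change O k (O' (m - k) v) = 0 at h0
    simp [h0])

theorem conv_smul_left {O O' : ℤ → Module.End ℂ V} (h : GoodPair O O') (c : ℂ) :
    conv (c • O) O' = c • conv O O' := by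
  funext m
  refine LinearMap.ext fun v => ?_
  rw [conv_apply (h.smul_left c), Pi.smul_apply, LinearMap.smul_apply, conv_apply h, smul_finsum]
  rfl

theorem GoodPair.neg_left {O O' : ℤ → Module.End ℂ V} (h : GoodPair O O') : GoodPair (-O) O' :=
  fun m v => (h m v).subset fun k hk => fun h0 => hk (by
    change O k (O' (m - k) v) = 0 at h0
    simp [h0])

theorem conv_neg_left {O O' : ℤ → Module.End ℂ V} (h : GoodPair O O') :
    conv (-O) O' = -conv O O' := by
  funext m
  refine LinearMap.ext fun v => ?_
  rw [conv_apply h.neg_left, Pi.neg_apply, LinearMap.neg_apply, conv_apply h,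
    ← finsum_neg_distrib]
  rfl

theorem GoodPair.sum_left {ι : Type*} {O : ι → ℤ → Module.End ℂ V} {O' : ℤ → Module.End ℂ V}
    {I : Finset ι} (h : ∀ i ∈ I, GoodPair (O i) O') : GoodPair (∑ i ∈ I, O i) O' := by
  classical
  induction I using Finset.induction_on with
  | empty => simpa using goodPair_zero_left O'
  | insert i I hi ih =>
    rw [Finset.sum_insert hi]
    exact (h i (Finset.mem_insert_self i I)).add_left
      (ih fun j hj => h j (Finset.mem_insert_of_mem hj))

theorem conv_sum_left {ι : Type*} {O : ι → ℤ → Module.End ℂ V} {O' : ℤ → Module.End ℂ V}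
    {I : Finset ι} (h : ∀ i ∈ I, GoodPair (O i) O') :
    conv (∑ i ∈ I, O i) O' = ∑ i ∈ I, conv (O i) O' := by
  classical
  induction I using Finset.induction_on with
  | empty => simpa using conv_zero_left O'
  | insert i I hi ih =>
    have h' : ∀ j ∈ I, GoodPair (O j) O' := fun j hj => h j (Finset.mem_insert_of_mem hj)
    rw [Finset.sum_insert hi, Finset.sum_insert hi, conv_add_left
      (h i (Finset.mem_insert_self i I)) (GoodPair.sum_left h'), ih h']

/-! ### Commutators with fields -/

/-- `[D, O(z)] = z^r O₁(z)`. -/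
def FieldBracket (D : Module.End ℂ V) (r : ℤ) (O O₁ : ℤ → Module.End ℂ V) : Prop :=
  ∀ k v, D (O k v) - O k (D v) = O₁ (k + r) v

theorem FComm.fieldBracket {P O : ℤ → Module.End ℂ V} (h : FComm P O) (k r : ℤ) :
    FieldBracket (P k) r O 0 := fun l v => by simp [h k l v]

theorem fieldBracket_zero (D : Module.End ℂ V) (r : ℤ) : FieldBracket D r 0 0 := fun k v => by simp

theorem FieldBracket.add {D : Module.End ℂ V} {r : ℤ} {O O₁ O' O₁' : ℤ → Module.End ℂ V}
    (h : FieldBracket D r O O₁) (h' : FieldBracket D r O' O₁') :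
    FieldBracket D r (O + O') (O₁ + O₁') := fun k v => by
  simp only [Pi.add_apply, LinearMap.add_apply, map_add, ← h k v, ← h' k v]
  abel

theorem FieldBracket.smul {D : Module.End ℂ V} {r : ℤ} {O O₁ : ℤ → Module.End ℂ V}
    (h : FieldBracket D r O O₁) (c : ℂ) : FieldBracket D r (c • O) (c • O₁) := fun k v => by
  simp only [Pi.smul_apply, LinearMap.smul_apply, map_smul, ← h k v, smul_sub]

theorem FieldBracket.sum {ι : Type*} {D : Module.End ℂ V} {r : ℤ}
    {O O₁ : ι → ℤ → Module.End ℂ V} {I : Finset ι}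
    (h : ∀ i ∈ I, FieldBracket D r (O i) (O₁ i)) :
    FieldBracket D r (∑ i ∈ I, O i) (∑ i ∈ I, O₁ i) := by
  classical
  induction I using Finset.induction_on with
  | empty => simpa using fieldBracket_zero D r
  | insert i I hi ih =>
    rw [Finset.sum_insert hi, Finset.sum_insert hi]
    exact (h i (Finset.mem_insert_self i I)).add (ih fun j hj => h j (Finset.mem_insert_of_mem hj))

/-- The Leibniz rule for [D, ·]; the shift by r is absorbed into the summation index in the term
where D meets the first factor. -/
theorem FieldBracket.conv {D : Module.End ℂ V} {r : ℤ} {O O₁ O' O₁' : ℤ → Module.End ℂ V}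
    (h : FieldBracket D r O O₁) (h' : FieldBracket D r O' O₁') (hg : GoodPair O O')
    (hg₁ : GoodPair O₁ O') (hg' : GoodPair O O₁') :
    FieldBracket D r (conv O O') (conv O₁ O' + conv O O₁') := by
  intro m v
  have e1 : D (∑ᶠ k, O k (O' (m - k) v)) = ∑ᶠ k, D (O k (O' (m - k) v)) :=
    AddMonoidHom.map_finsum D.toAddMonoidHom (hg m v)
  have f1 : (Function.support fun k => D (O k (O' (m - k) v))).Finite :=
    (hg m v).subset fun k hk h0 => hk (by
      change O k (O' (m - k) v) = 0 at h0
      simp [h0])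
  have e2 : ∑ᶠ k, O₁ k (O' (m + r - k) v) = ∑ᶠ k, O₁ (k + r) (O' (m - k) v) := by
    rw [← finsum_comp_equiv (Equiv.addRight r)]
    refine finsum_congr fun k => ?_
    rw [Equiv.coe_addRight, show m + r - (k + r) = m - k by ring]
  have f2 : (Function.support fun k => O₁ (k + r) (O' (m - k) v)).Finite := by
    refine ((hg₁ (m + r) v).preimage (Equiv.addRight r).injective.injOn).subset fun k hk => ?_
    simp only [Set.mem_preimage, Function.mem_support, Equiv.coe_addRight]
    rwa [show m + r - (k + r) = m - k by ring]
  rw [Pi.add_apply, LinearMap.add_apply, conv_apply hg, conv_apply hg, conv_apply hg₁,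
    conv_apply hg', e1, e2, ← finsum_sub_distrib f1 (hg m (D v)),
    ← finsum_add_distrib f2 (hg' (m + r) v)]
  refine finsum_congr fun k => ?_
  rw [← h k, show m + r - k = m - k + r by ring, ← h' (m - k), map_sub]
  abel

theorem FieldBracket.congr {D : Module.End ℂ V} {r : ℤ} {O O₁ O₂ : ℤ → Module.End ℂ V}
    (h : FieldBracket D r O O₁) (e : O₁ = O₂) : FieldBracket D r O O₂ := e ▸ h

/-- The bracket of two modes depends only on the sum of their indices, so it can be read as the
action of either field on the other. -/
theorem fieldBracket_swap {O P O₁ : ℤ → Module.End ℂ V}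
    (h : ∀ k, FieldBracket (P k) k O O₁) (r : ℤ) : FieldBracket (O r) r P (-O₁) := fun k v => by
  have := h k r v
  rw [Pi.neg_apply, LinearMap.neg_apply, add_comm k r, ← this]
  abel

/-! ### Homogeneous fields -/

/-- The field has conformal weight zero and charge `χ` with respect to the grading operator `Q`. -/
def Homogeneous (q : ℂ) (Q : Module.End ℂ V) (χ : ℂ) (O : ℤ → Module.End ℂ V) : Prop :=
  ∀ k v, Q (O k v) = (q ^ (-k) * χ) • O k (Q v)

theorem homogeneous_unitField (q : ℂ) (Q : Module.End ℂ V) : Homogeneous q Q 1 unitField :=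
  fun k v => by
    by_cases h : k = 0 <;> simp [unitField, h]

theorem Homogeneous.smul {q χ : ℂ} {Q : Module.End ℂ V} {O : ℤ → Module.End ℂ V}
    (h : Homogeneous q Q χ O) (c : ℂ) : Homogeneous q Q χ (c • O) := fun k v => by
  simp only [Pi.smul_apply, LinearMap.smul_apply, map_smul, h k v]
  rw [smul_comm]

theorem Homogeneous.sum {ι : Type*} {q χ : ℂ} {Q : Module.End ℂ V} {O : ι → ℤ → Module.End ℂ V}
    {I : Finset ι} (h : ∀ i ∈ I, Homogeneous q Q χ (O i)) : Homogeneous q Q χ (∑ i ∈ I, O i) := by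
  intro k v
  simp only [Finset.sum_apply, LinearMap.sum_apply, map_sum, Finset.smul_sum]
  exact Finset.sum_congr rfl fun i hi => h i hi k v

theorem Homogeneous.conv {q χ χ' : ℂ} (hq : q ≠ 0) {Q : Module.End ℂ V}
    {O O' : ℤ → Module.End ℂ V} (h : Homogeneous q Q χ O) (h' : Homogeneous q Q χ' O')
    (hg : GoodPair O O') : Homogeneous q Q (χ * χ') (conv O O') := by
  intro m v
  have e1 : Q (∑ᶠ k, O k (O' (m - k) v)) = ∑ᶠ k, Q (O k (O' (m - k) v)) :=
    AddMonoidHom.map_finsum Q.toAddMonoidHom (hg m v)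
  rw [conv_apply hg, conv_apply hg, e1, smul_finsum]
  refine finsum_congr fun k => ?_
  rw [h, h', map_smul, smul_smul, show -m = -k + -(m - k) by ring, zpow_add₀ hq]
  congr 1
  ring

end Fields

end

end GenusOneWard

namespace GenusOneWard

noncomputable section

/-! ### Ghost fields -/

section Ghosts

variable {R : Type*}

theorem exists_index_bound (v : GhostFock R) :
    ∃ K : ℤ, ∀ (α : R) (k : ℤ), K < |k| → MvPolynomial.pderiv (α, k) v = 0 := by
  classical
  refine ⟨∑ p ∈ v.vars, |p.2|, fun α k hk => MvPolynomial.pderiv_eq_zero_of_notMem_vars fun hm => ?_⟩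
  exact absurd (Finset.single_le_sum (f := fun p : R × ℤ => |p.2|) (fun p _ => abs_nonneg _) hm)
    (not_le.2 hk)

theorem gammaMode_of_nonpos {α : R} {m : ℤ} (h : m ≤ 0) (v : GhostFock R) :
    gammaMode α m v = MvPolynomial.X (α, -m) * v := by simp [gammaMode, h]

theorem gammaMode_of_pos {α : R} {m : ℤ} (h : 0 < m) (v : GhostFock R) :
    gammaMode α m v = -MvPolynomial.pderiv (α, -m) v := by
  rw [gammaMode, if_neg (not_le.2 h)]
  rfl

theorem betaMode_of_nonneg {α : R} {m : ℤ} (h : 0 ≤ m) (v : GhostFock R) :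
    betaMode α m v = MvPolynomial.pderiv (α, m) v := by
  rw [betaMode, if_pos h]
  rfl

theorem betaMode_of_neg {α : R} {m : ℤ} (h : m < 0) (v : GhostFock R) :
    betaMode α m v = MvPolynomial.X (α, m) * v := by
  rw [betaMode, if_neg (not_le.2 h)]
  rfl

theorem lowerBdd_gammaMode (α : R) : LowerBdd (gammaMode α) := fun v => by
  obtain ⟨K, hK⟩ := exists_index_bound v
  refine ⟨max K 0, fun k hk => ?_⟩
  have h0 : 0 < k := (le_max_right _ _).trans_lt hk
  rw [gammaMode_of_pos h0, hK, neg_zero]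
  rw [abs_neg, abs_of_pos h0]
  exact (le_max_left _ _).trans_lt hk

theorem lowerBdd_betaMode (α : R) : LowerBdd (betaMode α) := fun v => by
  obtain ⟨K, hK⟩ := exists_index_bound v
  refine ⟨max K 0, fun k hk => ?_⟩
  have h0 : 0 < k := (le_max_right _ _).trans_lt hk
  rw [betaMode_of_nonneg h0.le, hK]
  rw [abs_of_pos h0]
  exact (le_max_left _ _).trans_lt hk

theorem fcomm_gammaMode (α α' : R) : FComm (gammaMode α) (gammaMode α') := by
  intro k l v
  rcases le_or_gt k 0 with hk | hk <;> rcases le_or_gt l 0 with hl | hl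
  · simp only [gammaMode_of_nonpos hk, gammaMode_of_nonpos hl, mul_left_comm]
  · have hne : ((α, -k) : R × ℤ) ≠ (α', -l) := fun h => by
      have := (Prod.mk.inj h).2
      omega
    simp [gammaMode_of_nonpos hk, gammaMode_of_pos hl, MvPolynomial.pderiv_X_of_ne hne]
  · have hne : ((α', -l) : R × ℤ) ≠ (α, -k) := fun h => by
      have := (Prod.mk.inj h).2
      omega
    simp [gammaMode_of_nonpos hl, gammaMode_of_pos hk, MvPolynomial.pderiv_X_of_ne hne]
  · simp only [gammaMode_of_pos hk, gammaMode_of_pos hl, map_neg, neg_neg]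
    rw [ghost_pderiv_comm]

theorem fcomm_betaMode (α α' : R) : FComm (betaMode α) (betaMode α') := by
  intro k l v
  rcases lt_or_ge k 0 with hk | hk <;> rcases lt_or_ge l 0 with hl | hl
  · simp only [betaMode_of_neg hk, betaMode_of_neg hl, mul_left_comm]
  · have hne : ((α, k) : R × ℤ) ≠ (α', l) := fun h => by
      have := (Prod.mk.inj h).2
      omega
    simp [betaMode_of_neg hk, betaMode_of_nonneg hl, MvPolynomial.pderiv_X_of_ne hne]
  · have hne : ((α', l) : R × ℤ) ≠ (α, k) := fun h => by
      have := (Prod.mk.inj h).2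
      omega
    simp [betaMode_of_neg hl, betaMode_of_nonneg hk, MvPolynomial.pderiv_X_of_ne hne]
  · simp only [betaMode_of_nonneg hk, betaMode_of_nonneg hl]
    rw [ghost_pderiv_comm]

/-- The monomial `γ^{α₁}(z) ⋯ γ^{αᵣ}(z)` as a field. -/
def gammaWordField : List R → ℤ → Module.End ℂ (GhostFock R)
  | [] => unitField
  | α :: l => conv (gammaMode α) (gammaWordField l)

theorem FComm.gammaWordField {O : ℤ → Module.End ℂ (GhostFock R)}
    (h : ∀ α, FComm O (gammaMode α)) : ∀ l, FComm O (gammaWordField l)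
  | [] => fcomm_unitField O
  | α :: l => (h α).conv (FComm.gammaWordField h l)

theorem lowerBdd_gammaWordField : ∀ l : List R, LowerBdd (gammaWordField l)
  | [] => lowerBdd_unitField
  | α :: l => (lowerBdd_gammaMode α).conv (lowerBdd_gammaWordField l)
      (FComm.gammaWordField (fcomm_gammaMode α) l)

theorem gammaWordField_apply (l : List R) (m : ℤ) (v : GhostFock R) :
    gammaWordField l m v = gammaWord l m v := by
  induction l generalizing m v with
  | nil => by_cases h : m = 0 <;> simp [gammaWordField, gammaWord, unitField, h]
  | cons α l ih =>
    rw [gammaWordField, conv_apply_of_fcomm (FComm.gammaWordField (fcomm_gammaMode α) l)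
      (lowerBdd_gammaMode α) (lowerBdd_gammaWordField l), gammaWord]
    simp only [ih]

/-- The list attached to a monomial is ordered by an arbitrary choice, so products of monomials can
be compared only up to permutation. -/
theorem gammaWordField_perm {l l' : List R} (h : l.Perm l') :
    gammaWordField l = gammaWordField l' := by
  induction h with
  | nil => rfl
  | cons α _ ih => rw [gammaWordField, gammaWordField, ih]
  | swap α α' l =>
    simp only [gammaWordField]
    have h1 := FComm.gammaWordField (fcomm_gammaMode α) l
    have h2 := FComm.gammaWordField (fcomm_gammaMode α') l
    rw [← conv_assoc (fcomm_gammaMode α' α) h2 h1 (lowerBdd_gammaMode _) (lowerBdd_gammaMode _)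
      (lowerBdd_gammaWordField l), conv_comm (fcomm_gammaMode α' α) (lowerBdd_gammaMode _)
      (lowerBdd_gammaMode _), conv_assoc (fcomm_gammaMode α α') h1 h2 (lowerBdd_gammaMode _)
      (lowerBdd_gammaMode _) (lowerBdd_gammaWordField l)]
  | trans _ _ h1 h2 => exact h1.trans h2

/-- The monomial `γ(z)^s` as a field. -/
def gammaMonomial (s : R →₀ ℕ) : ℤ → Module.End ℂ (GhostFock R) :=
  gammaWordField (Finsupp.toMultiset s).toList

/-- The field `P(γ(z))`. -/
def gammaField : MvPolynomial R ℂ →ₗ[ℂ] ℤ → Module.End ℂ (GhostFock R) :=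
  (MvPolynomial.basisMonomials R ℂ).constr ℂ gammaMonomial

theorem gammaField_eq_sum (P : MvPolynomial R ℂ) :
    gammaField P = ∑ s ∈ P.support, P.coeff s • gammaMonomial s := by
  rw [gammaField, Module.Basis.constr_apply]
  rfl

theorem gammaField_apply (P : MvPolynomial R ℂ) (m : ℤ) (v : GhostFock R) :
    gammaField P m v = gammaPoly P m v := by
  rw [gammaField_eq_sum, gammaPoly, Finset.sum_apply, LinearMap.sum_apply]
  refine Finset.sum_congr rfl fun s _ => ?_
  rw [Pi.smul_apply, LinearMap.smul_apply, gammaMonomial, gammaWordField_apply]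

theorem gammaField_monomial (s : R →₀ ℕ) (c : ℂ) :
    gammaField (MvPolynomial.monomial s c) = c • gammaMonomial s := by
  rw [show MvPolynomial.monomial s c = c • MvPolynomial.monomial s (1 : ℂ) by
    rw [MvPolynomial.smul_monomial, smul_eq_mul, mul_one], map_smul]
  congr 1
  have := (MvPolynomial.basisMonomials R ℂ).constr_basis ℂ gammaMonomial s
  rwa [MvPolynomial.coe_basisMonomials] at this

theorem gammaField_C (c : ℂ) : gammaField (R := R) (MvPolynomial.C c) = c • unitField := by
  rw [← MvPolynomial.monomial_zero', gammaField_monomial]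
  simp [gammaMonomial, gammaWordField]

theorem lowerBdd_gammaField (P : MvPolynomial R ℂ) : LowerBdd (gammaField P) := by
  rw [gammaField_eq_sum]
  exact LowerBdd.sum fun s _ => (lowerBdd_gammaWordField _).smul _

theorem FComm.gammaField {O : ℤ → Module.End ℂ (GhostFock R)}
    (h : ∀ α, FComm O (gammaMode α)) (P : MvPolynomial R ℂ) : FComm O (gammaField P) := by
  rw [gammaField_eq_sum]
  exact FComm.sum fun s _ => (FComm.gammaWordField h _).smul _

theorem fcomm_gammaField (P Q : MvPolynomial R ℂ) : FComm (gammaField P) (gammaField Q) :=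
  FComm.gammaField (fun α => (FComm.gammaField (fcomm_gammaMode α) P).symm) Q

theorem goodPair_gammaField (P Q : MvPolynomial R ℂ) : GoodPair (gammaField P) (gammaField Q) :=
  (fcomm_gammaField P Q).goodPair (lowerBdd_gammaField P) (lowerBdd_gammaField Q)

theorem gammaField_X (α : R) : gammaField (MvPolynomial.X α) = gammaMode α := by
  rw [MvPolynomial.X, gammaField_monomial, one_smul, gammaMonomial, Finsupp.toMultiset_single,
    one_nsmul, Multiset.toList_singleton, gammaWordField, gammaWordField,
    conv_comm (fcomm_unitField _) (lowerBdd_gammaMode α) lowerBdd_unitField,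
    unitField_conv _ (lowerBdd_gammaMode α)]

theorem gammaField_X_mul (α : R) (P : MvPolynomial R ℂ) :
    gammaField (MvPolynomial.X α * P) = conv (gammaMode α) (gammaField P) := by
  have hg : ∀ Q, GoodPair (gammaField Q) (gammaMode α) := fun Q =>
    (FComm.gammaField (fcomm_gammaMode α) Q).symm.goodPair (lowerBdd_gammaField Q)
      (lowerBdd_gammaMode α)
  have hc : ∀ Q, conv (gammaMode α) (gammaField Q) = conv (gammaField Q) (gammaMode α) := fun Q =>
    conv_comm (FComm.gammaField (fcomm_gammaMode α) Q) (lowerBdd_gammaMode α)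
      (lowerBdd_gammaField Q)
  induction P using MvPolynomial.induction_on' with
  | monomial s c =>
    rw [MvPolynomial.X, MvPolynomial.monomial_mul, one_mul, gammaField_monomial, hc,
      gammaField_monomial, conv_smul_left]
    · congr 1
      have hp : (Finsupp.toMultiset (Finsupp.single α 1 + s)).toList.Perm
          (α :: (Finsupp.toMultiset s).toList) := by
        rw [← Multiset.coe_eq_coe, Multiset.coe_toList, ← Multiset.cons_coe, Multiset.coe_toList]
        simp
      rw [gammaMonomial, gammaWordField_perm hp, gammaWordField, gammaMonomial]
      exact conv_comm (FComm.gammaWordField (fcomm_gammaMode α) _) (lowerBdd_gammaMode α)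
        (lowerBdd_gammaWordField _)
    · exact (FComm.gammaWordField (fcomm_gammaMode α) _).symm.goodPair
        (lowerBdd_gammaWordField _) (lowerBdd_gammaMode α)
  | add P Q hP hQ =>
    rw [mul_add, map_add, hP, hQ, hc, hc, hc, map_add, conv_add_left (hg P) (hg Q)]

/-- Multiplicativity of P ↦ P(γ(z)) is what allows commutators with P(γ(z)) to be checked on
generators. -/
theorem gammaField_mul (P Q : MvPolynomial R ℂ) :
    gammaField (P * Q) = conv (gammaField P) (gammaField Q) := by
  induction P using MvPolynomial.induction_on with
  | C c =>
    rw [← MvPolynomial.smul_eq_C_mul, map_smul, gammaField_C, conv_smul_left,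
      unitField_conv _ (lowerBdd_gammaField Q)]
    exact (fcomm_unitField _).symm.goodPair lowerBdd_unitField (lowerBdd_gammaField Q)
  | add P P' hP hP' =>
    rw [add_mul, map_add, hP, hP', map_add,
      conv_add_left (goodPair_gammaField P Q) (goodPair_gammaField P' Q)]
  | mul_X P α hP =>
    rw [mul_comm P, mul_assoc, gammaField_X_mul, hP, gammaField_X_mul, conv_assoc
      (FComm.gammaField (fcomm_gammaMode α) P) (FComm.gammaField (fcomm_gammaMode α) Q)
      (fcomm_gammaField P Q) (lowerBdd_gammaMode α) (lowerBdd_gammaField P) (lowerBdd_gammaField Q)]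

theorem vectorFieldApply_C [Fintype R] (S : R → MvPolynomial R ℂ) (c : ℂ) :
    vectorFieldApply S (MvPolynomial.C c) = 0 := by simp [vectorFieldApply]

theorem vectorFieldApply_add [Fintype R] (S : R → MvPolynomial R ℂ) (P Q : MvPolynomial R ℂ) :
    vectorFieldApply S (P + Q) = vectorFieldApply S P + vectorFieldApply S Q := by
  simp [vectorFieldApply, mul_add, Finset.sum_add_distrib]

theorem vectorFieldApply_X [Fintype R] (S : R → MvPolynomial R ℂ) (α : R) :
    vectorFieldApply S (MvPolynomial.X α) = S α := by
  classical
  rw [vectorFieldApply, Finset.sum_eq_single α]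
  · simp
  · intro δ _ hδ
    rw [MvPolynomial.pderiv_X_of_ne hδ.symm, mul_zero]
  · simp

theorem vectorFieldApply_mul [Fintype R] (S : R → MvPolynomial R ℂ) (P Q : MvPolynomial R ℂ) :
    vectorFieldApply S (P * Q) = vectorFieldApply S P * Q + P * vectorFieldApply S Q := by
  simp only [vectorFieldApply, Derivation.leibniz, smul_eq_mul, Finset.sum_mul, Finset.mul_sum,
    ← Finset.sum_add_distrib]
  exact Finset.sum_congr rfl fun δ _ => by ring

theorem vectorFieldApply_single [Fintype R] [DecidableEq R] (δ : R) (P : MvPolynomial R ℂ) :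
    vectorFieldApply (Pi.single δ 1) P = MvPolynomial.pderiv δ P := by
  rw [vectorFieldApply, Finset.sum_eq_single δ]
  · simp
  · intro ε _ hε
    simp [hε]
  · simp

/-- Both the commutator with D and the vector field are derivations, hence determined by their
effect on the γ^α. -/
theorem FieldBracket.gammaField [Fintype R] {D : Module.End ℂ (GhostFock R)} {r : ℤ}
    {S : R → MvPolynomial R ℂ}
    (h : ∀ α, FieldBracket D r (gammaMode α) (gammaField (S α))) (P : MvPolynomial R ℂ) :
    FieldBracket D r (gammaField P) (gammaField (vectorFieldApply S P)) := by
  induction P using MvPolynomial.induction_on with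
  | C c =>
    rw [vectorFieldApply_C, gammaField_C, map_zero]
    refine (FieldBracket.smul (fun k v => ?_) c).congr (smul_zero c)
    by_cases hk : k = 0 <;> simp [unitField, hk]
  | add P Q hP hQ =>
    rw [vectorFieldApply_add, map_add, map_add]
    exact hP.add hQ
  | mul_X P α hP =>
    rw [vectorFieldApply_mul, vectorFieldApply_X, gammaField_mul, map_add, gammaField_mul,
      gammaField_mul, gammaField_X]
    have hg : ∀ Q, GoodPair (GenusOneWard.gammaField Q) (gammaMode α) := fun Q =>
      (FComm.gammaField (fcomm_gammaMode α) Q).symm.goodPair (lowerBdd_gammaField Q)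
        (lowerBdd_gammaMode α)
    exact hP.conv (h α) (hg _) (hg _) (goodPair_gammaField _ _)

theorem fieldBracket_betaMode_gammaMode [DecidableEq R] (δ α : R) (j : ℤ) :
    FieldBracket (betaMode δ j) j (gammaMode α)
      (gammaField ((Pi.single δ 1 : R → MvPolynomial R ℂ) α)) := by
  intro k v
  have h := LinearMap.congr_fun (betaMode_gammaMode δ α j k) v
  rw [LinearMap.sub_apply, Module.End.mul_apply, Module.End.mul_apply] at h
  rw [h]
  by_cases hα : α = δ
  · subst hα
    rw [Pi.single_eq_same, ← MvPolynomial.C_1, gammaField_C, one_smul, unitField, add_comm j k]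
    simp
  · rw [Pi.single_eq_of_ne hα, map_zero, if_neg fun h => hα h.1.symm]
    rfl

theorem fieldBracket_betaMode [Fintype R] (δ : R) (j : ℤ) (P : MvPolynomial R ℂ) :
    FieldBracket (betaMode δ j) j (gammaField P) (gammaField (MvPolynomial.pderiv δ P)) := by
  classical
  have := FieldBracket.gammaField (fun α => fieldBracket_betaMode_gammaMode δ α j) P
  rwa [vectorFieldApply_single] at this

/-- The only obstruction to commuting is the contraction ∂P/∂x^δ. Its vanishing makes normal
ordering of P(γ)β_δ vacuous. -/
theorem fcomm_gammaField_betaMode [Fintype R] {δ : R} {P : MvPolynomial R ℂ}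
    (h : MvPolynomial.pderiv δ P = 0) : FComm (gammaField P) (betaMode δ) := by
  intro k l v
  have := fieldBracket_betaMode δ l P k v
  rw [h, map_zero] at this
  exact (sub_eq_zero.1 this).symm

theorem goodPair_gammaField_betaMode [Fintype R] {δ : R} {P : MvPolynomial R ℂ}
    (h : MvPolynomial.pderiv δ P = 0) : GoodPair (gammaField P) (betaMode δ) :=
  (fcomm_gammaField_betaMode h).goodPair (lowerBdd_gammaField P) (lowerBdd_betaMode δ)

/-! ### Currents -/

/-- The current `∑_δ S_δ(γ(z)) β_δ(z)`, for `S_δ` independent of `x^δ`. -/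
def currentField [Fintype R] (S : R → MvPolynomial R ℂ) : ℤ → Module.End ℂ (GhostFock R) :=
  ∑ δ, conv (gammaField (S δ)) (betaMode δ)

theorem currentField_apply [Fintype R] {S : R → MvPolynomial R ℂ}
    (hS : ∀ δ, MvPolynomial.pderiv δ (S δ) = 0) (m : ℤ) (v : GhostFock R) :
    currentField S m v = currentMode S m v := by
  rw [currentField, currentMode, Finset.sum_apply, LinearMap.sum_apply]
  refine Finset.sum_congr rfl fun δ _ => ?_
  rw [conv_apply (goodPair_gammaField_betaMode (hS δ)), ← finsum_comp_equiv (Equiv.subLeft m)]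
  refine finsum_congr fun k => ?_
  rw [Equiv.subLeft_apply, sub_sub_cancel, ← gammaField_apply, ← gammaField_apply,
    fcomm_gammaField_betaMode (hS δ)]
  simp

theorem currentField_sum_smul [Fintype R] {ι : Type*} (I : Finset ι) (c : ι → ℂ)
    {S : ι → R → MvPolynomial R ℂ} (hS : ∀ i δ, MvPolynomial.pderiv δ (S i δ) = 0) :
    currentField (fun δ => ∑ i ∈ I, c i • S i δ) = ∑ i ∈ I, c i • currentField (S i) := by
  simp only [currentField, Finset.smul_sum]
  rw [Finset.sum_comm]
  refine Finset.sum_congr rfl fun δ _ => ?_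
  rw [map_sum, conv_sum_left]
  · refine Finset.sum_congr rfl fun i _ => ?_
    rw [map_smul, conv_smul_left (goodPair_gammaField_betaMode (hS i δ))]
  · intro i _
    rw [map_smul]
    exact (goodPair_gammaField_betaMode (hS i δ)).smul_left _

/-- It suffices to treat a single γ^α. Its modes commute with the coefficients of the current and
contract only with β_α, which leaves -S_α(γ); then the roles of the two fields are exchanged. -/
theorem fieldBracket_currentField_gammaField [Fintype R] {S : R → MvPolynomial R ℂ}
    (hS : ∀ δ, MvPolynomial.pderiv δ (S δ) = 0) (r : ℤ) (P : MvPolynomial R ℂ) :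
    FieldBracket (currentField S r) r (gammaField P) (gammaField (vectorFieldApply S P)) := by
  classical
  refine FieldBracket.gammaField (fun α => ?_) P
  have h1 : ∀ δ k, FieldBracket (gammaMode α k) k (betaMode δ)
      (-gammaField ((Pi.single δ 1 : R → MvPolynomial R ℂ) α)) := fun δ =>
    fieldBracket_swap fun k => fieldBracket_betaMode_gammaMode δ α k
  have h2 : ∀ k, FieldBracket (gammaMode α k) k (currentField S)
      (∑ δ, conv (gammaField (S δ)) (-gammaField ((Pi.single δ 1 : R → MvPolynomial R ℂ) α))) := by
    intro k
    refine FieldBracket.sum fun δ _ => ?_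
    refine (((FComm.gammaField (fcomm_gammaMode α) (S δ)).fieldBracket k k).conv (h1 δ k)
      (goodPair_gammaField_betaMode (hS δ)) (goodPair_zero_left _) ?_).congr ?_
    · rw [← map_neg]
      exact goodPair_gammaField _ _
    · rw [conv_zero_left, zero_add]
  refine (fieldBracket_swap h2 r).congr ?_
  rw [Finset.sum_eq_single α]
  · rw [← map_neg, ← gammaField_mul, Pi.single_eq_same, mul_neg, mul_one, map_neg, neg_neg]
  · intro δ _ hδ
    rw [Pi.single_eq_of_ne hδ.symm, map_zero, neg_zero, conv_zero_right]
  · simp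

/-- The commutator of two vector fields. -/
def vectorFieldBracket [Fintype R] (S S' : R → MvPolynomial R ℂ) (δ : R) : MvPolynomial R ℂ :=
  vectorFieldApply S (S' δ) - vectorFieldApply S' (S δ)

/-- The Wick expansion has single contractions, giving the bracket of vector fields, and double
contractions proportional to ∂_δ S_ε ∂_ε S'_δ. The hypothesis `hd` makes each of the latter vanish,
so there is no anomaly. -/
theorem fieldBracket_currentField [Fintype R] {S S' : R → MvPolynomial R ℂ}
    (hS : ∀ δ, MvPolynomial.pderiv δ (S δ) = 0) (hS' : ∀ δ, MvPolynomial.pderiv δ (S' δ) = 0)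
    (hSS' : ∀ δ, MvPolynomial.pderiv δ (vectorFieldApply S (S' δ)) = 0)
    (hd : ∀ δ ε, MvPolynomial.pderiv δ (S ε) = 0 ∨ MvPolynomial.pderiv ε (S' δ) = 0) (r : ℤ) :
    FieldBracket (currentField S r) r (currentField S') (currentField (vectorFieldBracket S S')) := by
  -- Partial derivatives commute and ∂_ε S_ε = 0.
  have hdd : ∀ δ ε, MvPolynomial.pderiv ε (MvPolynomial.pderiv δ (S ε)) = 0 := fun δ ε => by
    have h : ⁅(MvPolynomial.pderiv ε : Derivation ℂ (MvPolynomial R ℂ) (MvPolynomial R ℂ)),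
        (MvPolynomial.pderiv δ : Derivation ℂ (MvPolynomial R ℂ) (MvPolynomial R ℂ))⁆ = 0 := by
      classical
      refine MvPolynomial.derivation_ext fun k => ?_
      rw [Derivation.commutator_apply, MvPolynomial.pderiv_X, MvPolynomial.pderiv_X]
      by_cases hi : k = ε <;> by_cases hj : k = δ <;> simp [Pi.single_apply, hi, hj] <;>
        split_ifs <;> simp
    have h2 := congrArg (fun D => D (S ε)) h
    simp only [Derivation.commutator_apply, hS, map_zero, sub_zero, Derivation.coe_zero,
      Pi.zero_apply] at h2
    exact h2
  have hprod : ∀ δ ε, MvPolynomial.pderiv ε (S' δ * MvPolynomial.pderiv δ (S ε)) = 0 := by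
    intro δ ε
    rw [Derivation.leibniz, hdd, smul_zero, zero_add]
    rcases hd δ ε with h | h <;> simp [h]
  have hβ : ∀ δ, FieldBracket (currentField S r) r (betaMode δ)
      (-∑ ε, conv (gammaField (MvPolynomial.pderiv δ (S ε))) (betaMode ε)) := by
    intro δ
    refine fieldBracket_swap (fun k => FieldBracket.sum fun ε _ => ?_) r
    refine ((fieldBracket_betaMode δ k (S ε)).conv ((fcomm_betaMode δ ε).fieldBracket k k)
      (goodPair_gammaField_betaMode (hS ε)) (goodPair_gammaField_betaMode (hdd δ ε))
      (goodPair_zero_right _)).congr ?_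
    rw [conv_zero_right, add_zero]
  -- Here double contractions disappear: either the coefficient ∂_δ S_ε is zero, or S'_δ is
  -- independent of x^ε and commutes with β_ε. In both cases the triple product can be reassociated.
  have hcomm : ∀ δ ε, FComm (gammaField (S' δ))
      (conv (gammaField (MvPolynomial.pderiv δ (S ε))) (betaMode ε)) := by
    intro δ ε
    rcases hd δ ε with h | h
    · rw [h, map_zero, conv_zero_left]
      exact fcomm_zero _
    · exact (fcomm_gammaField _ _).conv (fcomm_gammaField_betaMode h)
  have hbdd : ∀ δ ε, LowerBdd
      (conv (gammaField (MvPolynomial.pderiv δ (S ε))) (betaMode ε)) := fun δ ε =>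
    (lowerBdd_gammaField _).conv (lowerBdd_betaMode ε) (fcomm_gammaField_betaMode (hdd δ ε))
  have hgood : ∀ δ, GoodPair (gammaField (S' δ))
      (-∑ ε, conv (gammaField (MvPolynomial.pderiv δ (S ε))) (betaMode ε)) := fun δ =>
    (FComm.sum fun ε _ => hcomm δ ε).neg.goodPair (lowerBdd_gammaField _)
      (LowerBdd.sum fun ε _ => hbdd δ ε).neg
  have hmul : ∀ δ, conv (gammaField (S' δ))
      (-∑ ε, conv (gammaField (MvPolynomial.pderiv δ (S ε))) (betaMode ε))
      = -∑ ε, conv (gammaField (S' δ * MvPolynomial.pderiv δ (S ε))) (betaMode ε) := by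
    intro δ
    rw [conv_comm (FComm.sum fun ε _ => hcomm δ ε).neg (lowerBdd_gammaField _)
      (LowerBdd.sum fun ε _ => hbdd δ ε).neg, conv_neg_left,
      conv_sum_left]
    · congr 1
      refine Finset.sum_congr rfl fun ε _ => ?_
      rw [← conv_comm (hcomm δ ε) (lowerBdd_gammaField _) (hbdd δ ε), gammaField_mul]
      rcases hd δ ε with h | h
      · simp only [h, map_zero, conv_zero_left, conv_zero_right]
      · rw [conv_assoc (fcomm_gammaField _ _) (fcomm_gammaField_betaMode h)
          (fcomm_gammaField_betaMode (hdd δ ε)) (lowerBdd_gammaField _) (lowerBdd_gammaField _)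
          (lowerBdd_betaMode ε)]
    · exact fun ε _ => (hcomm δ ε).symm.goodPair (hbdd δ ε) (lowerBdd_gammaField _)
    · exact (FComm.sum fun ε _ => hcomm δ ε).symm.goodPair (LowerBdd.sum fun ε _ => hbdd δ ε)
        (lowerBdd_gammaField _)
  refine (FieldBracket.sum fun δ _ => (fieldBracket_currentField_gammaField hS r (S' δ)).conv (hβ δ)
    (goodPair_gammaField_betaMode (hS' δ)) (goodPair_gammaField_betaMode (hSS' δ))
    (hgood δ)).congr ?_
  simp only [hmul, Finset.sum_add_distrib, Finset.sum_neg_distrib]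
  rw [Finset.sum_comm (f := fun δ ε => conv (gammaField (S' δ * MvPolynomial.pderiv δ (S ε)))
    (betaMode ε)), ← sub_eq_add_neg, ← Finset.sum_sub_distrib, currentField]
  refine Finset.sum_congr rfl fun δ _ => ?_
  have hsum : ∑ ε, conv (gammaField (S' ε * MvPolynomial.pderiv ε (S δ))) (betaMode δ)
      = conv (gammaField (vectorFieldApply S' (S δ))) (betaMode δ) := by
    rw [vectorFieldApply, map_sum, conv_sum_left]
    exact fun ε _ => goodPair_gammaField_betaMode (hprod ε δ)
  have h0 : MvPolynomial.pderiv δ (vectorFieldApply S' (S δ)) = 0 := by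
    rw [vectorFieldApply, map_sum]
    exact Finset.sum_eq_zero fun ε _ => hprod ε δ
  rw [hsum, vectorFieldBracket, sub_eq_add_neg (vectorFieldApply S (S' δ)), map_add, conv_add_left,
    map_neg, conv_neg_left,
    sub_eq_add_neg]
  · exact goodPair_gammaField_betaMode h0
  · exact goodPair_gammaField_betaMode (hSS' δ)
  · exact goodPair_gammaField_betaMode (by rw [map_neg, h0, neg_zero])

end Ghosts

end

end GenusOneWard

namespace GenusOneWard

open Complex

noncomputable section

/-! ### The grading operator and the charges of the fields -/

section Grading

variable {R : Type*}

/-- The diagonal operator with eigenvalue `w p` on the oscillator `p`. -/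
def gradingOp {ι : Type*} (w : ι → ℂ) : Module.End ℂ (MvPolynomial ι ℂ) :=
  (MvPolynomial.aeval fun p => w p • (MvPolynomial.X p : MvPolynomial ι ℂ)).toLinearMap

theorem gradingOp_X_mul {ι : Type*} (w : ι → ℂ) (p : ι) (v : MvPolynomial ι ℂ) :
    gradingOp w (MvPolynomial.X p * v) = w p • (MvPolynomial.X p * gradingOp w v) := by
  simp [gradingOp]

theorem gradingOp_monomial {ι : Type*} (w : ι → ℂ) (s : ι →₀ ℕ) :
    gradingOp w (MvPolynomial.monomial s 1) = expProd w s • MvPolynomial.monomial s (1 : ℂ) := by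
  rw [gradingOp, AlgHom.toLinearMap_apply, MvPolynomial.aeval_monomial, map_one, one_mul,
    MvPolynomial.monomial_eq, map_one, one_mul, expProd]
  simp only [Finsupp.prod, MvPolynomial.smul_eq_C_mul, mul_pow, Finset.prod_mul_distrib, map_prod,
    map_pow]

/-- An annihilation operator has the inverse of the weight of its oscillator; stated without
division, this needs no nonvanishing of w. -/
theorem gradingOp_pderiv {ι : Type*} (w : ι → ℂ) (p : ι) (v : MvPolynomial ι ℂ) :
    w p • gradingOp w (MvPolynomial.pderiv p v) = MvPolynomial.pderiv p (gradingOp w v) := by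
  classical
  induction v using MvPolynomial.induction_on with
  | C c => simp [gradingOp]
  | add v v' h h' => simp only [map_add, smul_add, h, h']
  | mul_X v j h =>
    rw [mul_comm v, gradingOp_X_mul, Derivation.map_smul, Derivation.leibniz, Derivation.leibniz, map_add,
      smul_eq_mul, smul_eq_mul, gradingOp_X_mul, ← h, MvPolynomial.pderiv_X]
    by_cases hj : j = p
    · subst hj
      simp [mul_comm, smul_add]
    · simp [Pi.single_eq_of_ne hj, mul_comm, smul_comm (w j)]

theorem modeWeight_of_nonneg (q : ℂ) (wt : R → ℂ) (α : R) {k : ℤ} (h : 0 ≤ k) :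
    modeWeight q wt (α, k) = q ^ k * cexp (-wt α) := by
  rw [modeWeight, if_pos h, ← zpow_natCast, Int.natCast_natAbs, abs_of_nonneg h]

theorem modeWeight_of_neg (q : ℂ) (wt : R → ℂ) (α : R) {k : ℤ} (h : k < 0) :
    modeWeight q wt (α, k) = q ^ (-k) * cexp (wt α) := by
  rw [modeWeight, if_neg (not_le.2 h), ← zpow_natCast, Int.natCast_natAbs, abs_of_neg h]

theorem homogeneous_gammaMode {q : ℂ} (hq : q ≠ 0) (wt : R → ℂ) (α : R) :
    Homogeneous q (gradingOp (modeWeight q wt)) (cexp (-wt α)) (gammaMode α) := by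
  intro k v
  rcases le_or_gt k 0 with hk | hk
  · rw [gammaMode_of_nonpos hk, gammaMode_of_nonpos hk, gradingOp_X_mul,
      modeWeight_of_nonneg q wt α (by omega)]
  · rw [gammaMode_of_pos hk, gammaMode_of_pos hk, map_neg, ← gradingOp_pderiv,
      modeWeight_of_neg q wt α (by omega), smul_neg, smul_smul, neg_neg, zpow_neg,
      Complex.exp_neg]
    have h1 := exp_ne_zero (wt α)
    have h2 := zpow_ne_zero k hq
    rw [show (q ^ k)⁻¹ * (cexp (wt α))⁻¹ * (q ^ k * cexp (wt α)) = 1 by field_simp, one_smul]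

theorem homogeneous_betaMode {q : ℂ} (hq : q ≠ 0) (wt : R → ℂ) (α : R) :
    Homogeneous q (gradingOp (modeWeight q wt)) (cexp (wt α)) (betaMode α) := by
  intro k v
  rcases lt_or_ge k 0 with hk | hk
  · rw [betaMode_of_neg hk, betaMode_of_neg hk, gradingOp_X_mul, modeWeight_of_neg q wt α hk]
  · rw [betaMode_of_nonneg hk, betaMode_of_nonneg hk, ← gradingOp_pderiv,
      modeWeight_of_nonneg q wt α hk, smul_smul, zpow_neg, Complex.exp_neg]
    have h1 := exp_ne_zero (wt α)
    have h2 := zpow_ne_zero k hq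
    rw [show (q ^ k)⁻¹ * cexp (wt α) * (q ^ k * (cexp (wt α))⁻¹) = 1 by field_simp, one_smul]

theorem homogeneous_gammaWordField {q : ℂ} (hq : q ≠ 0) (wt : R → ℂ) (l : List R) :
    Homogeneous q (gradingOp (modeWeight q wt)) (cexp (-(l.map wt).sum)) (gammaWordField l) := by
  induction l with
  | nil => simpa [gammaWordField] using homogeneous_unitField q (gradingOp (modeWeight q wt))
  | cons α l ih =>
    rw [List.map_cons, List.sum_cons, neg_add, Complex.exp_add]
    exact (homogeneous_gammaMode hq wt α).conv hq ih
      ((FComm.gammaWordField (fcomm_gammaMode α) l).goodPair (lowerBdd_gammaMode α)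
        (lowerBdd_gammaWordField l))

theorem sum_map_toMultiset_toList (wt : R → ℂ) (s : R →₀ ℕ) :
    ((Finsupp.toMultiset s).toList.map wt).sum = Finsupp.weight wt s := by
  rw [← Multiset.sum_coe, ← Multiset.map_coe, Multiset.coe_toList]
  induction s using Finsupp.induction_linear with
  | zero => simp
  | add s t hs ht => rw [map_add, Multiset.map_add, Multiset.sum_add, hs, ht, map_add]
  | single α k => simp [Finsupp.weight_single, Multiset.map_nsmul, Multiset.sum_nsmul]

theorem homogeneous_gammaField {q : ℂ} (hq : q ≠ 0) {wt : R → ℂ} {P : MvPolynomial R ℂ} {c : ℂ}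
    (h : MvPolynomial.IsWeightedHomogeneous wt P c) :
    Homogeneous q (gradingOp (modeWeight q wt)) (cexp (-c)) (gammaField P) := by
  rw [gammaField_eq_sum]
  refine Homogeneous.sum fun s hs => Homogeneous.smul ?_ _
  rw [← h (MvPolynomial.mem_support_iff.1 hs), ← sum_map_toMultiset_toList]
  exact homogeneous_gammaWordField hq wt _

/-- The factor S_δ(γ) has charge e^{-(wt δ - c)} and β_δ has charge e^{wt δ}, so every summand has
charge e^c. -/
theorem homogeneous_currentField [Fintype R] {q : ℂ} (hq : q ≠ 0) {wt : R → ℂ}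
    {S : R → MvPolynomial R ℂ} {c : ℂ} (hS : ∀ δ, MvPolynomial.pderiv δ (S δ) = 0)
    (h : ∀ δ, MvPolynomial.IsWeightedHomogeneous wt (S δ) (wt δ - c)) :
    Homogeneous q (gradingOp (modeWeight q wt)) (cexp c) (currentField S) := by
  refine Homogeneous.sum fun δ _ => ?_
  rw [show cexp c = cexp (-(wt δ - c)) * cexp (wt δ) by rw [← Complex.exp_add]; ring_nf]
  exact (homogeneous_gammaField hq (h δ)).conv hq (homogeneous_betaMode hq wt δ)
    (goodPair_gammaField_betaMode (hS δ))

/-! ### The filtration by ghost number -/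

/-- The ghost number of a monomial: each `γ` oscillator counts `1`, each `β` oscillator `-1`. -/
def ghostDegree : (R × ℤ →₀ ℕ) →+ ℤ := Finsupp.weight fun p => if 0 ≤ p.2 then 1 else -1

/-- The span of the monomials of ghost number at least `d`. -/
def degreeFiltration (R : Type*) (d : ℤ) : Submodule ℂ (GhostFock R) where
  carrier := {v | ∀ s, v.coeff s ≠ 0 → d ≤ ghostDegree s}
  add_mem' := fun {v w} hv hw s hs => by
    rw [MvPolynomial.coeff_add] at hs
    by_cases h : v.coeff s = 0
    · exact hw s fun h' => hs (by rw [h, h', add_zero])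
    · exact hv s h
  zero_mem' := fun s hs => absurd (MvPolynomial.coeff_zero s) hs
  smul_mem' := fun c v hv s hs => hv s fun h => hs (by rw [MvPolynomial.coeff_smul, h, smul_zero])

theorem degreeFiltration_mono {d d' : ℤ} (h : d ≤ d') :
    degreeFiltration R d' ≤ degreeFiltration R d := fun _ hv s hs => h.trans (hv s hs)

/-- A mode of γ either creates a γ oscillator or destroys a β oscillator, and both raise the ghost
number by one. -/
theorem gammaMode_mem_degreeFiltration {d : ℤ} {v : GhostFock R} (hv : v ∈ degreeFiltration R d)
    (α : R) (m : ℤ) : gammaMode α m v ∈ degreeFiltration R (d + 1) := by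
  classical
  intro s hs
  rcases le_or_gt m 0 with hm | hm
  · rw [gammaMode_of_nonpos hm, MvPolynomial.coeff_X_mul'] at hs
    split_ifs at hs with h
    · have h1 := hv _ hs
      have h2 : s = (s - Finsupp.single (α, -m) 1) + Finsupp.single (α, -m) 1 := by
        rw [tsub_add_cancel_of_le]
        rw [Finsupp.single_le_iff]
        have := Finsupp.mem_support_iff.1 h
        omega
      rw [h2, map_add, ghostDegree, Finsupp.weight_single, one_smul, if_pos (by simpa using hm)]
      exact add_le_add_left h1 1
    · exact absurd rfl hs
  · rw [gammaMode_of_pos hm, MvPolynomial.coeff_neg, neg_ne_zero, MvPolynomial.coeff_pderiv] at hs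
    have h1 := hv _ (left_ne_zero_of_mul hs)
    rw [map_add, ghostDegree, Finsupp.weight_single, one_smul, if_neg (by simpa using hm)] at h1
    exact (by linarith [show d ≤ ghostDegree s + -1 from h1])

theorem gammaWordField_mem_degreeFiltration (l : List R) (m : ℤ) {d : ℤ} {v : GhostFock R}
    (hv : v ∈ degreeFiltration R d) :
    gammaWordField l m v ∈ degreeFiltration R (d + l.length) := by
  induction l generalizing m with
  | nil =>
    by_cases h : m = 0
    · simpa [gammaWordField, unitField, h] using hv
    · simp [gammaWordField, unitField, h]
  | cons α l ih =>
    rw [gammaWordField, conv_apply_of_fcomm (FComm.gammaWordField (fcomm_gammaMode α) l)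
      (lowerBdd_gammaMode α) (lowerBdd_gammaWordField l), List.length_cons, Nat.cast_succ,
      ← add_assoc]
    exact finsum_induction (· ∈ degreeFiltration R (d + l.length + 1)) (zero_mem _)
      (fun x y => add_mem) fun k => gammaMode_mem_degreeFiltration (ih _) α k

theorem gammaField_sub_mem_degreeFiltration (P : MvPolynomial R ℂ) (m : ℤ) {d : ℤ}
    {v : GhostFock R} (hv : v ∈ degreeFiltration R d) :
    gammaField P m v - (if m = 0 then P.coeff 0 else 0) • v ∈ degreeFiltration R (d + 1) := by
  classical
  induction P using MvPolynomial.induction_on' with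
  | monomial s c =>
    rw [gammaField_monomial]
    by_cases hs : s = 0
    · subst hs
      by_cases hm : m = 0 <;> simp [gammaMonomial, gammaWordField, unitField, hm]
    · rw [MvPolynomial.coeff_monomial, if_neg hs, ite_self, zero_smul, sub_zero]
      refine Submodule.smul_mem _ c (degreeFiltration_mono ?_
        (gammaWordField_mem_degreeFiltration _ m hv))
      have : 0 < (Finsupp.toMultiset s).toList.length := by
        rw [Multiset.length_toList, Multiset.card_pos]
        exact fun h => hs (by rw [← Finsupp.toMultiset_toFinsupp s, h, map_zero])
      omega
  | add P Q hP hQ =>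
    have := add_mem hP hQ
    have e : gammaField (P + Q) m v - (if m = 0 then (P + Q).coeff 0 else 0) • v
        = gammaField P m v - (if m = 0 then P.coeff 0 else 0) • v
          + (gammaField Q m v - (if m = 0 then Q.coeff 0 else 0) • v) := by
      rw [map_add, Pi.add_apply, LinearMap.add_apply]
      split_ifs
      · rw [MvPolynomial.coeff_add, add_smul]
        abel
      · simp
    rwa [e]

theorem composeFin_zero {V : Type*} (f : Fin 0 → V → V) : composeFin f = id := rfl

theorem composeFin_succ {V : Type*} {n : ℕ} (f : Fin (n + 1) → V → V) :
    composeFin f = f 0 ∘ composeFin fun i => f i.succ := by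
  simp [composeFin, List.ofFn_succ]

theorem composeFin_sub_mem {V : Type*} [AddCommGroup V] [Module ℂ V] (F : ℤ → Submodule ℂ V)
    (hF : ∀ d, F (d + 1) ≤ F d) {n : ℕ} (f : Fin n → V → V) (c : Fin n → ℂ)
    (hf : ∀ i d v, v ∈ F d → f i v - c i • v ∈ F (d + 1)) {d : ℤ} {v : V} (hv : v ∈ F d) :
    composeFin f v - (∏ i, c i) • v ∈ F (d + 1) := by
  induction n with
  | zero => simp [composeFin_zero]
  | succ n ih =>
    have h1 := ih (fun i => f i.succ) (fun i => c i.succ) fun i => hf i.succ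
    set w := composeFin (fun i => f i.succ) v with hw
    have h2 : w ∈ F d := by
      have := add_mem (hF d h1) (Submodule.smul_mem (F d) (∏ i, c (Fin.succ i)) hv)
      rwa [sub_add_cancel] at this
    have h3 := add_mem (hf 0 d w h2) (Submodule.smul_mem (F (d + 1)) (c 0) h1)
    rw [composeFin_succ, Function.comp, Fin.prod_univ_succ, ← hw]
    convert h3 using 1
    rw [smul_sub, smul_smul]
    abel

/-- Nonconstant monomials in γ strictly raise the ghost number and so have no diagonal matrix
elements. Only the constant terms survive, which is the start of the recursion. -/
theorem coeff_composeFin_gammaPoly {n : ℕ} (P : Fin n → MvPolynomial R ℂ) (k : Fin n → ℤ)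
    (s : R × ℤ →₀ ℕ) :
    MvPolynomial.coeff s (composeFin (fun a => gammaPoly (P a) (k a)) (MvPolynomial.monomial s 1))
      = if k = 0 then ∏ a, (P a).coeff 0 else 0 := by
  classical
  have hv : (MvPolynomial.monomial s 1 : GhostFock R) ∈ degreeFiltration R (ghostDegree s) := by
    intro t ht
    rw [MvPolynomial.coeff_monomial] at ht
    split_ifs at ht with h
    · rw [h]
    · exact absurd rfl ht
  have h := composeFin_sub_mem (degreeFiltration R) (fun d => degreeFiltration_mono (by omega))
    (fun a => gammaPoly (P a) (k a)) (fun a => if k a = 0 then (P a).coeff 0 else 0)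
    (fun a d v hv => by
      rw [← gammaField_apply]
      exact gammaField_sub_mem_degreeFiltration (P a) (k a) hv) hv
  have h2 : MvPolynomial.coeff s (composeFin (fun a => gammaPoly (P a) (k a))
      (MvPolynomial.monomial s 1) - (∏ a, if k a = 0 then (P a).coeff 0 else 0) •
        (MvPolynomial.monomial s 1 : GhostFock R)) = 0 := by
    by_contra hne
    have := h s hne
    omega
  rw [MvPolynomial.coeff_sub, MvPolynomial.coeff_smul, MvPolynomial.coeff_monomial, if_pos rfl,
    smul_eq_mul, mul_one, sub_eq_zero] at h2
  rw [h2]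
  split_ifs with hk
  · simp [hk]
  · obtain ⟨a, ha⟩ := Function.ne_iff.1 hk
    exact Finset.prod_eq_zero (Finset.mem_univ a) (if_neg ha)

end Grading

end

end GenusOneWard

namespace GenusOneWard

open Complex Filter Topology

open scoped ENNReal NNReal

noncomputable section

/-! ### Weighted `ℓ¹` norms -/

section Norms

variable {ι : Type*}

/-- The weighted `ℓ¹` norm `∑ₛ |vₛ| ρ^s` of a polynomial. -/
def wnorm (ρ : ι → ℝ≥0) (v : MvPolynomial ι ℂ) : ℝ≥0∞ :=
  ∑' s : ι →₀ ℕ, ‖v.coeff s‖ₑ * (expProd ρ s : ℝ≥0)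

theorem wnorm_zero (ρ : ι → ℝ≥0) : wnorm ρ 0 = 0 := by simp [wnorm]

theorem wnorm_add_le (ρ : ι → ℝ≥0) (v w : MvPolynomial ι ℂ) :
    wnorm ρ (v + w) ≤ wnorm ρ v + wnorm ρ w := by
  rw [wnorm, wnorm, wnorm, ← ENNReal.tsum_add]
  refine ENNReal.tsum_le_tsum fun s => ?_
  rw [← add_mul, MvPolynomial.coeff_add]
  gcongr
  exact enorm_add_le _ _

theorem wnorm_smul (ρ : ι → ℝ≥0) (c : ℂ) (v : MvPolynomial ι ℂ) :
    wnorm ρ (c • v) = ‖c‖ₑ * wnorm ρ v := by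
  rw [wnorm, wnorm, ← ENNReal.tsum_mul_left]
  refine tsum_congr fun s => ?_
  rw [MvPolynomial.coeff_smul, smul_eq_mul, enorm_mul, mul_assoc]

theorem wnorm_neg (ρ : ι → ℝ≥0) (v : MvPolynomial ι ℂ) : wnorm ρ (-v) = wnorm ρ v := by
  simp [wnorm]

theorem wnorm_sum_le {κ : Type*} (ρ : ι → ℝ≥0) (I : Finset κ) (v : κ → MvPolynomial ι ℂ) :
    wnorm ρ (∑ i ∈ I, v i) ≤ ∑ i ∈ I, wnorm ρ (v i) := by
  classical
  induction I using Finset.induction_on with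
  | empty => simp [wnorm_zero]
  | insert i I hi ih =>
    rw [Finset.sum_insert hi, Finset.sum_insert hi]
    exact (wnorm_add_le ρ _ _).trans (by gcongr)

theorem wnorm_finsum_le {κ : Type*} (ρ : ι → ℝ≥0) (v : κ → MvPolynomial ι ℂ) :
    wnorm ρ (∑ᶠ i, v i) ≤ ∑' i, wnorm ρ (v i) := by
  by_cases h : (Function.support v).Finite
  · rw [finsum_eq_sum v h]
    exact (wnorm_sum_le ρ _ v).trans (ENNReal.sum_le_tsum _)
  · rw [finsum_of_infinite_support h, wnorm_zero]
    exact bot_le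

theorem wnorm_monomial (ρ : ι → ℝ≥0) (s : ι →₀ ℕ) (c : ℂ) :
    wnorm ρ (MvPolynomial.monomial s c) = ‖c‖ₑ * (expProd ρ s : ℝ≥0) := by
  classical
  rw [wnorm, tsum_eq_single s]
  · rw [MvPolynomial.coeff_monomial, if_pos rfl]
  · intro t ht
    rw [MvPolynomial.coeff_monomial, if_neg ht.symm]
    simp

theorem enorm_coeff_le_wnorm (ρ : ι → ℝ≥0) (s : ι →₀ ℕ) (v : MvPolynomial ι ℂ) :
    ‖v.coeff s‖ₑ * (expProd ρ s : ℝ≥0) ≤ wnorm ρ v :=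
  ENNReal.le_tsum (f := fun s => ‖v.coeff s‖ₑ * ((expProd ρ s : ℝ≥0) : ℝ≥0∞)) s

theorem expProd_mono {ρ ρ' : ι → ℝ≥0} (h : ρ' ≤ ρ) (s : ι →₀ ℕ) : expProd ρ' s ≤ expProd ρ s :=
  Finset.prod_le_prod' fun i _ => pow_le_pow_left' (h i) _

theorem wnorm_mono {ρ ρ' : ι → ℝ≥0} (h : ρ' ≤ ρ) (v : MvPolynomial ι ℂ) :
    wnorm ρ' v ≤ wnorm ρ v :=
  ENNReal.tsum_le_tsum fun s => by
    gcongr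
    exact expProd_mono h s

theorem wnorm_eq_sum (ρ : ι → ℝ≥0) (v : MvPolynomial ι ℂ) :
    wnorm ρ v = ∑ s ∈ v.support, ‖v.coeff s‖ₑ * (expProd ρ s : ℝ≥0) :=
  tsum_eq_sum fun s hs => by
    rw [MvPolynomial.notMem_support_iff.1 hs]
    simp

theorem wnorm_map_le {ρ ρ' : ι → ℝ≥0} {C : ℝ≥0∞} (T : Module.End ℂ (MvPolynomial ι ℂ))
    (h : ∀ s, wnorm ρ' (T (MvPolynomial.monomial s 1)) ≤ C * (expProd ρ s : ℝ≥0))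
    (v : MvPolynomial ι ℂ) : wnorm ρ' (T v) ≤ C * wnorm ρ v := by
  have hv : T v = ∑ s ∈ v.support, v.coeff s • T (MvPolynomial.monomial s 1) := by
    conv_lhs => rw [v.as_sum, map_sum]
    refine Finset.sum_congr rfl fun s _ => ?_
    rw [← map_smul, MvPolynomial.smul_monomial, smul_eq_mul, mul_one]
  rw [hv, wnorm_eq_sum ρ v, Finset.mul_sum]
  refine (wnorm_sum_le _ _ _).trans (Finset.sum_le_sum fun s _ => ?_)
  rw [wnorm_smul, mul_left_comm]
  gcongr
  exact h s

theorem wnorm_X_mul_le (ρ : ι → ℝ≥0) (i : ι) (v : MvPolynomial ι ℂ) :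
    wnorm ρ (MvPolynomial.X i * v) ≤ ρ i * wnorm ρ v := by
  refine wnorm_map_le (LinearMap.mulLeft ℂ (MvPolynomial.X i)) (fun s => ?_) v
  rw [LinearMap.mulLeft_apply, MvPolynomial.X, MvPolynomial.monomial_mul, one_mul, wnorm_monomial,
    expProd_add, expProd_single, pow_one]
  simp

/-- The left side is a single term of the binomial expansion of the right side. -/
theorem nsmul_pow_mul_le (x y : ℝ≥0) (n : ℕ) : n * x ^ (n - 1) * y ≤ (x + y) ^ n := by
  induction n with
  | zero => simp
  | succ n ih =>
    have h1 : x ^ n ≤ (x + y) ^ n := pow_le_pow_left' (by simp) n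
    have h2 : (n : ℝ≥0) * x ^ n * y ≤ (x + y) ^ n * x := by
      rcases n.eq_zero_or_pos with rfl | hn
      · simp
      · calc (n : ℝ≥0) * x ^ n * y = (n * x ^ (n - 1) * y) * x := by
              rw [← Nat.sub_add_cancel hn, pow_succ]
              simp only [Nat.add_sub_cancel]
              ring
          _ ≤ _ := by gcongr
    calc ((n + 1 : ℕ) : ℝ≥0) * x ^ (n + 1 - 1) * y = n * x ^ n * y + x ^ n * y := by
          rw [Nat.add_sub_cancel]
          push_cast
          ring
      _ ≤ (x + y) ^ n * x + (x + y) ^ n * y := by gcongr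
      _ = (x + y) ^ (n + 1) := by ring

/-- A Cauchy estimate: a derivative costs the inverse of the amount d by which the radius of the
variable shrinks. -/
theorem wnorm_pderiv_le {ρ ρ' : ι → ℝ≥0} (h : ρ' ≤ ρ) {i : ι} {d : ℝ≥0} (hd0 : d ≠ 0)
    (hd : ρ' i + d ≤ ρ i) (v : MvPolynomial ι ℂ) :
    wnorm ρ' (MvPolynomial.pderiv i v) ≤ (d⁻¹ : ℝ≥0) * wnorm ρ v := by
  classical
  refine wnorm_map_le (MvPolynomial.pderiv i).toLinearMap (fun s => ?_) v
  change wnorm ρ' (MvPolynomial.pderiv i _) ≤ _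
  rw [MvPolynomial.pderiv_monomial, wnorm_monomial, one_mul, ← enorm_norm, Complex.norm_natCast]
  have h1 : s - Finsupp.single i 1 = Finsupp.single i (s i - 1) + s.erase i := by
    ext j
    by_cases hj : j = i
    · subst hj
      simp
    · simp [Finsupp.erase_ne hj, Finsupp.single_eq_of_ne hj]
  have h2 : expProd ρ s = ρ i ^ s i * expProd ρ (s.erase i) := by
    conv_lhs => rw [← Finsupp.single_add_erase i s, expProd_add, expProd_single]
  rw [h1, h2, expProd_add, expProd_single]
  have h3 : (s i : ℝ≥0) * (ρ' i ^ (s i - 1) * expProd ρ' (s.erase i))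
      ≤ d⁻¹ * (ρ i ^ s i * expProd ρ (s.erase i)) := by
    rw [le_inv_mul_iff₀ (pos_iff_ne_zero.2 hd0)]
    calc d * ((s i : ℝ≥0) * (ρ' i ^ (s i - 1) * expProd ρ' (s.erase i)))
        = (s i * ρ' i ^ (s i - 1) * d) * expProd ρ' (s.erase i) := by ring
      _ ≤ (ρ' i + d) ^ s i * expProd ρ (s.erase i) := by
          gcongr
          · exact nsmul_pow_mul_le _ _ _
          · exact expProd_mono h _
      _ ≤ _ := by gcongr
  have h4 : ‖((s i : ℕ) : ℝ)‖ₑ = ((s i : ℝ≥0) : ℝ≥0∞) := by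
    rw [← ofReal_norm, Real.norm_natCast]
    simp
  rw [h4]
  exact_mod_cast h3

/-! ### Families of operators bounded between weighted norms -/

/-- `∑ₖ x^{-k} ‖O[k] v‖_{ρ'} ≤ C ‖v‖_ρ`. -/
def FieldBound (O : ℤ → MvPolynomial ι ℂ → MvPolynomial ι ℂ) (x : ℝ≥0) (ρ ρ' : ι → ℝ≥0) : Prop :=
  ∃ C : ℝ≥0, ∀ v, ∑' k : ℤ, ((x ^ (-k) : ℝ≥0) : ℝ≥0∞) * wnorm ρ' (O k v) ≤ C * wnorm ρ v

theorem FieldBound.mono {O : ℤ → MvPolynomial ι ℂ → MvPolynomial ι ℂ} {x : ℝ≥0}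
    {ρ ρ' σ σ' : ι → ℝ≥0} (h : FieldBound O x ρ ρ') (h1 : ρ ≤ σ) (h2 : σ' ≤ ρ') :
    FieldBound O x σ σ' := by
  obtain ⟨C, hC⟩ := h
  refine ⟨C, fun v => le_trans (ENNReal.tsum_le_tsum fun k => ?_) ((hC v).trans ?_)⟩
  · gcongr
    exact wnorm_mono h2 _
  · gcongr
    exact wnorm_mono h1 v

theorem FieldBound.of_le {O : ℤ → MvPolynomial ι ℂ → MvPolynomial ι ℂ} {x : ℝ≥0}
    {ρ ρ' : ι → ℝ≥0} {g : ℤ → ℝ≥0} (h : ∀ k v, wnorm ρ' (O k v) ≤ g k * wnorm ρ v)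
    (hg : Summable fun k => x ^ (-k) * g k) : FieldBound O x ρ ρ' := by
  refine ⟨∑' k, x ^ (-k) * g k, fun v => ?_⟩
  rw [ENNReal.coe_tsum hg, ← ENNReal.tsum_mul_right]
  refine ENNReal.tsum_le_tsum fun k => ?_
  rw [ENNReal.coe_mul, mul_assoc]
  gcongr
  exact h k v

theorem FieldBound.sum {κ : Type*} {I : Finset κ}
    {O : κ → ℤ → MvPolynomial ι ℂ → MvPolynomial ι ℂ} {x : ℝ≥0} {ρ ρ' : ι → ℝ≥0} {c : κ → ℂ}
    (h : ∀ i ∈ I, FieldBound (O i) x ρ ρ') :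
    FieldBound (fun k v => ∑ i ∈ I, c i • O i k v) x ρ ρ' := by
  classical
  induction I using Finset.induction_on with
  | empty => exact ⟨0, fun v => by simp [wnorm_zero]⟩
  | insert i I hi ih =>
    obtain ⟨C, hC⟩ := h i (Finset.mem_insert_self i I)
    obtain ⟨C', hC'⟩ := ih fun j hj => h j (Finset.mem_insert_of_mem hj)
    refine ⟨‖c i‖₊ * C + C', fun v => ?_⟩
    rw [ENNReal.coe_add, ENNReal.coe_mul, add_mul, mul_assoc]
    refine le_trans ?_ (add_le_add (mul_le_mul_right (hC v) (‖c i‖₊ : ℝ≥0∞)) (hC' v))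
    rw [← ENNReal.tsum_mul_left, ← ENNReal.tsum_add]
    refine ENNReal.tsum_le_tsum fun k => ?_
    simp only [Finset.sum_insert hi]
    rw [mul_left_comm, ← mul_add]
    gcongr
    refine (wnorm_add_le _ _ _).trans ?_
    rw [wnorm_smul]
    rfl

/-- With j = m - k the weight x^{-m} factors as x^{-j} x^{-k} and the sums decouple. The norms stay
inside the sum over k, so the bound can be compared termwise with normally ordered products. -/
theorem tsum_conv_le {O O' : ℤ → MvPolynomial ι ℂ → MvPolynomial ι ℂ} {x : ℝ≥0} (hx : x ≠ 0)
    {ρ σ ρ' : ι → ℝ≥0} (h : FieldBound O x σ ρ') (h' : FieldBound O' x ρ σ) :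
    ∃ C : ℝ≥0, ∀ v, ∑' m : ℤ, ((x ^ (-m) : ℝ≥0) : ℝ≥0∞) *
      ∑' k : ℤ, wnorm ρ' (O k (O' (m - k) v)) ≤ C * wnorm ρ v := by
  obtain ⟨C, hC⟩ := h
  obtain ⟨C', hC'⟩ := h'
  refine ⟨C * C', fun v => ?_⟩
  calc ∑' m : ℤ, ((x ^ (-m) : ℝ≥0) : ℝ≥0∞) * ∑' k : ℤ, wnorm ρ' (O k (O' (m - k) v))
      = ∑' k : ℤ, ∑' m : ℤ, ((x ^ (-m) : ℝ≥0) : ℝ≥0∞) * wnorm ρ' (O k (O' (m - k) v)) := by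
        simp only [← ENNReal.tsum_mul_left]
        exact ENNReal.tsum_comm
    _ = ∑' k : ℤ, ∑' j : ℤ, ((x ^ (-(j + k)) : ℝ≥0) : ℝ≥0∞) * wnorm ρ' (O k (O' j v)) := by
        refine tsum_congr fun k => ?_
        rw [← (Equiv.addRight k).tsum_eq]
        refine tsum_congr fun j => ?_
        simp
    _ = ∑' j : ℤ, ((x ^ (-j) : ℝ≥0) : ℝ≥0∞) * ∑' k : ℤ, ((x ^ (-k) : ℝ≥0) : ℝ≥0∞) *
          wnorm ρ' (O k (O' j v)) := by
        rw [ENNReal.tsum_comm]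
        refine tsum_congr fun j => ?_
        rw [← ENNReal.tsum_mul_left]
        refine tsum_congr fun k => ?_
        rw [neg_add, zpow_add₀ hx, ENNReal.coe_mul, mul_assoc]
    _ ≤ ∑' j : ℤ, ((x ^ (-j) : ℝ≥0) : ℝ≥0∞) * (C * wnorm σ (O' j v)) := by
        refine ENNReal.tsum_le_tsum fun j => ?_
        gcongr
        exact hC _
    _ = C * ∑' j : ℤ, ((x ^ (-j) : ℝ≥0) : ℝ≥0∞) * wnorm σ (O' j v) := by
        rw [← ENNReal.tsum_mul_left]
        exact tsum_congr fun j => mul_left_comm _ _ _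
    _ ≤ C * (C' * wnorm ρ v) := by
        gcongr
        exact hC' v
    _ = _ := by rw [ENNReal.coe_mul, mul_assoc]

end Norms

end

end GenusOneWard

namespace GenusOneWard

open Complex Filter Topology

open scoped ENNReal NNReal

noncomputable section

/-! ### Norm bounds for the modes of ghost fields and currents -/

section FieldBounds

variable {R : Type*}

/-- The weights of the oscillators: `c r^k` for `γ^α[-k]` and `c u^{k-1}` for `β_α[-k]`. -/
def oscRadius (R : Type*) (c r u : ℝ≥0) (p : R × ℤ) : ℝ≥0 :=
  if 0 ≤ p.2 then c * r ^ p.2.natAbs else c * u ^ (p.2.natAbs - 1)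

theorem oscRadius_mono {c r u c' r' u' : ℝ≥0} (hc : c' ≤ c) (hr : r' ≤ r) (hu : u' ≤ u) :
    oscRadius R c' r' u' ≤ oscRadius R c r u := fun p => by
  unfold oscRadius
  split_ifs <;> gcongr

theorem lt_of_mul_lt_one_lt {r u x : ℝ≥0} (h1 : r * x < 1) (h2 : 1 < u * x) : r < u :=
  lt_of_mul_lt_mul_right (h1.trans h2) bot_le

theorem ne_zero_of_one_lt_mul {u x : ℝ≥0} (h : 1 < u * x) : u ≠ 0 ∧ x ≠ 0 :=
  mul_ne_zero_iff.1 (zero_lt_one.trans h).ne'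

theorem summable_nnreal_of_nat_of_neg {f : ℤ → ℝ≥0} (h1 : Summable fun n : ℕ => f n)
    (h2 : Summable fun n : ℕ => f (-((n : ℤ) + 1))) : Summable f :=
  NNReal.summable_coe.1
    (Summable.of_nat_of_neg_add_one (NNReal.summable_coe.2 h1) (NNReal.summable_coe.2 h2))

theorem summable_inv_pow {y : ℝ≥0} (h : 1 < y) : Summable fun n : ℕ => (y ^ n)⁻¹ := by
  simp only [← inv_pow]
  exact NNReal.summable_geometric (inv_lt_one_of_one_lt₀ h)

/-- Creation modes form a geometric series of ratio r'x, and annihilation modes, by the Cauchy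
estimate, one of ratio 1/(ux). The strict decrease of c pays for the derivative. As γ creates only γ
oscillators and destroys only β oscillators, r and u enter separately, so several γ fields can sit
at one point. -/
theorem fieldBound_gammaMode (α : R) {x c r u c' r' u' : ℝ≥0} (hc : c' < c) (hr : r' ≤ r)
    (hu : u' ≤ u) (h1 : r' * x < 1) (h2 : 1 < u * x) :
    FieldBound (fun k v => gammaMode α k v) x (oscRadius R c r u) (oscRadius R c' r' u') := by
  obtain ⟨hu0, hx0⟩ := ne_zero_of_one_lt_mul h2
  have hcc : c - c' ≠ 0 := (tsub_pos_of_lt hc).ne'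
  have hmono := oscRadius_mono (R := R) hc.le hr hu
  refine FieldBound.of_le (g := fun k => if k ≤ 0 then c' * r' ^ k.natAbs
    else ((c - c') * u ^ (k.natAbs - 1))⁻¹) (fun k v => ?_) ?_
  · split_ifs with hk
    · rw [gammaMode_of_nonpos hk]
      refine (wnorm_X_mul_le _ _ _).trans ?_
      rw [show oscRadius R c' r' u' (α, -k) = c' * r' ^ k.natAbs by simp [oscRadius, hk]]
      gcongr
      exact wnorm_mono hmono v
    · rw [gammaMode_of_pos (not_le.1 hk), wnorm_neg]
      refine wnorm_pderiv_le hmono (mul_ne_zero hcc (pow_ne_zero _ hu0)) ?_ v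
      simp only [oscRadius, Int.natAbs_neg, Left.nonneg_neg_iff, if_neg hk]
      calc c' * u' ^ (k.natAbs - 1) + (c - c') * u ^ (k.natAbs - 1)
          ≤ c' * u ^ (k.natAbs - 1) + (c - c') * u ^ (k.natAbs - 1) := by gcongr
        _ = c * u ^ (k.natAbs - 1) := by rw [← add_mul, add_tsub_cancel_of_le hc.le]
  · refine summable_nnreal_of_nat_of_neg ((NNReal.summable_nat_add_iff 1).1 ?_) ?_
    · refine ((summable_inv_pow h2).mul_left (x⁻¹ * (c - c')⁻¹)).congr fun n => ?_
      rw [if_neg (by omega), show ((n + 1 : ℕ) : ℤ).natAbs - 1 = n by omega, zpow_neg,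
        zpow_natCast, pow_succ, mul_inv, mul_inv, mul_pow, mul_inv]
      ring
    · refine ((NNReal.summable_geometric h1).mul_left (c' * (r' * x))).congr fun n => ?_
      rw [if_pos (by omega), show (-((n : ℤ) + 1)).natAbs = n + 1 by omega, neg_neg,
        ← Nat.cast_succ, zpow_natCast, mul_pow, pow_succ, pow_succ]
      ring

theorem fieldBound_betaMinus (δ : R) {x c r u c' r' u' : ℝ≥0} (hc : c' < c) (hr : r' ≤ r)
    (hu : u' ≤ u) (h2 : 1 < r * x) :
    FieldBound (fun k v => if 0 ≤ k then betaMode δ k v else 0) x (oscRadius R c r u)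
      (oscRadius R c' r' u') := by
  obtain ⟨hr0, hx0⟩ := ne_zero_of_one_lt_mul h2
  have hcc : c - c' ≠ 0 := (tsub_pos_of_lt hc).ne'
  refine FieldBound.of_le (g := fun k => if 0 ≤ k then ((c - c') * r ^ k.natAbs)⁻¹ else 0)
    (fun k v => ?_) ?_
  · split_ifs with hk
    · rw [betaMode_of_nonneg hk]
      refine wnorm_pderiv_le (oscRadius_mono hc.le hr hu) (mul_ne_zero hcc (pow_ne_zero _ hr0)) ?_ v
      simp only [oscRadius, if_pos hk]
      calc c' * r' ^ k.natAbs + (c - c') * r ^ k.natAbs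
          ≤ c' * r ^ k.natAbs + (c - c') * r ^ k.natAbs := by gcongr
        _ = c * r ^ k.natAbs := by rw [← add_mul, add_tsub_cancel_of_le hc.le]
    · simp [wnorm_zero]
  · refine summable_nnreal_of_nat_of_neg ?_ ?_
    · refine ((summable_inv_pow h2).mul_left (c - c')⁻¹).congr fun n => ?_
      rw [if_pos (by omega), Int.natAbs_natCast, zpow_neg, zpow_natCast, mul_inv, mul_pow, mul_inv]
      ring
    · refine summable_zero.congr fun n => ?_
      rw [if_neg (by omega), mul_zero]

theorem fieldBound_betaPlus (δ : R) {x c r u c' r' u' : ℝ≥0} (hc : c' ≤ c) (hr : r' ≤ r)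
    (hu : u' ≤ u) (h1 : u' * x < 1) :
    FieldBound (fun k v => if 0 ≤ k then 0 else betaMode δ k v) x (oscRadius R c r u)
      (oscRadius R c' r' u') := by
  refine FieldBound.of_le (g := fun k => if 0 ≤ k then 0 else c' * u' ^ (k.natAbs - 1))
    (fun k v => ?_) ?_
  · split_ifs with hk
    · simp [wnorm_zero]
    · rw [betaMode_of_neg (not_le.1 hk)]
      refine (wnorm_X_mul_le _ _ _).trans ?_
      simp only [oscRadius, if_neg hk]
      gcongr
      exact wnorm_mono (oscRadius_mono hc hr hu) v
  · refine summable_nnreal_of_nat_of_neg ?_ ?_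
    · refine summable_zero.congr fun n => ?_
      rw [if_pos (by omega), mul_zero]
    · refine ((NNReal.summable_geometric h1).mul_left (c' * x)).congr fun n => ?_
      rw [if_neg (by omega), show (-((n : ℤ) + 1)).natAbs - 1 = n by omega, neg_neg,
        ← Nat.cast_succ, zpow_natCast, mul_pow, pow_succ]
      ring

theorem fieldBound_unit {x c r u c' r' u' : ℝ≥0} (hc : c' ≤ c) (hr : r' ≤ r) (hu : u' ≤ u) :
    FieldBound (fun (k : ℤ) (v : GhostFock R) => if k = 0 then v else 0) x (oscRadius R c r u)
      (oscRadius R c' r' u') := by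
  refine ⟨1, fun v => ?_⟩
  rw [tsum_eq_single 0]
  · simpa using wnorm_mono (oscRadius_mono hc hr hu) v
  · intro k hk
    simp [hk, wnorm_zero]

/-- Only the scale c has to decrease strictly from letter to letter: the later factors act with r
already lowered to r', and u is kept until the last one. -/
theorem fieldBound_gammaWord (l : List R) {x c r u c' r' u' : ℝ≥0} (hc : c' < c) (hr : r' ≤ r)
    (hu : u' ≤ u) (h1 : r' * x < 1) (h2 : 1 < u * x) :
    FieldBound (gammaWord l) x (oscRadius R c r u) (oscRadius R c' r' u') := by
  induction l generalizing c' u' with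
  | nil => exact fieldBound_unit hc.le hr hu
  | cons α l ih =>
    obtain ⟨c₁, hc₁, hc₁'⟩ := exists_between hc
    obtain ⟨C, hC⟩ := tsum_conv_le (ne_zero_of_one_lt_mul h2).2
      (fieldBound_gammaMode α hc₁ le_rfl hu h1 h2) (ih hc₁' le_rfl)
    refine ⟨C, fun v => le_trans (ENNReal.tsum_le_tsum fun m => ?_) (hC v)⟩
    gcongr
    exact wnorm_finsum_le _ _

theorem fieldBound_gammaPoly (P : MvPolynomial R ℂ) {x c r u c' r' u' : ℝ≥0} (hc : c' < c)
    (hr : r' ≤ r) (hu : u' ≤ u) (h1 : r' * x < 1) (h2 : 1 < u * x) :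
    FieldBound (gammaPoly P) x (oscRadius R c r u) (oscRadius R c' r' u') :=
  FieldBound.sum fun _ _ => fieldBound_gammaWord _ hc hr hu h1 h2

theorem gammaPoly_zero (P : MvPolynomial R ℂ) (m : ℤ) : gammaPoly P m 0 = 0 := by
  rw [← gammaField_apply, map_zero]

/-- Normal ordering decides when the radii drop. Annihilators of β act while r is still large;
creators of β act last, when the radius of the β oscillators may be lowered. -/
theorem fieldBound_currentMode [Fintype R] (S : R → MvPolynomial R ℂ) {x c r c' r' : ℝ≥0}
    (hc : c' < c) (h1 : r' * x < 1) (h2 : 1 < r * x) :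
    FieldBound (currentMode S) x (oscRadius R c r r) (oscRadius R c' r' r') := by
  obtain ⟨c₁, hc₁, hc₁'⟩ := exists_between hc
  have hx := (ne_zero_of_one_lt_mul h2).2
  have hr := (lt_of_mul_lt_one_lt h1 h2).le
  have key : ∀ δ, FieldBound (fun m v => ∑ᶠ k : ℤ, if 0 ≤ k then
      gammaPoly (S δ) (m - k) (betaMode δ k v) else betaMode δ k (gammaPoly (S δ) (m - k) v)) x
      (oscRadius R c r r) (oscRadius R c' r' r') := by
    intro δ
    -- The part with annihilators of β acting first.
    obtain ⟨A, hA⟩ := tsum_conv_le hx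
      ((fieldBound_gammaPoly (S δ) hc₁ hr le_rfl h1 h2).mono le_rfl (oscRadius_mono le_rfl le_rfl hr))
      (fieldBound_betaMinus δ hc₁' le_rfl le_rfl h2)
    -- The part with creators of β acting last.
    obtain ⟨B, hB⟩ := tsum_conv_le hx (fieldBound_betaPlus δ hc₁.le le_rfl hr h1)
      (fieldBound_gammaPoly (S δ) hc₁' hr le_rfl h1 h2)
    refine ⟨A + B, fun v => ?_⟩
    rw [ENNReal.coe_add, add_mul]
    refine le_trans ?_ (add_le_add (hA v) (hB v))
    rw [← ENNReal.tsum_add]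
    refine ENNReal.tsum_le_tsum fun m => ?_
    rw [← mul_add]
    gcongr
    refine (wnorm_finsum_le _ _).trans ?_
    rw [← (Equiv.subLeft m).tsum_eq (fun k => wnorm (oscRadius R c' r' r')
      (gammaPoly (S δ) k (if 0 ≤ m - k then betaMode δ (m - k) v else 0))), ← ENNReal.tsum_add]
    refine ENNReal.tsum_le_tsum fun k => ?_
    rw [Equiv.subLeft_apply, sub_sub_cancel]
    split_ifs
    · exact le_self_add
    · rw [gammaPoly_zero, wnorm_zero, zero_add]
  have := FieldBound.sum (I := Finset.univ) (c := fun _ => 1) fun δ _ => key δ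
  simp only [one_smul] at this
  exact this

end FieldBounds

end

end GenusOneWard

namespace GenusOneWard

open Complex Filter Topology

open scoped ENNReal NNReal

noncomputable section

/-! ### Composition of radially ordered fields -/

section Composition

variable {R : Type*}

/-- The modes of `O` are bounded between all pairs of oscillator norms whose radii enclose the
inverse of the modulus `x` of the insertion point. -/
def RadialBound (O : ℤ → GhostFock R → GhostFock R) (x : ℝ≥0) : Prop :=
  ∀ c r c' r' : ℝ≥0, c' < c → r' * x < 1 → 1 < r * x →
    FieldBound O x (oscRadius R c r r) (oscRadius R c' r' r')

theorem radialBound_gammaPoly (P : MvPolynomial R ℂ) (x : ℝ≥0) : RadialBound (gammaPoly P) x :=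
  fun _ _ _ _ hc h1 h2 => fieldBound_gammaPoly P hc (lt_of_mul_lt_one_lt h1 h2).le
    (lt_of_mul_lt_one_lt h1 h2).le h1 h2

theorem radialBound_currentMode [Fintype R] (S : R → MvPolynomial R ℂ) (x : ℝ≥0) :
    RadialBound (currentMode S) x :=
  fun _ _ _ _ hc h1 h2 => fieldBound_currentMode S hc h1 h2

/-- The radius is taken slightly above 1/x₀; every 1/x_i with i ≥ 1 is strictly larger than 1/x₀. -/
theorem exists_radius_between {N : ℕ} {x : Fin (N + 1) → ℝ≥0} (hx : StrictAnti x) {r : ℝ≥0}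
    (hr : 1 < r * x 0) : ∃ u, u ≤ r ∧ 1 < u * x 0 ∧ ∀ i : Fin N, u * x i.succ < 1 := by
  have hx0 := (ne_zero_of_one_lt_mul hr).2
  have h1 : ∀ᶠ u in 𝓝[>] (x 0)⁻¹, u < r := by
    refine nhdsWithin_le_nhds (gt_mem_nhds ?_)
    rwa [inv_lt_iff_one_lt_mul₀ (pos_iff_ne_zero.2 hx0)]
  have h2 : ∀ᶠ u in 𝓝[>] (x 0)⁻¹, ∀ i : Fin N, u * x i.succ < 1 := by
    refine nhdsWithin_le_nhds (eventually_all.2 fun i => ?_)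
    have hc : ContinuousAt (fun u : ℝ≥0 => u * x i.succ) (x 0)⁻¹ := by fun_prop
    refine hc.eventually_lt_const ?_
    rw [inv_mul_lt_one₀ (pos_iff_ne_zero.2 hx0)]
    exact hx (Fin.succ_pos i)
  have h3 : ∀ᶠ u in 𝓝[>] (x 0)⁻¹, (x 0)⁻¹ < u := self_mem_nhdsWithin
  obtain ⟨u, h1, h2, h3⟩ := (h1.and (h2.and h3)).exists
  refine ⟨u, h1.le, ?_, h2⟩
  rwa [← inv_lt_iff_one_lt_mul₀ (pos_iff_ne_zero.2 hx0)]

/-- The rightmost field acts first and has the smallest insertion point, so the oscillator radii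
decrease from r to r', passing each 1/x_i in turn. -/
theorem tsum_composeFin_le {N : ℕ} {O : Fin N → ℤ → GhostFock R → GhostFock R} {x : Fin N → ℝ≥0}
    (hO : ∀ i, RadialBound (O i) (x i)) (hx : StrictAnti x) {c r c' r' : ℝ≥0} (hc : c' < c)
    (hr : r' ≤ r) (h1 : ∀ i, r' * x i < 1) (h2 : ∀ i, 1 < r * x i) :
    ∃ C : ℝ≥0, ∀ v, ∑' κ : Fin N → ℤ, ((∏ i, x i ^ (-κ i) : ℝ≥0) : ℝ≥0∞) *
      wnorm (oscRadius R c' r' r') (composeFin (fun i => O i (κ i)) v)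
        ≤ C * wnorm (oscRadius R c r r) v := by
  induction N generalizing c' r' with
  | zero =>
    refine ⟨1, fun v => ?_⟩
    rw [tsum_eq_single default fun κ hκ => (hκ (Subsingleton.elim _ _)).elim, composeFin_zero]
    simpa using wnorm_mono (oscRadius_mono hc.le hr hr) v
  | succ N ih =>
    obtain ⟨u, hur, hu0, hu⟩ := exists_radius_between hx (h2 0)
    obtain ⟨c₁, hc₁, hc₁'⟩ := exists_between hc
    obtain ⟨C, hC⟩ := ih (fun i => hO i.succ) (fun i j h => hx (Fin.succ_lt_succ_iff.2 h)) hc₁' hur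
      hu (fun i => h2 i.succ)
    obtain ⟨C', hC'⟩ := hO 0 c₁ u c' r' hc₁ (h1 0) hu0
    refine ⟨C' * C, fun v => ?_⟩
    rw [← (Fin.consEquiv fun _ => ℤ).tsum_eq, ENNReal.tsum_prod', ENNReal.tsum_comm]
    calc _ = ∑' κ : Fin N → ℤ, ((∏ i, x i.succ ^ (-κ i) : ℝ≥0) : ℝ≥0∞) *
          ∑' k : ℤ, ((x 0 ^ (-k) : ℝ≥0) : ℝ≥0∞) * wnorm (oscRadius R c' r' r')
            (O 0 k (composeFin (fun i => O i.succ (κ i)) v)) := by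
          refine tsum_congr fun κ => ?_
          rw [← ENNReal.tsum_mul_left]
          refine tsum_congr fun k => ?_
          simp only [Fin.consEquiv_apply, composeFin_succ, Fin.prod_univ_succ, Fin.cons_zero,
            Fin.cons_succ, Function.comp_apply, ENNReal.coe_mul]
          ring
      _ ≤ ∑' κ : Fin N → ℤ, ((∏ i, x i.succ ^ (-κ i) : ℝ≥0) : ℝ≥0∞) *
          (C' * wnorm (oscRadius R c₁ u u) (composeFin (fun i => O i.succ (κ i)) v)) := by
          gcongr with κ
          exact hC' _
      _ = C' * ∑' κ : Fin N → ℤ, ((∏ i, x i.succ ^ (-κ i) : ℝ≥0) : ℝ≥0∞) *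
          wnorm (oscRadius R c₁ u u) (composeFin (fun i => O i.succ (κ i)) v) := by
          rw [← ENNReal.tsum_mul_left]
          exact tsum_congr fun κ => mul_left_comm _ _ _
      _ ≤ C' * (C * wnorm (oscRadius R c r r) v) := by
          gcongr
          exact hC v
      _ = _ := by rw [ENNReal.coe_mul, mul_assoc]

end Composition

/-! ### Absolute convergence of weighted traces -/

section Traces

variable {R : Type*}

/-- All 1/x_i must lie between r' and r with Q r < r'. There is room because Q times the largest
point is below the smallest one. -/
theorem exists_trace_radii {Q : ℝ≥0} (hQ0 : Q ≠ 0) (hQ : Q < 1) {N : ℕ} {x : Fin N → ℝ≥0}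
    (hx0 : ∀ i, x i ≠ 0) (hx : ∀ i j, Q * x i < x j) :
    ∃ r r' : ℝ≥0, r' ≤ r ∧ Q * r < r' ∧ (∀ i, r' * x i < 1) ∧ ∀ i, 1 < r * x i := by
  rcases N.eq_zero_or_pos with rfl | hN
  · exact ⟨1, 1, le_rfl, by simpa using hQ, fun i => i.elim0, fun i => i.elim0⟩
  have : Nonempty (Fin N) := ⟨⟨0, hN⟩⟩
  obtain ⟨a, ha⟩ := Finite.exists_max x
  obtain ⟨d, hd⟩ := Finite.exists_min x
  have hpos : ∀ i, 0 < x i := fun i => pos_iff_ne_zero.2 (hx0 i)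
  have h : Q * (x d)⁻¹ < (x a)⁻¹ := by
    rw [← div_eq_mul_inv, div_lt_iff₀ (hpos d), lt_inv_mul_iff₀ (hpos a), mul_comm]
    exact hx a d
  obtain ⟨r', h1, h2⟩ := exists_between h
  have h3 : (x d)⁻¹ < r' / Q := by
    rw [lt_div_iff₀ (pos_iff_ne_zero.2 hQ0), mul_comm]
    exact h1
  obtain ⟨r, h4, h5⟩ := exists_between h3
  refine ⟨r, r', ?_, ?_, fun i => ?_, fun i => ?_⟩
  · exact (h2.trans_le ((inv_anti₀ (hpos d) (ha d)).trans h4.le)).le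
  · rwa [lt_div_iff₀ (pos_iff_ne_zero.2 hQ0), mul_comm] at h5
  · calc r' * x i ≤ r' * x a := by gcongr; exact ha i
      _ < (x a)⁻¹ * x a := by gcongr; exact hpos a
      _ = 1 := inv_mul_cancel₀ (hx0 a)
  · calc 1 = (x d)⁻¹ * x d := (inv_mul_cancel₀ (hx0 d)).symm
      _ < r * x d := by gcongr; exact hpos d
      _ ≤ r * x i := by gcongr; exact hd i

/-- The weights `w` are so small that operators which are bounded from the norm `ρ` to the norm
`ρ'` have an absolutely convergent weighted trace. -/
def TraceDominated {ι : Type*} (w : ι → ℂ) (ρ ρ' : ι → ℝ≥0) : Prop :=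
  (∀ i, ρ' i ≠ 0) ∧ Summable fun s : ι →₀ ℕ => expProd (fun i => ‖w i‖₊ * (ρ i / ρ' i)) s

theorem summable_expProd_nnreal {ι : Type*} {y : ι → ℝ≥0} (h1 : ∀ i, y i < 1) (hs : Summable y) :
    Summable fun s : ι →₀ ℕ => expProd y s := by
  refine NNReal.summable_coe.1 ((summable_expProd_of_nonneg (y := fun i => (y i : ℝ))
    (fun i => (y i).2) (fun i => by exact_mod_cast h1 i) (NNReal.summable_coe.2 hs)).congr
    fun s => ?_)
  exact (map_expProd NNReal.toRealHom y s).symm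

/-- The loss r/r' per unit of energy is beaten by |q|, and the loss c/c' per oscillator by the slack
in 1 < |e^{α(H)}| < |q|⁻¹, which is uniform over finitely many roots. -/
theorem traceDominated_oscRadius [Finite R] {q : ℂ} {wt : R → ℂ}
    (hwt : ∀ α, 1 < ‖cexp (wt α)‖ ∧ ‖q * cexp (wt α)‖ < 1) {r r' : ℝ≥0} (hr0 : r' ≠ 0)
    (hr : ‖q‖₊ * r < r') :
    ∃ κ > 1, ∀ c c' : ℝ≥0, c' ≠ 0 → c ≤ κ * c' →
      TraceDominated (modeWeight q wt) (oscRadius R c r r) (oscRadius R c' r' r') := by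
  have := Fintype.ofFinite R
  set a : R → ℝ≥0 := fun α => ‖cexp (wt α)‖₊ with ha
  have ha1 : ∀ α, 1 < a α := fun α => (hwt α).1
  have ha0 : ∀ α, a α ≠ 0 := fun α => (zero_lt_one.trans (ha1 α)).ne'
  have ha2 : ∀ α, ‖q‖₊ * a α < 1 := fun α => by
    have := (hwt α).2
    rw [norm_mul] at this
    exact this
  have hev : ∀ᶠ κ in 𝓝[>] (1 : ℝ≥0), ∀ α, κ * (a α)⁻¹ < 1 ∧ κ * (‖q‖₊ * a α) < 1 := by
    refine nhdsWithin_le_nhds (eventually_all.2 fun α => ?_)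
    have hc (y : ℝ≥0) : ContinuousAt (fun κ : ℝ≥0 => κ * y) 1 := by fun_prop
    refine ((hc _).eventually_lt_const ?_).and ((hc _).eventually_lt_const ?_)
    · beta_reduce
      rw [one_mul]
      exact inv_lt_one_of_one_lt₀ (ha1 α)
    · beta_reduce
      rw [one_mul]
      exact ha2 α
  obtain ⟨κ, hκ, hκ1⟩ := (hev.and self_mem_nhdsWithin).exists
  refine ⟨κ, hκ1, fun c c' hc' hc => ⟨fun p => ?_, ?_⟩⟩
  · unfold oscRadius
    split_ifs <;> exact mul_ne_zero hc' (pow_ne_zero _ hr0)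
  set y := ‖q‖₊ * r / r' with hy
  have hy1 : y < 1 := by
    rw [hy, div_lt_one₀ (pos_iff_ne_zero.2 hr0)]
    exact hr
  -- The exponent k - 1 in the radius of β[-k] matters here: β[-1] then pays only |q e^{α(H)}| κ <
  -- 1, without a factor r/r'.
  set D : R × ℤ → ℝ≥0 := fun p => if 0 ≤ p.2 then κ * (a p.1)⁻¹ * y ^ p.2.natAbs
    else κ * (‖q‖₊ * a p.1) * y ^ (p.2.natAbs - 1) with hD
  have hle : ∀ p, ‖modeWeight q wt p‖₊ * (oscRadius R c r r p / oscRadius R c' r' r' p) ≤ D p := by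
    intro p
    have hcκ : c / c' ≤ κ := by rwa [div_le_iff₀ (pos_iff_ne_zero.2 hc')]
    rw [modeWeight_eq, oscWeight, nnnorm_mul, nnnorm_pow]
    simp only [oscRadius, hD]
    split_ifs with hp
    · rw [nnnorm_inv, mul_div_mul_comm]
      calc ‖q‖₊ ^ p.2.natAbs * (a p.1)⁻¹ * (c / c' * (r ^ p.2.natAbs / r' ^ p.2.natAbs))
          = c / c' * (a p.1)⁻¹ * y ^ p.2.natAbs := by
            rw [hy, div_pow, mul_pow]
            ring
        _ ≤ _ := by gcongr
    · rw [mul_div_mul_comm]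
      obtain ⟨n, hn⟩ : ∃ n, p.2.natAbs = n + 1 := ⟨p.2.natAbs - 1, by omega⟩
      rw [hn, Nat.add_sub_cancel]
      calc ‖q‖₊ ^ (n + 1) * a p.1 * (c / c' * (r ^ n / r' ^ n))
          = c / c' * (‖q‖₊ * a p.1) * y ^ n := by
            rw [hy, div_pow, mul_pow]
            ring
        _ ≤ _ := by gcongr
  have hD1 : ∀ p, D p < 1 := by
    intro p
    simp only [hD]
    split_ifs
    · exact (mul_le_of_le_one_right' (pow_le_one₀ bot_le hy1.le)).trans_lt (hκ p.1).1
    · exact (mul_le_of_le_one_right' (pow_le_one₀ bot_le hy1.le)).trans_lt (hκ p.1).2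
  have hDs : Summable D := by
    rw [← NNReal.summable_coe, summable_prod_of_nonneg fun _ => NNReal.coe_nonneg _]
    refine ⟨fun α => NNReal.summable_coe.2 (summable_nnreal_of_nat_of_neg ?_ ?_),
      summable_of_hasFiniteSupport (Set.toFinite _)⟩
    · refine ((NNReal.summable_geometric hy1).mul_left (κ * (a α)⁻¹)).congr fun n => ?_
      simp [hD]
    · refine ((NNReal.summable_geometric hy1).mul_left (κ * (‖q‖₊ * a α))).congr fun n => ?_
      simp only [hD]
      rw [if_neg (by omega), show (-((n : ℤ) + 1)).natAbs - 1 = n by omega]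
  exact summable_expProd_nnreal (fun p => (hle p).trans_lt (hD1 p)) (NNReal.summable_of_le hle hDs)

/-- A diagonal entry times ρ'^s is at most the ρ'-norm of the image of x^s, hence at most C ρ^s. So
the trace is dominated by ∑ |w|^s (ρ/ρ')^s. -/
theorem TraceDominated.tsum_enorm_ne_top {ι : Type*} {w : ι → ℂ} {ρ ρ' : ι → ℝ≥0}
    (h : TraceDominated w ρ ρ') {C : ℝ≥0} {κ : Type*} {a : κ → ℝ≥0}
    {M : κ → MvPolynomial ι ℂ → MvPolynomial ι ℂ}
    (hM : ∀ v, ∑' k, (a k : ℝ≥0∞) * wnorm ρ' (M k v) ≤ C * wnorm ρ v) :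
    ∑' x : (ι →₀ ℕ) × κ, ‖(M x.2 (MvPolynomial.monomial x.1 1)).coeff x.1‖ₑ * a x.2
      * ‖expProd w x.1‖ₑ ≠ ∞ := by
  obtain ⟨h0, h1⟩ := h
  rw [ENNReal.tsum_prod']
  refine ne_top_of_le_ne_top (ENNReal.mul_ne_top (ENNReal.coe_ne_top (r := C))
    (ENNReal.tsum_coe_ne_top_iff_summable.2 h1)) ?_
  rw [← ENNReal.tsum_mul_left]
  refine ENNReal.tsum_le_tsum fun s => ?_
  have hρ : expProd ρ' s ≠ 0 := Finset.prod_ne_zero_iff.2 fun i _ => pow_ne_zero _ (h0 i)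
  have hw : ‖expProd w s‖ₑ = ((expProd (fun i => ‖w i‖₊) s : ℝ≥0) : ℝ≥0∞) := by
    exact congrArg ((↑) : ℝ≥0 → ℝ≥0∞) (map_expProd (nnnormHom (α := ℂ)) w s)
  have hsplit : expProd (fun i => ‖w i‖₊ * (ρ i / ρ' i)) s * expProd ρ' s
      = expProd ρ s * expProd (fun i => ‖w i‖₊) s := by
    simp only [← expProd_mul]
    refine congrArg (fun f => expProd f s) (funext fun i => ?_)
    field_simp [h0 i]
  have hρ' : ((expProd ρ' s : ℝ≥0) : ℝ≥0∞) ≠ 0 := ENNReal.coe_ne_zero.2 hρ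
  -- Multiplying by the finite nonzero ρ'^s avoids division of extended reals.
  rw [← ENNReal.mul_le_mul_iff_left hρ' ENNReal.coe_ne_top, ← ENNReal.tsum_mul_right]
  calc _ ≤ ∑' k, (a k : ℝ≥0∞) * wnorm ρ' (M k (MvPolynomial.monomial s 1)) * ‖expProd w s‖ₑ := by
        refine ENNReal.tsum_le_tsum fun k => ?_
        rw [mul_right_comm, mul_comm _ (a k : ℝ≥0∞), mul_assoc (a k : ℝ≥0∞)]
        gcongr
        exact enorm_coeff_le_wnorm _ _ _
    _ ≤ C * wnorm ρ (MvPolynomial.monomial s 1) * ‖expProd w s‖ₑ := by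
        rw [ENNReal.tsum_mul_right]
        gcongr
        exact hM _
    _ = _ := by
        rw [wnorm_monomial, hw, mul_assoc (C : ℝ≥0∞), mul_assoc (C : ℝ≥0∞), ← ENNReal.coe_mul,
          hsplit]
        simp

theorem InConvergenceRegion.nnnorm_mul_lt {q : ℂ} (hq : ‖q‖ < 1) {wt : R → ℂ} {N : ℕ}
    {p : Fin N → ℂ} (hp : InConvergenceRegion q wt p) (i j : Fin N) : ‖q‖₊ * ‖p i‖₊ < ‖p j‖₊ := by
  obtain ⟨-, hp0, hpp⟩ := hp
  rw [← nnnorm_mul]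
  rcases lt_trichotomy i j with h | rfl | h
  · exact (hpp i j h).2
  · rw [nnnorm_mul]
    exact mul_lt_of_lt_one_left (nnnorm_pos.2 (hp0 i)) hq
  · refine lt_trans ?_ (show ‖p i‖₊ < ‖p j‖₊ from (hpp j i h).1)
    rw [nnnorm_mul]
    exact mul_lt_of_lt_one_left (nnnorm_pos.2 (hp0 i)) hq

theorem summable_trace_composeFin [Finite R] {q : ℂ} (hq0 : q ≠ 0) (hq : ‖q‖ < 1) {wt : R → ℂ} {N : ℕ}
    {O : Fin N → ℤ → GhostFock R → GhostFock R} {p : Fin N → ℂ} (hp : InConvergenceRegion q wt p)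
    (hO : ∀ i, RadialBound (O i) ‖p i‖₊) :
    Summable fun x : (R × ℤ →₀ ℕ) × (Fin N → ℤ) =>
      (composeFin (fun i => O i (x.2 i)) (MvPolynomial.monomial x.1 1)).coeff x.1
        * (∏ i, p i ^ (-x.2 i)) * expProd (modeWeight q wt) x.1 := by
  have hqp := hp.nnnorm_mul_lt hq
  obtain ⟨hwt, hp0, hpp⟩ := hp
  have hanti : StrictAnti fun i => ‖p i‖₊ := fun i j h => (hpp i j h).1
  obtain ⟨r, r', hrr, hqr, h1, h2⟩ := exists_trace_radii (nnnorm_ne_zero_iff.2 hq0) hq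
    (fun i => nnnorm_ne_zero_iff.2 (hp0 i)) hqp
  obtain ⟨κ, hκ, hdom⟩ := traceDominated_oscRadius hwt (bot_le.trans_lt hqr).ne' hqr
  obtain ⟨C, hC⟩ := tsum_composeFin_le hO hanti hκ hrr h1 h2
  have := (hdom κ 1 one_ne_zero (by rw [mul_one])).tsum_enorm_ne_top hC
  refine Summable.of_enorm (ne_of_eq_of_ne (tsum_congr fun x => ?_) this)
  rw [enorm_mul, enorm_mul]
  congr 2
  simp [enorm, nnnorm_prod, nnnorm_zpow]

end Traces

end

end GenusOneWard

namespace GenusOneWard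

open Complex Filter Topology

open scoped ENNReal NNReal

noncomputable section

section RingIdentities

theorem mul_prod_ofFn_sub {A : Type*} [Ring A] {n : ℕ} (D : A) (f : Fin n → A) :
    D * (List.ofFn f).prod - (List.ofFn f).prod * D
      = ∑ a, (List.ofFn (Function.update f a (D * f a - f a * D))).prod := by
  induction n with
  | zero => simp
  | succ n ih =>
    rw [Fin.sum_univ_succ]
    have h1 : ∀ a : Fin n, (List.ofFn (Function.update f a.succ (D * f a.succ - f a.succ * D))).prod
        = f 0 * (List.ofFn (Function.update (fun i => f i.succ) a
          (D * f a.succ - f a.succ * D))).prod := by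
      intro a
      rw [List.ofFn_succ, List.prod_cons, Function.update_of_ne (Fin.succ_ne_zero a).symm]
      congr 3
      funext i
      simp only [Function.update_apply, Fin.succ_inj]
    simp only [h1]
    rw [← Finset.mul_sum, ← ih]
    have h2 : (fun i : Fin n => Function.update f 0 (D * f 0 - f 0 * D) i.succ)
        = fun i => f i.succ := by
      funext i
      exact Function.update_of_ne (Fin.succ_ne_zero i) _ _
    rw [List.ofFn_succ, List.ofFn_succ, List.prod_cons, List.prod_cons, Function.update_self, h2]
    noncomm_ring

theorem composeFin_coe {V : Type*} [AddCommGroup V] [Module ℂ V] {n : ℕ}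
    (f : Fin n → Module.End ℂ V) : composeFin (fun i => (f i : V → V)) = (List.ofFn f).prod := by
  induction n with
  | zero =>
    rw [composeFin_zero, List.ofFn_zero, List.prod_nil]
    rfl
  | succ n ih =>
    rw [composeFin_succ, List.ofFn_succ, List.prod_cons, ih]
    rfl

end RingIdentities

/-! ### Traces of operators on the polynomial ring -/

section WTrace

variable {ι : Type*}

/-- The terms of the weighted trace `∑ₛ ⟨s| M |s⟩ w^s`. -/
def wtraceTerm (w : ι → ℂ) (M : Module.End ℂ (MvPolynomial ι ℂ)) (s : ι →₀ ℕ) : ℂ :=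
  (M (MvPolynomial.monomial s 1)).coeff s * expProd w s

/-- The weighted trace `∑ₛ ⟨s| M |s⟩ w^s`. -/
def wtrace (w : ι → ℂ) (M : Module.End ℂ (MvPolynomial ι ℂ)) : ℂ := ∑' s, wtraceTerm w M s

theorem wtraceTerm_sub (w : ι → ℂ) (M M' : Module.End ℂ (MvPolynomial ι ℂ)) :
    wtraceTerm w (M - M') = wtraceTerm w M - wtraceTerm w M' := by
  funext s
  simp [wtraceTerm, sub_mul]

theorem wtraceTerm_sum {κ : Type*} (w : ι → ℂ) (I : Finset κ)
    (M : κ → Module.End ℂ (MvPolynomial ι ℂ)) (s : ι →₀ ℕ) :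
    wtraceTerm w (∑ i ∈ I, M i) s = ∑ i ∈ I, wtraceTerm w (M i) s := by
  simp [wtraceTerm, Finset.sum_mul, MvPolynomial.coeff_sum]

theorem map_eq_sum_coeff (T : Module.End ℂ (MvPolynomial ι ℂ)) (v : MvPolynomial ι ℂ) :
    T v = ∑ s ∈ v.support, v.coeff s • T (MvPolynomial.monomial s 1) := by
  conv_lhs => rw [v.as_sum, map_sum]
  refine Finset.sum_congr rfl fun s _ => ?_
  rw [← map_smul, MvPolynomial.smul_monomial, smul_eq_mul, mul_one]

theorem hasSum_coeff_map (T : Module.End ℂ (MvPolynomial ι ℂ)) (v : MvPolynomial ι ℂ)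
    (u : ι →₀ ℕ) :
    HasSum (fun s => v.coeff s * (T (MvPolynomial.monomial s 1)).coeff u) ((T v).coeff u) := by
  have : (T v).coeff u
      = ∑ s ∈ v.support, v.coeff s * (T (MvPolynomial.monomial s 1)).coeff u := by
    rw [map_eq_sum_coeff T v, MvPolynomial.coeff_sum]
    simp
  rw [this]
  refine hasSum_sum_of_ne_finset_zero fun s hs => ?_
  rw [MvPolynomial.notMem_support_iff.1 hs, zero_mul]

theorem coeff_gradingOp (w : ι → ℂ) (v : MvPolynomial ι ℂ) (s : ι →₀ ℕ) :
    (gradingOp w v).coeff s = v.coeff s * expProd w s := by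
  classical
  rw [map_eq_sum_coeff (gradingOp w) v, MvPolynomial.coeff_sum]
  simp only [gradingOp_monomial, MvPolynomial.coeff_smul, MvPolynomial.coeff_monomial, smul_eq_mul]
  rw [Finset.sum_eq_single s]
  · simp
  · intro t _ ht
    simp [ht]
  · intro hs
    simp [MvPolynomial.notMem_support_iff.1 hs]

/-- Cyclicity of the trace. -/
theorem wtrace_cyclic {w : ι → ℂ} {ρ ρ' ρ'' : ι → ℝ≥0} (h : TraceDominated w ρ ρ'')
    {M J : Module.End ℂ (MvPolynomial ι ℂ)} {C C' : ℝ≥0}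
    (hM : ∀ v, wnorm ρ' (M v) ≤ C * wnorm ρ v) (hJ : ∀ v, wnorm ρ'' (J v) ≤ C' * wnorm ρ' v)
    {χ : ℂ} (hχ : χ ≠ 0) (hQ : ∀ v, gradingOp w (J v) = χ • J (gradingOp w v)) :
    Summable (wtraceTerm w (J * M)) ∧ Summable (wtraceTerm w (M * J)) ∧
      wtrace w (J * M) = χ * wtrace w (M * J) := by
  -- The double series of products of matrix elements. Its row sums are the terms of Tr(JM), and its
  -- column sums are χ times the terms of Tr(MJ).
  obtain ⟨f, hf⟩ : ∃ f : (ι →₀ ℕ) × (ι →₀ ℕ) → ℂ, f = fun x =>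
    (M (MvPolynomial.monomial x.1 1)).coeff x.2 *
      (J (MvPolynomial.monomial x.2 1)).coeff x.1 * expProd w x.1 := ⟨_, rfl⟩
  have hsum : Summable f := by
    -- Absolute convergence: inserting a complete set of basis vectors between J and M still
    -- respects the norm bounds, since the intermediate norm is an ℓ¹ norm.
    refine Summable.of_enorm ?_
    have hJM : ∀ v, ∑' u : ι →₀ ℕ, ((1 : ℝ≥0) : ℝ≥0∞) * wnorm ρ''
        ((M v).coeff u • J (MvPolynomial.monomial u 1)) ≤ (C' * C : ℝ≥0) * wnorm ρ v := by
      intro v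
      calc _ ≤ ∑' u : ι →₀ ℕ, C' * (‖(M v).coeff u‖ₑ * (expProd ρ' u : ℝ≥0)) := by
            refine ENNReal.tsum_le_tsum fun u => ?_
            rw [wnorm_smul, ENNReal.coe_one, one_mul, mul_left_comm]
            gcongr
            refine (hJ _).trans_eq ?_
            rw [wnorm_monomial]
            simp
        _ = C' * wnorm ρ' (M v) := by rw [ENNReal.tsum_mul_left, wnorm]
        _ ≤ C' * (C * wnorm ρ v) := by
            gcongr
            exact hM v
        _ = _ := by rw [ENNReal.coe_mul, mul_assoc]
    refine ne_of_eq_of_ne (tsum_congr fun x => ?_) (h.tsum_enorm_ne_top hJM)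
    simp only [hf, enorm_mul, MvPolynomial.coeff_smul, smul_eq_mul, ENNReal.coe_one, mul_one]
  have h1 : ∀ s, HasSum (fun u => f (s, u)) (wtraceTerm w (J * M) s) := by
    intro s
    simp only [hf, wtraceTerm, Module.End.mul_apply]
    exact (hasSum_coeff_map J (M (MvPolynomial.monomial s 1)) s).mul_right (expProd w s)
  have h2 : ∀ u, HasSum (fun s => f (s, u)) (χ * wtraceTerm w (M * J) u) := by
    intro u
    have h3 : (M (gradingOp w (J (MvPolynomial.monomial u 1)))).coeff u
        = χ * wtraceTerm w (M * J) u := by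
      rw [hQ (MvPolynomial.monomial u 1), gradingOp_monomial, LinearMap.map_smul,
        LinearMap.map_smul, LinearMap.map_smul, MvPolynomial.coeff_smul, MvPolynomial.coeff_smul,
        wtraceTerm, Module.End.mul_apply, smul_eq_mul, smul_eq_mul, mul_comm (expProd w u)]
    rw [← h3, hf]
    have h4 := hasSum_coeff_map M (gradingOp w (J (MvPolynomial.monomial u 1))) u
    have h5 : ∀ s, (gradingOp w (J (MvPolynomial.monomial u 1))).coeff s *
        (M (MvPolynomial.monomial s 1)).coeff u = (M (MvPolynomial.monomial s 1)).coeff u *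
          (J (MvPolynomial.monomial u 1)).coeff s * expProd w s := by
      intro s
      rw [coeff_gradingOp, mul_comm, mul_assoc]
    simp only [h5] at h4
    exact h4
  have e1 := hsum.hasSum.prod_fiberwise h1
  have e2 : HasSum (fun u => χ * wtraceTerm w (M * J) u) (∑' x, f x) :=
    HasSum.prod_fiberwise (f := fun x : (ι →₀ ℕ) × (ι →₀ ℕ) => f x.swap)
      ((Equiv.prodComm _ _).hasSum_iff.2 hsum.hasSum) h2
  refine ⟨e1.summable, (summable_mul_left_iff hχ).1 e2.summable, ?_⟩
  rw [wtrace, wtrace, e1.tsum_eq, ← tsum_mul_left, e2.tsum_eq]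

end WTrace

end

end GenusOneWard

namespace GenusOneWard

open Complex Filter Topology

open scoped ENNReal NNReal

noncomputable section

/-! ### Traces of products of modes and the Ward identity for modes -/

section FieldTraces

variable {ι : Type*}

/-- The product of one mode of each of the fields. -/
def fieldProd {V : Type*} [AddCommGroup V] [Module ℂ V] {N : ℕ} (O : Fin N → ℤ → Module.End ℂ V)
    (κ : Fin N → ℤ) : Module.End ℂ V := (List.ofFn fun i => O i (κ i)).prod

/-- The contribution of a basis vector and of modes to the trace of a product of fields; the fields
`A` have weight `0`, the fields `B` have weight `1`. -/
def fieldTerm (w : ι → ℂ) {n m : ℕ} (A : Fin n → ℤ → Module.End ℂ (MvPolynomial ι ℂ))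
    (B : Fin m → ℤ → Module.End ℂ (MvPolynomial ι ℂ)) (z : Fin n → ℂ) (t : Fin m → ℂ)
    (x : (ι →₀ ℕ) × (Fin n → ℤ) × (Fin m → ℤ)) : ℂ :=
  wtraceTerm w (fieldProd A x.2.1 * fieldProd B x.2.2) x.1
    * ((∏ a, z a ^ (-x.2.1 a)) * ∏ j, t j ^ (-x.2.2 j - 1))

theorem summable_fiber {X Y : Type*} {f : X → Y → ℂ} {c : Y → ℂ} (hc : ∀ y, c y ≠ 0)
    (h : Summable fun x : X × Y => f x.1 x.2 * c x.2) (y : Y) : Summable fun x => f x y :=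
  (summable_mul_right_iff (hc y)).1
    (h.comp_injective (i := fun x => (x, y)) fun _ _ h => (Prod.ext_iff.1 h).1)

theorem hasSum_tsum_fiber {X Y : Type*} {f : X → Y → ℂ} {c : Y → ℂ} (hc : ∀ y, c y ≠ 0) {v : ℂ}
    (h : HasSum (fun x : X × Y => f x.1 x.2 * c x.2) v) :
    HasSum (fun y => (∑' x, f x y) * c y) v :=
  HasSum.prod_fiberwise (f := fun x : Y × X => f x.2 x.1 * c x.1)
    ((Equiv.prodComm Y X).hasSum_iff.2 h) fun y => (summable_fiber hc h.summable y).hasSum.mul_right _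

theorem modeProd_ne_zero {n m : ℕ} {z : Fin n → ℂ} {t : Fin m → ℂ} (hz : ∀ a, z a ≠ 0)
    (ht : ∀ j, t j ≠ 0) (x : (Fin n → ℤ) × (Fin m → ℤ)) :
    (∏ a, z a ^ (-x.1 a)) * ∏ j, t j ^ (-x.2 j - 1) ≠ 0 :=
  mul_ne_zero (Finset.prod_ne_zero_iff.2 fun a _ => zpow_ne_zero _ (hz a))
    (Finset.prod_ne_zero_iff.2 fun j _ => zpow_ne_zero _ (ht j))

theorem wtraceTerm_summable_of_fieldTerm {w : ι → ℂ} {n m : ℕ}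
    {A : Fin n → ℤ → Module.End ℂ (MvPolynomial ι ℂ)}
    {B : Fin m → ℤ → Module.End ℂ (MvPolynomial ι ℂ)} {z : Fin n → ℂ} {t : Fin m → ℂ}
    (hz : ∀ a, z a ≠ 0) (ht : ∀ j, t j ≠ 0) (h : Summable (fieldTerm w A B z t))
    (k : Fin n → ℤ) (r : Fin m → ℤ) : Summable (wtraceTerm w (fieldProd A k * fieldProd B r)) :=
  summable_fiber (f := fun s (x : (Fin n → ℤ) × (Fin m → ℤ)) =>
    wtraceTerm w (fieldProd A x.1 * fieldProd B x.2) s) (modeProd_ne_zero hz ht) h (k, r)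

theorem hasSum_wtrace_of_fieldTerm {w : ι → ℂ} {n m : ℕ}
    {A : Fin n → ℤ → Module.End ℂ (MvPolynomial ι ℂ)}
    {B : Fin m → ℤ → Module.End ℂ (MvPolynomial ι ℂ)} {z : Fin n → ℂ} {t : Fin m → ℂ}
    (hz : ∀ a, z a ≠ 0) (ht : ∀ j, t j ≠ 0) {y : ℂ} (h : HasSum (fieldTerm w A B z t) y) :
    HasSum (fun x : (Fin n → ℤ) × (Fin m → ℤ) => wtrace w (fieldProd A x.1 * fieldProd B x.2)
      * ((∏ a, z a ^ (-x.1 a)) * ∏ j, t j ^ (-x.2 j - 1))) y :=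
  hasSum_tsum_fiber (f := fun s (x : (Fin n → ℤ) × (Fin m → ℤ)) =>
    wtraceTerm w (fieldProd A x.1 * fieldProd B x.2) s) (modeProd_ne_zero hz ht) h

theorem fieldProd_commutator {V : Type*} [AddCommGroup V] [Module ℂ V] {N : ℕ}
    {O O' : Fin N → ℤ → Module.End ℂ V} {D : Module.End ℂ V} {r : ℤ}
    (h : ∀ i, FieldBracket D r (O i) (O' i)) (κ : Fin N → ℤ) :
    D * fieldProd O κ - fieldProd O κ * D
      = ∑ i, fieldProd (Function.update O i (O' i)) (κ + Pi.single i r) := by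
  rw [fieldProd, mul_prod_ofFn_sub]
  refine Finset.sum_congr rfl fun i _ => ?_
  rw [fieldProd]
  congr 2
  funext j
  by_cases hj : j = i
  · subst hj
    refine LinearMap.ext fun v => ?_
    simp only [Function.update_self, Pi.add_apply, Pi.single_eq_same]
    exact h j (κ j) v
  · simp [Function.update_of_ne hj, Pi.single_eq_of_ne hj]

/-- Three facts combine: Tr(JAB) = Tr(AJB) + Tr([J, A]B), Tr(AJB) = Tr(ABJ) + Tr(A[J, B]), and
cyclicity in the form Tr(ABJ) = μ Tr(JAB). -/
theorem wtrace_ward {w : ι → ℂ} {ρ ρ' ρ'' : ι → ℝ≥0} (hd : TraceDominated w ρ ρ'') {n m : ℕ}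
    {A A' : Fin n → ℤ → Module.End ℂ (MvPolynomial ι ℂ)}
    {B B' : Fin m → ℤ → Module.End ℂ (MvPolynomial ι ℂ)} {J : Module.End ℂ (MvPolynomial ι ℂ)}
    {r₀ : ℤ} (hA : ∀ a, FieldBracket J r₀ (A a) (A' a)) (hB : ∀ j, FieldBracket J r₀ (B j) (B' j))
    {k : Fin n → ℤ} {r : Fin m → ℤ} {C C' : ℝ≥0}
    (hM : ∀ v, wnorm ρ' ((fieldProd A k * fieldProd B r) v) ≤ C * wnorm ρ v)
    (hJ : ∀ v, wnorm ρ'' (J v) ≤ C' * wnorm ρ' v) {μ : ℂ} (hμ : μ ≠ 0)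
    (hQ : ∀ v, gradingOp w (J v) = μ⁻¹ • J (gradingOp w v))
    (hsA : ∀ a, Summable (wtraceTerm w
      (fieldProd (Function.update A a (A' a)) (k + Pi.single a r₀) * fieldProd B r)))
    (hsB : ∀ j, Summable (wtraceTerm w
      (fieldProd A k * fieldProd (Function.update B j (B' j)) (r + Pi.single j r₀)))) :
    (1 - μ) * wtrace w (fieldProd A k * (J * fieldProd B r))
      = (∑ a, μ * wtrace w
          (fieldProd (Function.update A a (A' a)) (k + Pi.single a r₀) * fieldProd B r))
        + ∑ j, wtrace w
          (fieldProd A k * fieldProd (Function.update B j (B' j)) (r + Pi.single j r₀)) := by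
  obtain ⟨h1, h2, h3⟩ := wtrace_cyclic hd hM hJ (inv_ne_zero hμ) hQ
  have eA : J * (fieldProd A k * fieldProd B r) - fieldProd A k * (J * fieldProd B r)
      = ∑ a, fieldProd (Function.update A a (A' a)) (k + Pi.single a r₀) * fieldProd B r := by
    rw [← Finset.sum_mul, ← fieldProd_commutator hA, sub_mul, mul_assoc, mul_assoc]
  have eB : fieldProd A k * (J * fieldProd B r) - fieldProd A k * fieldProd B r * J
      = ∑ j, fieldProd A k * fieldProd (Function.update B j (B' j)) (r + Pi.single j r₀) := by
    rw [← Finset.mul_sum, ← fieldProd_commutator hB, mul_sub, mul_assoc]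
  have tA := congrArg (wtraceTerm w) eA
  have tB := congrArg (wtraceTerm w) eB
  rw [wtraceTerm_sub] at tA tB
  have sA : HasSum (wtraceTerm w (∑ a, fieldProd (Function.update A a (A' a)) (k + Pi.single a r₀)
      * fieldProd B r)) (∑ a, wtrace w
        (fieldProd (Function.update A a (A' a)) (k + Pi.single a r₀) * fieldProd B r)) := by
    simp only [funext (wtraceTerm_sum w _ _)]
    exact hasSum_sum fun a _ => (hsA a).hasSum
  have sB : HasSum (wtraceTerm w (∑ j, fieldProd A k *
      fieldProd (Function.update B j (B' j)) (r + Pi.single j r₀))) (∑ j, wtrace w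
        (fieldProd A k * fieldProd (Function.update B j (B' j)) (r + Pi.single j r₀))) := by
    simp only [funext (wtraceTerm_sum w _ _)]
    exact hasSum_sum fun j _ => (hsB j).hasSum
  rw [← tA] at sA
  rw [← tB] at sB
  -- Convergence of the trace of AJB is not assumed; it follows from that of JAB and of the
  -- commutator terms.
  have sAJB : HasSum (wtraceTerm w (fieldProd A k * (J * fieldProd B r)))
      (wtrace w (J * (fieldProd A k * fieldProd B r)) - ∑ a, wtrace w
        (fieldProd (Function.update A a (A' a)) (k + Pi.single a r₀) * fieldProd B r)) := by
    have := h1.hasSum.sub sA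
    simp only [Pi.sub_apply, sub_sub_cancel] at this
    exact this
  have e1 := sAJB.tsum_eq
  have e2 := (sAJB.sub h2.hasSum).unique sB
  rw [← Finset.mul_sum]
  change wtrace w _ = _ at e1
  rw [← e1] at e2
  change _ - wtrace w _ = _ at e2
  rw [h3] at e1
  have e3 : wtrace w (fieldProd A k * fieldProd B r * J)
      = μ * (μ⁻¹ * wtrace w (fieldProd A k * fieldProd B r * J)) := by
    rw [mul_inv_cancel_left₀ hμ]
  linear_combination e2 - μ * e1 + e3

/-- The offset d is the conformal weight: 0 for the fields P(γ), 1 for currents. -/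
theorem prod_zpow_neg_add_single {N : ℕ} {z : Fin N → ℂ} {a : Fin N} (hz : z a ≠ 0) (k : Fin N → ℤ)
    (r : ℤ) (d : ℤ) :
    ∏ i, z i ^ (-(k + Pi.single a r : Fin N → ℤ) i - d) = z a ^ (-r) * ∏ i, z i ^ (-k i - d) := by
  rw [← Finset.mul_prod_erase _ _ (Finset.mem_univ a),
    ← Finset.mul_prod_erase _ (fun i => z i ^ (-k i - d)) (Finset.mem_univ a), ← mul_assoc]
  congr 1
  · rw [← zpow_add₀ hz, Pi.add_apply, Pi.single_eq_same]
    congr 1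
    ring
  · refine Finset.prod_congr rfl fun i hi => ?_
    rw [Pi.add_apply, Pi.single_eq_of_ne (Finset.ne_of_mem_erase hi), add_zero]

/-- The bijection which splits off the mode of the first field of weight `1`. -/
def consModesEquiv (n m : ℕ) :
    (ℤ × (Fin n → ℤ) × (Fin m → ℤ)) ≃ (Fin n → ℤ) × (Fin (m + 1) → ℤ) where
  toFun x := (x.2.1, Fin.cons x.1 x.2.2)
  invFun y := (y.2 0, y.1, Fin.tail y.2)
  left_inv x := by simp
  right_inv y := by simp

theorem hasSum_consModes {n m : ℕ} {F : (Fin n → ℤ) → (Fin (m + 1) → ℤ) → ℂ} {v : ℂ}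
    (h : HasSum (fun x : (Fin n → ℤ) × (Fin (m + 1) → ℤ) => F x.1 x.2) v) :
    HasSum (fun x : ℤ × (Fin n → ℤ) × (Fin m → ℤ) => F x.2.1 (Fin.cons x.1 x.2.2)) v :=
  (consModesEquiv n m).hasSum_iff.2 h

/-- A commutator with J[r] shifts another mode index by r. Summed over all modes the shift is a
shear, so kernel and correlator factor. -/
theorem hasSum_mul_shift {X : Type*} {c : ℤ → ℂ} {U : X → ℂ} {C y : ℂ} (hc : HasSum c C)
    (hU : HasSum U y) (e : ℤ → X ≃ X) : HasSum (fun x : ℤ × X => c x.1 * U (e x.1 x.2)) (C * y) := by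
  have h1 : HasSum (fun x : ℤ × X => c x.1 * U x.2) (C * y) :=
    HasSum.mul (f := c) (g := U) hc hU
      (summable_mul_of_summable_norm (f := c) (g := U) hc.summable.norm hU.summable.norm)
  exact (Equiv.prodShear (Equiv.refl ℤ) e).hasSum_iff.2 h1

theorem hasSum_mul_shift_fst {X Y : Type*} [AddGroup X] {c : ℤ → ℂ} {U : X → Y → ℂ} {C y : ℂ}
    (hc : HasSum c C) (hU : HasSum (fun x : X × Y => U x.1 x.2) y) (d : ℤ → X) :
    HasSum (fun x : ℤ × X × Y => c x.1 * U (x.2.1 + d x.1) x.2.2) (C * y) :=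
  hasSum_mul_shift hc hU fun r => (Equiv.addRight (d r)).prodCongr (Equiv.refl Y)

theorem hasSum_mul_shift_snd {X Y : Type*} [AddGroup Y] {c : ℤ → ℂ} {U : X → Y → ℂ} {C y : ℂ}
    (hc : HasSum c C) (hU : HasSum (fun x : X × Y => U x.1 x.2) y) (d : ℤ → Y) :
    HasSum (fun x : ℤ × X × Y => c x.1 * U x.2.1 (x.2.2 + d x.1)) (C * y) :=
  hasSum_mul_shift hc hU fun r => (Equiv.refl X).prodCongr (Equiv.addRight (d r))

end FieldTraces

end

end GenusOneWard

namespace GenusOneWard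

open Complex Filter Topology

open scoped ENNReal NNReal

noncomputable section

/-! ### Summing the mode identity over all modes -/

section WardSum

variable {R : Type*}

theorem castAdd_lt_natAdd {n m : ℕ} (a : Fin n) (j : Fin m) : Fin.castAdd m a < Fin.natAdd n j := by
  rw [Fin.lt_def, Fin.val_castAdd, Fin.val_natAdd]
  omega

theorem inConvergenceRegion_append {q : ℂ} {wt : R → ℂ} {n m : ℕ} {z : Fin n → ℂ} {t : Fin m → ℂ} :
    InConvergenceRegion q wt (Fin.append z t) ↔
      InConvergenceRegion q wt z ∧ InConvergenceRegion q wt t ∧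
        ∀ a j, ‖t j‖ < ‖z a‖ ∧ ‖q * z a‖ < ‖t j‖ := by
  constructor
  · rintro ⟨h1, h2, h3⟩
    refine ⟨⟨h1, fun a => ?_, fun a a' h => ?_⟩, ⟨h1, fun j => ?_, fun j j' h => ?_⟩,
      fun a j => ?_⟩
    · simpa using h2 (Fin.castAdd m a)
    · simpa using h3 (Fin.castAdd m a) (Fin.castAdd m a') h
    · simpa using h2 (Fin.natAdd n j)
    · simpa using h3 (Fin.natAdd n j) (Fin.natAdd n j') (by simpa using h)
    · simpa using h3 (Fin.castAdd m a) (Fin.natAdd n j) (castAdd_lt_natAdd a j)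
  · rintro ⟨⟨h1, h2, h3⟩, ⟨-, h4, h5⟩, h6⟩
    refine ⟨h1, fun i => ?_, fun i i' h => ?_⟩
    · refine Fin.addCases (fun a => ?_) (fun j => ?_) i
      · simpa using h2 a
      · simpa using h4 j
    · induction i using Fin.addCases with
      | left a =>
        induction i' using Fin.addCases with
        | left a' => simpa using h3 a a' h
        | right j => simpa using h6 a j
      | right j =>
        induction i' using Fin.addCases with
        | left a' => exact absurd h (castAdd_lt_natAdd a' j).le.not_gt
        | right j' => simpa using h5 j j' (by simpa using h)

theorem inConvergenceRegion_cons {q : ℂ} {wt : R → ℂ} {m : ℕ} {t₀ : ℂ} {t : Fin m → ℂ} :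
    InConvergenceRegion q wt (Fin.cons t₀ t : Fin (m + 1) → ℂ) ↔
      InConvergenceRegion q wt t ∧ t₀ ≠ 0 ∧ ∀ j, ‖t j‖ < ‖t₀‖ ∧ ‖q * t₀‖ < ‖t j‖ := by
  constructor
  · rintro ⟨h1, h2, h3⟩
    refine ⟨⟨h1, fun j => ?_, fun j j' h => ?_⟩, ?_, fun j => ?_⟩
    · simpa using h2 j.succ
    · simpa using h3 j.succ j'.succ (by simpa using h)
    · simpa using h2 0
    · simpa using h3 0 j.succ (Fin.succ_pos j)
  · rintro ⟨⟨h1, h2, h3⟩, h4, h5⟩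
    refine ⟨h1, fun i => ?_, fun i i' h => ?_⟩
    · refine Fin.cases ?_ (fun j => ?_) i
      · simpa using h4
      · simpa using h2 j
    · induction i' using Fin.cases with
      | zero => exact absurd h (Fin.not_lt_zero i)
      | succ j' =>
        induction i using Fin.cases with
        | zero => simpa using h5 j'
        | succ j => simpa using h3 j j' (by simpa using h)

theorem append_modes {V : Type*} {n m : ℕ} (A : Fin n → ℤ → V) (B : Fin m → ℤ → V) (k : Fin n → ℤ)
    (r : Fin m → ℤ) : (fun i => Fin.append A B i (Fin.append k r i))
      = Fin.append (fun a => A a (k a)) fun j => B j (r j) := by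
  funext i
  refine Fin.addCases (fun a => ?_) (fun j => ?_) i <;> simp

theorem composeFin_append_coe {V : Type*} [AddCommGroup V] [Module ℂ V] {n m : ℕ}
    (A : Fin n → ℤ → Module.End ℂ V) (B : Fin m → ℤ → Module.End ℂ V) (k : Fin n → ℤ)
    (r : Fin m → ℤ) : composeFin (fun i => (Fin.append A B i (Fin.append k r i) : V → V))
      = fieldProd A k * fieldProd B r := by
  rw [composeFin_coe fun i => Fin.append A B i (Fin.append k r i), append_modes, List.ofFn_fin_append,
    List.prod_append]
  rfl

/-- The fields `A` have radial bounds at all points. -/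
def RadiallyBounded {N : ℕ} (A : Fin N → ℤ → Module.End ℂ (GhostFock R)) : Prop :=
  ∀ i x, RadialBound (fun k v => A i k v) x

theorem RadiallyBounded.append {n m : ℕ} {A : Fin n → ℤ → Module.End ℂ (GhostFock R)}
    {B : Fin m → ℤ → Module.End ℂ (GhostFock R)} (hA : RadiallyBounded A)
    (hB : RadiallyBounded B) : RadiallyBounded (Fin.append A B) := by
  intro i x
  refine Fin.addCases (fun a => ?_) (fun j => ?_) i
  · simpa using hA a x
  · simpa using hB j x

theorem summable_fieldTerm [Finite R] {q : ℂ} (hq0 : q ≠ 0) (hq : ‖q‖ < 1) {wt : R → ℂ} {n m : ℕ}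
    {A : Fin n → ℤ → Module.End ℂ (GhostFock R)} {B : Fin m → ℤ → Module.End ℂ (GhostFock R)}
    (hA : RadiallyBounded A) (hB : RadiallyBounded B) {z : Fin n → ℂ} {t : Fin m → ℂ}
    (hp : InConvergenceRegion q wt (Fin.append z t)) :
    Summable (fieldTerm (modeWeight q wt) A B z t) := by
  have ht : ∀ j, t j ≠ 0 := (inConvergenceRegion_append.1 hp).2.1.2.1
  have h1 := summable_trace_composeFin hq0 hq hp (O := fun i k v => Fin.append A B i k v)
    fun i => hA.append hB i _
  have h2 := (((Equiv.refl (R × ℤ →₀ ℕ)).prodCongr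
    (Fin.appendEquiv (α := ℤ) n m)).summable_iff.2 h1).mul_right (∏ j, (t j)⁻¹)
  refine h2.congr fun x => ?_
  obtain ⟨s, k, r⟩ := x
  have h3 : ∏ i, Fin.append z t i ^ (-Fin.append k r i)
      = (∏ a, z a ^ (-k a)) * ∏ j, t j ^ (-r j) := by
    rw [Fin.prod_univ_add]
    simp
  have h4 : ∏ j, t j ^ (-r j - 1) = (∏ j, t j ^ (-r j)) * ∏ j, (t j)⁻¹ := by
    rw [← Finset.prod_mul_distrib]
    exact Finset.prod_congr rfl fun j _ => zpow_sub_one₀ (ht j) _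
  simp only [Function.comp_apply, Equiv.prodCongr_apply, Prod.map_apply, Equiv.refl_apply,
    Fin.appendEquiv, Equiv.coe_fn_mk, fieldTerm, wtraceTerm, composeFin_append_coe, h3, h4]
  ring

theorem exists_dominated_bounds [Finite R] {q : ℂ} (hq0 : q ≠ 0) (hq : ‖q‖ < 1) {wt : R → ℂ} {n m : ℕ}
    {A : Fin n → ℤ → Module.End ℂ (GhostFock R)} {B : Fin m → ℤ → Module.End ℂ (GhostFock R)}
    (hA : RadiallyBounded A) (hB : RadiallyBounded B) {z : Fin n → ℂ} {t : Fin m → ℂ}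
    (hp : InConvergenceRegion q wt (Fin.append z t)) :
    ∃ ρ ρ' ρ'' : R × ℤ → ℝ≥0, TraceDominated (modeWeight q wt) ρ ρ'' ∧
      (∀ k r, ∃ C : ℝ≥0, ∀ v, wnorm ρ' ((fieldProd A k * fieldProd B r) v) ≤ C * wnorm ρ v) ∧
      ∀ J : ℤ → Module.End ℂ (GhostFock R), (∀ x, RadialBound (fun k v => J k v) x) →
        ∀ r, ∃ C : ℝ≥0, ∀ v, wnorm ρ'' (J r v) ≤ C * wnorm ρ' v := by
  obtain ⟨r, r', hrr, hqr, h1, h2⟩ := exists_trace_radii (nnnorm_ne_zero_iff.2 hq0) hq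
    (fun i => nnnorm_ne_zero_iff.2 (hp.2.1 i)) (hp.nnnorm_mul_lt hq)
  -- A third radius makes room for one more application of J after the product; likewise the scale
  -- drops in two steps κ > c > 1.
  obtain ⟨r'', hr1, hr2⟩ := exists_between hqr
  have hr0 : 0 < r'' := bot_le.trans_lt hr1
  obtain ⟨κ, hκ, hdom⟩ := traceDominated_oscRadius hp.1 hr0.ne' hr1
  obtain ⟨c, hc, hcκ⟩ := exists_between hκ
  refine ⟨_, oscRadius R c r' r', _, hdom κ 1 one_ne_zero (by rw [mul_one]), fun k l => ?_,
    fun J hJ k => ?_⟩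
  · obtain ⟨C, hC⟩ := tsum_composeFin_le (O := fun i k v => Fin.append A B i k v)
      (fun i => hA.append hB i ‖Fin.append z t i‖₊)
      (fun i j h => (hp.2.2 i j h).1) hcκ hrr h1 h2
    set a : ℝ≥0 := ∏ i, ‖Fin.append z t i‖₊ ^ (-Fin.append k l i) with ha
    have ha0 : a ≠ 0 := Finset.prod_ne_zero_iff.2 fun i _ =>
      zpow_ne_zero _ (nnnorm_ne_zero_iff.2 (hp.2.1 i))
    refine ⟨a⁻¹ * C, fun v => ?_⟩
    have h3 := (ENNReal.le_tsum (Fin.append k l)).trans (hC v)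
    rw [composeFin_append_coe, ← ha] at h3
    rw [ENNReal.coe_mul, mul_assoc, ENNReal.coe_inv ha0, ← ENNReal.mul_le_iff_le_inv
      (ENNReal.coe_ne_zero.2 ha0) ENNReal.coe_ne_top]
    exact h3
  -- A single mode of J has no insertion point of its own, so any radius x between 1/r' and 1/r''
  -- may be used in its bound.
  · obtain ⟨x, hx1, hx2⟩ := exists_between (inv_strictAnti₀ hr0 hr2)
    have hx0 : x ≠ 0 := (bot_le.trans_lt hx1).ne'
    obtain ⟨C, hC⟩ := hJ x c r' 1 r'' hc ((lt_inv_mul_iff₀ hr0).1 (by rwa [mul_one]))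
      ((inv_lt_iff_one_lt_mul₀' (hr0.trans hr2)).1 hx1)
    have ha0 : x ^ (-k) ≠ 0 := zpow_ne_zero _ hx0
    refine ⟨(x ^ (-k))⁻¹ * C, fun v => ?_⟩
    rw [ENNReal.coe_mul, mul_assoc, ENNReal.coe_inv ha0, ← ENNReal.mul_le_iff_le_inv
      (ENNReal.coe_ne_zero.2 ha0) ENNReal.coe_ne_top]
    exact (ENNReal.le_tsum k).trans (hC v)

theorem fieldProd_cons {V : Type*} [AddCommGroup V] [Module ℂ V] {m : ℕ}
    (J : ℤ → Module.End ℂ V) (B : Fin m → ℤ → Module.End ℂ V) (r₀ : ℤ) (r : Fin m → ℤ) :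
    fieldProd (Fin.cons J B) (Fin.cons r₀ r : Fin (m + 1) → ℤ) = J r₀ * fieldProd B r := by
  rw [fieldProd, List.ofFn_succ, List.prod_cons]
  simp only [Fin.cons_zero, Fin.cons_succ]
  rfl

/-- After division by 1 - u q^r the dependence on the mode r of the current is a Lerch series. The
points z_a lie outside the circle of t₀ and the t_j inside, so the two expansions of the kernel
occur with exactly the required numerators. -/
theorem hasSum_ward_modes {τ : ℂ} (hτ : 0 < τ.im) {n m : ℕ} {u : ℂ} (hu0 : u ≠ 0)
    (hu : ∀ k : ℤ, u ≠ nome τ ^ k) {T : ℤ → (Fin n → ℤ) → (Fin m → ℤ) → ℂ}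
    {TA : Fin n → (Fin n → ℤ) → (Fin m → ℤ) → ℂ} {TB : Fin m → (Fin n → ℤ) → (Fin m → ℤ) → ℂ}
    (h : ∀ r₀ k r, (1 - u * nome τ ^ r₀) * T r₀ k r
      = (∑ a, u * nome τ ^ r₀ * TA a (k + Pi.single a r₀) r) + ∑ j, TB j k (r + Pi.single j r₀))
    {z : Fin n → ℂ} {t₀ : ℂ} {t : Fin m → ℂ} (ht₀ : t₀ ≠ 0) (hz : ∀ a, z a ≠ 0) (ht : ∀ j, t j ≠ 0)
    (hzt : ∀ a, ‖t₀‖ < ‖z a‖ ∧ ‖nome τ * z a‖ < ‖t₀‖)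
    (htt : ∀ j, ‖t j‖ < ‖t₀‖ ∧ ‖nome τ * t₀‖ < ‖t j‖) {y : Fin n → ℂ} {y' : Fin m → ℂ}
    (hy : ∀ a, HasSum (fun x : (Fin n → ℤ) × (Fin m → ℤ) =>
      TA a x.1 x.2 * ((∏ i, z i ^ (-x.1 i)) * ∏ j, t j ^ (-x.2 j - 1))) (y a))
    (hy' : ∀ j, HasSum (fun x : (Fin n → ℤ) × (Fin m → ℤ) =>
      TB j x.1 x.2 * ((∏ i, z i ^ (-x.1 i)) * ∏ j, t j ^ (-x.2 j - 1))) (y' j)) :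
    HasSum (fun x : ℤ × (Fin n → ℤ) × (Fin m → ℤ) => T x.1 x.2.1 x.2.2 *
      ((∏ i, z i ^ (-x.2.1 i)) * (t₀ ^ (-x.1 - 1) * ∏ j, t j ^ (-x.2.2 j - 1))))
      ((∑ a, negKernel τ u t₀ (z a) * y a) + ∑ j, negKernel τ u t₀ (t j) * y' j) := by
  have hμ1 : ∀ r : ℤ, 1 - u * nome τ ^ r ≠ 0 := by
    intro r h
    refine hu (-r) ?_
    rw [zpow_neg]
    exact eq_inv_of_mul_eq_one_left (sub_eq_zero.1 h).symm
  have sA : ∀ a, HasSum (fun x : ℤ × (Fin n → ℤ) × (Fin m → ℤ) =>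
      z a ^ x.1 * t₀ ^ (-x.1 - 1) * (u * nome τ ^ x.1 * (1 - u * nome τ ^ x.1)⁻¹) *
      (TA a (x.2.1 + Pi.single a x.1) x.2.2 *
        ((∏ i, z i ^ (-(x.2.1 + Pi.single a x.1 : Fin n → ℤ) i)) * ∏ j, t j ^ (-x.2.2 j - 1))))
      (negKernel τ u t₀ (z a) * y a) := fun a =>
    hasSum_mul_shift_fst
      (c := fun r => z a ^ r * t₀ ^ (-r - 1) * (u * nome τ ^ r * (1 - u * nome τ ^ r)⁻¹))
      (U := fun k r => TA a k r * ((∏ i, z i ^ (-k i)) * ∏ j, t j ^ (-r j - 1)))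
      (hasSum_negKernel_of_gt hτ hu0 hu ht₀ (hzt a).2 (hzt a).1) (hy a)
      fun r => Pi.single a r
  have sB : ∀ j, HasSum (fun x : ℤ × (Fin n → ℤ) × (Fin m → ℤ) =>
      t j ^ x.1 * t₀ ^ (-x.1 - 1) * (1 - u * nome τ ^ x.1)⁻¹ *
      (TB j x.2.1 (x.2.2 + Pi.single j x.1) * ((∏ i, z i ^ (-x.2.1 i)) *
          ∏ i, t i ^ (-(x.2.2 + Pi.single j x.1 : Fin m → ℤ) i - 1))))
      (negKernel τ u t₀ (t j) * y' j) := fun j =>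
    hasSum_mul_shift_snd
      (c := fun r => t j ^ r * t₀ ^ (-r - 1) * (1 - u * nome τ ^ r)⁻¹)
      (U := fun k r => TB j k r * ((∏ i, z i ^ (-k i)) * ∏ j, t j ^ (-r j - 1)))
      (hasSum_negKernel_of_lt hτ hu0 hu ht₀ (htt j).2 (htt j).1) (hy' j)
      fun r => Pi.single j r
  have hsum := (hasSum_sum fun a (_ : a ∈ Finset.univ) => sA a).add
    (hasSum_sum fun j (_ : j ∈ Finset.univ) => sB j)
  refine (congrArg (fun f => HasSum f _) (funext fun x => ?_)).mp hsum
  obtain ⟨r₀, k, r⟩ := x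
  have h1 : T r₀ k r = (1 - u * nome τ ^ r₀)⁻¹ *
      ((∑ a, u * nome τ ^ r₀ * TA a (k + Pi.single a r₀) r)
        + ∑ j, TB j k (r + Pi.single j r₀)) := by
    rw [← h, inv_mul_cancel_left₀ (hμ1 r₀)]
  simp only [h1, mul_add, add_mul, Finset.mul_sum, Finset.sum_mul]
  congr 1
  · refine Finset.sum_congr rfl fun a _ => ?_
    have h2 := prod_zpow_neg_add_single (hz a) k r₀ 0
    simp only [sub_zero] at h2
    rw [h2, zpow_neg]
    have h3 : z a ^ r₀ ≠ 0 := zpow_ne_zero _ (hz a)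
    field_simp
  · refine Finset.sum_congr rfl fun j _ => ?_
    rw [prod_zpow_neg_add_single (ht j) r r₀ 1, zpow_neg]
    have h3 : t j ^ r₀ ≠ 0 := zpow_ne_zero _ (ht j)
    field_simp

-- Absolute convergence of the full series is known beforehand from the radial bounds. Its value may
-- therefore be computed by summing over basis vectors first, where the trace identity applies mode
-- by mode, and over modes afterwards.
attribute [local irreducible] wtrace wtraceTerm fieldProd in
theorem hasSum_fieldTerm_cons [Finite R] {τ : ℂ} (hτ : 0 < τ.im) {wt : R → ℂ} {n m : ℕ}
    {A A' : Fin n → ℤ → Module.End ℂ (GhostFock R)} {B B' : Fin m → ℤ → Module.End ℂ (GhostFock R)}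
    {J : ℤ → Module.End ℂ (GhostFock R)} (hrA : RadiallyBounded A) (hrB : RadiallyBounded B)
    (hrJ : ∀ x, RadialBound (fun k v => J k v) x) (hA : ∀ r a, FieldBracket (J r) r (A a) (A' a))
    (hB : ∀ r j, FieldBracket (J r) r (B j) (B' j)) {c : ℂ} (hc : ∀ k : ℤ, cexp (-c) ≠ nome τ ^ k)
    (hQ : Homogeneous (nome τ) (gradingOp (modeWeight (nome τ) wt)) (cexp c) J)
    {z : Fin n → ℂ} {t₀ : ℂ} {t : Fin m → ℂ}
    (hp : InConvergenceRegion (nome τ) wt (Fin.append z (Fin.cons t₀ t : Fin (m + 1) → ℂ)))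
    {y : Fin n → ℂ} {y' : Fin m → ℂ}
    (hy : ∀ a, HasSum (fieldTerm (modeWeight (nome τ) wt) (Function.update A a (A' a)) B z t) (y a))
    (hy' : ∀ j, HasSum (fieldTerm (modeWeight (nome τ) wt) A (Function.update B j (B' j)) z t)
      (y' j)) :
    HasSum (fieldTerm (modeWeight (nome τ) wt) A (Fin.cons J B) z (Fin.cons t₀ t))
      ((∑ a, negKernel τ (cexp (-c)) t₀ (z a) * y a)
        + ∑ j, negKernel τ (cexp (-c)) t₀ (t j) * y' j) := by
  set w := modeWeight (nome τ) wt with hw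
  have hq0 := nome_ne_zero τ
  have hq := norm_nome_lt_one hτ
  obtain ⟨hz, ht, hzt⟩ := inConvergenceRegion_append.1 hp
  obtain ⟨ht, ht₀, htt⟩ := inConvergenceRegion_cons.1 ht
  have hzt' : InConvergenceRegion (nome τ) wt (Fin.append z t) :=
    inConvergenceRegion_append.2 ⟨hz, ht, fun a j => by simpa using hzt a j.succ⟩
  have hzt₀ : ∀ a, ‖t₀‖ < ‖z a‖ ∧ ‖nome τ * z a‖ < ‖t₀‖ := fun a => by simpa using hzt a 0
  obtain ⟨ρ, ρ', ρ'', hd, hM, hJ⟩ := exists_dominated_bounds hq0 hq hrA hrB hzt'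
  have hμ : ∀ r : ℤ, cexp (-c) * nome τ ^ r ≠ 0 :=
    fun r => mul_ne_zero (exp_ne_zero _) (zpow_ne_zero _ hq0)
  have hward := fun (r₀ : ℤ) (k : Fin n → ℤ) (r : Fin m → ℤ) =>
    wtrace_ward hd (fun a => hA r₀ a) (fun j => hB r₀ j) (hM k r).choose_spec
      (hJ J hrJ r₀).choose_spec (hμ r₀)
      (fun v => by
        rw [hQ r₀ v, mul_inv, zpow_neg, Complex.exp_neg, inv_inv, mul_comm (cexp c)])
      (fun a => wtraceTerm_summable_of_fieldTerm hz.2.1 ht.2.1 (hy a).summable _ _)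
      (fun j => wtraceTerm_summable_of_fieldTerm hz.2.1 ht.2.1 (hy' j).summable _ _)
  have hmodes := hasSum_ward_modes hτ (exp_ne_zero (-c)) hc
    (T := fun r₀ k r => wtrace w (fieldProd A k * (J r₀ * fieldProd B r)))
    (TA := fun a k r => wtrace w (fieldProd (Function.update A a (A' a)) k * fieldProd B r))
    (TB := fun j k r => wtrace w (fieldProd A k * fieldProd (Function.update B j (B' j)) r))
    hward ht₀ hz.2.1 ht.2.1 hzt₀ htt
    (fun a => hasSum_wtrace_of_fieldTerm hz.2.1 ht.2.1 (hy a))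
    (fun j => hasSum_wtrace_of_fieldTerm hz.2.1 ht.2.1 (hy' j))
  have hcons := summable_fieldTerm hq0 hq hrA
    (show RadiallyBounded (Fin.cons J B : Fin (m + 1) → _) from
      fun i x => Fin.cases (hrJ x) (fun j => hrB j x) i) hp
  have h1 := hasSum_consModes (F := fun k r => wtrace w (fieldProd A k * fieldProd (Fin.cons J B) r)
      * ((∏ a, z a ^ (-k a)) *
        ∏ j, (Fin.cons t₀ t : Fin (m + 1) → ℂ) j ^ (-r j - 1)))
    (hasSum_wtrace_of_fieldTerm hz.2.1
      (fun j => Fin.cases (by simpa using ht₀) (fun j => by simpa using ht.2.1 j) j) hcons.hasSum)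
  have h2 := fun r₀ r => fieldProd_cons J B r₀ (r : Fin m → ℤ)
  simp only [h2, Fin.prod_univ_succ, Fin.cons_zero, Fin.cons_succ] at h1
  rw [← h1.unique hmodes]
  exact hcons.hasSum

end WardSum

end

end GenusOneWard

namespace GenusOneWard

open Complex Filter Topology

noncomputable section

/-! ### Weak derivatives of curves of operators -/

section WeakDeriv

variable {L : Type*} [AddCommGroup L] [Module ℂ L]

/-- All matrix coefficients of the curve `g` of operators are differentiable at `0`, with
derivatives given by `g'`. -/
def WeakDerivAt (g : ℂ → Module.End ℂ L) (g' : Module.End ℂ L) : Prop :=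
  ∀ (φ : Module.Dual ℂ L) (y : L), HasDerivAt (fun ε => φ (g ε y)) (φ (g' y)) 0

theorem dual_apply_eq_sum [FiniteDimensional ℂ L] (φ : Module.Dual ℂ L) (v : L) :
    φ v = ∑ k, (Module.finBasis ℂ L).coord k v * φ (Module.finBasis ℂ L k) := by
  conv_lhs => rw [← (Module.finBasis ℂ L).sum_repr v, map_sum]
  simp

/-- Expanding the intermediate vector in a basis reduces this to the product rule for finitely many
scalar functions. -/
theorem WeakDerivAt.mul [FiniteDimensional ℂ L] {g h : ℂ → Module.End ℂ L}
    {g' h' : Module.End ℂ L} (hg : WeakDerivAt g g') (hh : WeakDerivAt h h') :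
    WeakDerivAt (fun ε => g ε * h ε) (g' * h 0 + g 0 * h') := by
  intro φ y
  have h1 : ∀ (T : Module.End ℂ L) (v : L), φ (T v)
      = ∑ k, (Module.finBasis ℂ L).coord k v * φ (T (Module.finBasis ℂ L k)) :=
    fun T v => dual_apply_eq_sum (φ ∘ₗ T) v
  simp only [LinearMap.add_apply, map_add, Module.End.mul_apply]
  simp only [h1 (g _) (h _ y), h1 g' (h 0 y), h1 (g 0) (h' y)]
  rw [add_comm, ← Finset.sum_add_distrib]
  exact HasDerivAt.fun_sum fun k _ => (hh _ y).mul (hg φ _)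

theorem WeakDerivAt.unique {g : ℂ → Module.End ℂ L} {g₁ g₂ : Module.End ℂ L}
    (h₁ : WeakDerivAt g g₁) (h₂ : WeakDerivAt g g₂) : g₁ = g₂ :=
  LinearMap.ext fun y => sub_eq_zero.1 ((Module.forall_dual_apply_eq_zero_iff ℂ _).1 fun φ => by
    rw [map_sub, (h₁ φ y).unique (h₂ φ y), sub_self])

/-- All matrix coefficients of the family `g` of operators are polynomials. -/
def PolyFamily {R : Type*} (g : (R → ℂ) → Module.End ℂ L) : Prop :=
  ∀ (φ : Module.Dual ℂ L) (y : L), ∃ p : MvPolynomial R ℂ, ∀ x, MvPolynomial.eval x p = φ (g x y)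

theorem PolyFamily.one {R : Type*} : PolyFamily (fun _ : R → ℂ => (1 : Module.End ℂ L)) :=
  fun φ y => ⟨MvPolynomial.C (φ y), fun x => by simp⟩

theorem PolyFamily.mul [FiniteDimensional ℂ L] {R : Type*} {g h : (R → ℂ) → Module.End ℂ L}
    (hg : PolyFamily g) (hh : PolyFamily h) : PolyFamily fun x => g x * h x := by
  intro φ y
  choose p hp using fun k => hh ((Module.finBasis ℂ L).coord k) y
  choose p' hp' using fun k => hg φ (Module.finBasis ℂ L k)
  refine ⟨∑ k, p k * p' k, fun x => ?_⟩
  have h1 := dual_apply_eq_sum (φ ∘ₗ g x) (h x y)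
  simp only [map_sum, map_mul, hp, hp']
  exact h1.symm

end WeakDeriv

/-! ### Exponentials of nilpotent elements -/

section ExpAd

variable {L : Type*} [LieRing L] [LieAlgebra ℂ L]

theorem expAd_smul (c : ℂ) (X : L) : expAd (c • X) = ∑ k ∈ Finset.range (Module.finrank ℂ L),
    (c ^ k * (k.factorial : ℂ)⁻¹) • (LieAlgebra.ad ℂ L X) ^ k := by
  refine Finset.sum_congr rfl fun k _ => ?_
  rw [map_smul, smul_pow, smul_smul, mul_comm]

theorem isNilpotent_ad_smul {X : L} (h : IsNilpotent (LieAlgebra.ad ℂ L X)) (c : ℂ) :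
    IsNilpotent (LieAlgebra.ad ℂ L (c • X)) := by
  rw [map_smul]
  exact h.smul c

variable [FiniteDimensional ℂ L]

theorem pow_finrank_eq_zero {D : Module.End ℂ L} (h : IsNilpotent D) :
    D ^ Module.finrank ℂ L = 0 := by
  have h1 := D.aeval_self_charpoly
  rwa [IsNilpotent.charpoly_eq_X_pow_finrank h, map_pow, Polynomial.aeval_X] at h1

/-- The exponential of a nilpotent derivation is an automorphism, and the truncation at dim L is
exact because the power of ad X of order dim L is zero. -/
theorem expAd_exists_lieEquiv {X : L} (h : IsNilpotent (LieAlgebra.ad ℂ L X)) :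
    ∃ E : L ≃ₗ⁅ℂ⁆ L, ∀ y, E y = expAd X y := by
  -- The exponential series is taken over ℚ, so L is given the restricted rational structure.
  let _ : Module ℚ L := Module.compHom L (algebraMap ℚ ℂ)
  have hsmul : ∀ (r : ℚ) (x : L), r • x = (r : ℂ) • x := fun r x => rfl
  let _ : LieAlgebra ℚ L := { lie_smul := fun r x y => by rw [hsmul, hsmul, lie_smul] }
  have h' : IsNilpotent (LieDerivation.ad ℂ L X).toLinearMap := by
    rw [LieDerivation.coe_ad_apply_eq_ad_apply]
    exact h
  refine ⟨LieDerivation.exp _ h', fun y => ?_⟩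
  have h0 := pow_finrank_eq_zero h
  rw [LieDerivation.exp_map_apply, LieDerivation.coe_ad_apply_eq_ad_apply,
    IsNilpotent.exp_eq_sum h0, expAd, LinearMap.sum_apply, LinearMap.sum_apply]
  refine Finset.sum_congr rfl fun k _ => ?_
  rw [LinearMap.smul_apply, LinearMap.smul_apply, hsmul]
  push_cast
  rfl

/-- Automorphisms conjugate ad y into ad of the image of y. This moves an inner velocity to the left
of a group factor. -/
theorem expAd_mul_ad {X : L} (h : IsNilpotent (LieAlgebra.ad ℂ L X)) (y : L) :
    expAd X * LieAlgebra.ad ℂ L y = LieAlgebra.ad ℂ L (expAd X y) * expAd X := by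
  obtain ⟨E, hE⟩ := expAd_exists_lieEquiv h
  refine LinearMap.ext fun v => ?_
  simp only [Module.End.mul_apply, LieAlgebra.ad_apply, ← hE]
  exact LieEquiv.map_lie E y v

theorem surjective_expAd {X : L} (h : IsNilpotent (LieAlgebra.ad ℂ L X)) :
    Function.Surjective (expAd X) := by
  obtain ⟨E, hE⟩ := expAd_exists_lieEquiv h
  intro v
  obtain ⟨u, hu⟩ := E.surjective v
  exact ⟨u, (hE u).symm.trans hu⟩

theorem weakDerivAt_expAd {X : L} (h : IsNilpotent (LieAlgebra.ad ℂ L X)) (c v : ℂ) :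
    WeakDerivAt (fun ε => expAd ((c + ε * v) • X)) (v • (LieAlgebra.ad ℂ L X * expAd (c • X))) := by
  intro φ y
  set D := LieAlgebra.ad ℂ L X with hD
  have h0 := pow_finrank_eq_zero h
  have h1 : ∀ c : ℂ, φ (expAd (c • X) y) = ∑ k ∈ Finset.range (Module.finrank ℂ L),
      c ^ k * ((k.factorial : ℂ)⁻¹ * φ ((D ^ k) y)) := by
    intro c
    rw [expAd_smul, LinearMap.sum_apply, map_sum]
    refine Finset.sum_congr rfl fun k _ => ?_
    rw [LinearMap.smul_apply, map_smul, smul_eq_mul, mul_assoc]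
  have h2 : φ ((v • (D * expAd (c • X))) y) = ∑ k ∈ Finset.range (Module.finrank ℂ L),
      v * (c ^ k * ((k.factorial : ℂ)⁻¹ * φ ((D ^ (k + 1)) y))) := by
    rw [expAd_smul, Finset.mul_sum, Finset.smul_sum, LinearMap.sum_apply, map_sum]
    refine Finset.sum_congr rfl fun k _ => ?_
    rw [mul_smul_comm, smul_smul, LinearMap.smul_apply, map_smul, smul_eq_mul, ← pow_succ']
    ring
  have h3 : HasDerivAt (fun ε : ℂ => ∑ k ∈ Finset.range (Module.finrank ℂ L),
      (c + ε * v) ^ k * ((k.factorial : ℂ)⁻¹ * φ ((D ^ k) y)))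
      (∑ k ∈ Finset.range (Module.finrank ℂ L),
        (k * (c + 0 * v) ^ (k - 1) * (1 * v)) * ((k.factorial : ℂ)⁻¹ * φ ((D ^ k) y))) 0 :=
    HasDerivAt.fun_sum fun k _ =>
      ((((hasDerivAt_id (0 : ℂ)).mul_const v).const_add c).fun_pow k).mul_const _
  simp only [h1]
  rw [h2]
  convert h3 using 1
  -- The differentiated sum loses its constant term and the sum for ad X · exp its top term, where
  -- the power of order dim L is zero; shifting the index by one matches the rest.
  rcases hn : Module.finrank ℂ L with _ | n
  · simp
  · rw [hn] at h0
    rw [Finset.sum_range_succ, Finset.sum_range_succ', h0]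
    simp only [LinearMap.zero_apply, map_zero, mul_zero, add_zero, Nat.cast_zero, zero_mul, one_mul]
    refine Finset.sum_congr rfl fun k _ => ?_
    have : ((k + 1).factorial : ℂ)⁻¹ * ((k + 1 : ℕ) : ℂ) = (k.factorial : ℂ)⁻¹ := by
      rw [Nat.factorial_succ, Nat.cast_mul, mul_inv, mul_right_comm, inv_mul_cancel₀, one_mul]
      exact_mod_cast k.succ_ne_zero
    rw [← this, Nat.add_sub_cancel]
    ring

end ExpAd

/-! ### Coordinates of the second kind -/

section GroupElement

variable {L : Type*} [LieRing L] [LieAlgebra ℂ L] {R : Type*} (e : R → L)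

/-- The product `exp (x^{i₁} e_{i₁}) ⋯ exp (x^{iₛ} e_{iₛ})` in the adjoint representation. -/
def groupElement (l : List R) (x : R → ℂ) : Module.End ℂ L :=
  (l.map fun i => expAd (x i • e i)).prod

/-- The velocity `a' a⁻¹` of the group element, if the coordinates `x` move with velocity `v`. -/
def groupVelocity : List R → (R → ℂ) → (R → ℂ) → L
  | [], _, _ => 0
  | i :: l, x, v => v i • e i + expAd (x i • e i) (groupVelocity l x v)

variable {e}

theorem groupElement_cons (i : R) (l : List R) (x : R → ℂ) :
    groupElement e (i :: l) x = expAd (x i • e i) * groupElement e l x := by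
  rw [groupElement, List.map_cons, List.prod_cons]
  rfl

variable [FiniteDimensional ℂ L]

/-- The product rule, with the velocity of the tail conjugated through the first exponential. -/
theorem weakDerivAt_groupElement (he : ∀ i, IsNilpotent (LieAlgebra.ad ℂ L (e i))) (l : List R)
    (x v : R → ℂ) : WeakDerivAt (fun ε => groupElement e l fun δ => x δ + ε * v δ)
      (LieAlgebra.ad ℂ L (groupVelocity e l x v) * groupElement e l x) := by
  induction l with
  | nil =>
    intro φ y
    simpa [groupElement, groupVelocity] using hasDerivAt_const (0 : ℂ) (φ y)
  | cons i l ih =>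
    have h1 := (weakDerivAt_expAd (he i) (x i) (v i)).mul ih
    simp only [zero_mul, add_zero] at h1
    simp only [groupElement_cons]
    convert h1 using 1
    rw [groupVelocity, map_add, add_mul, map_smul, ← mul_assoc _ (expAd _),
      ← mul_assoc (expAd _) _ (groupElement e l x), expAd_mul_ad (isNilpotent_ad_smul (he i) _),
      smul_mul_assoc, smul_mul_assoc, mul_assoc, mul_assoc]

theorem surjective_groupElement (he : ∀ i, IsNilpotent (LieAlgebra.ad ℂ L (e i))) (l : List R)
    (x : R → ℂ) : Function.Surjective (groupElement e l x) := by
  induction l with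
  | nil => exact fun v => ⟨v, by simp [groupElement]⟩
  | cons i l ih =>
    rw [groupElement_cons, Module.End.mul_eq_comp, LinearMap.coe_comp]
    exact (surjective_expAd (isNilpotent_ad_smul (he i) _)).comp ih

theorem polyFamily_groupElement (l : List R) : PolyFamily (groupElement e l) := by
  induction l with
  | nil => exact PolyFamily.one
  | cons i l ih =>
    have h1 : PolyFamily fun x : R → ℂ => expAd (x i • e i) := by
      intro φ y
      refine ⟨∑ k ∈ Finset.range (Module.finrank ℂ L), MvPolynomial.X i ^ k *
        MvPolynomial.C ((k.factorial : ℂ)⁻¹ * φ ((LieAlgebra.ad ℂ L (e i) ^ k) y)), fun x => ?_⟩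
      beta_reduce
      rw [expAd_smul, LinearMap.sum_apply, map_sum, map_sum]
      refine Finset.sum_congr rfl fun k _ => ?_
      simp [mul_assoc]
    refine (funext fun x => groupElement_cons i l x : groupElement e (i :: l) = _) ▸ h1.mul ih

/-- The group element is surjective, so it cancels on the right, and ad is faithful by `hc`. Hence
velocities can be read off the motion. -/
theorem ad_mul_groupElement_injective (he : ∀ i, IsNilpotent (LieAlgebra.ad ℂ L (e i)))
    (hc : ∀ X : L, LieAlgebra.ad ℂ L X = 0 → X = 0) (l : List R) (x : R → ℂ) {X Y : L}
    (h : LieAlgebra.ad ℂ L X * groupElement e l x = LieAlgebra.ad ℂ L Y * groupElement e l x) :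
    X = Y := by
  refine sub_eq_zero.1 (hc _ (LinearMap.ext fun v => ?_))
  obtain ⟨u, rfl⟩ := surjective_groupElement he l x v
  have := LinearMap.congr_fun h u
  simp only [Module.End.mul_apply] at this
  rw [map_sub, LinearMap.sub_apply, this, sub_self, LinearMap.zero_apply]

end GroupElement

end

end GenusOneWard

namespace GenusOneWard

open Complex Filter Topology

noncomputable section

/-! ### Polynomial vector fields and matrix coefficients -/

section VectorFields

variable {R : Type*} [Fintype R]

theorem vectorFieldApply_vectorFieldBracket (S S' : R → MvPolynomial R ℂ) (P : MvPolynomial R ℂ) :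
    vectorFieldApply (vectorFieldBracket S S') P
      = vectorFieldApply S (vectorFieldApply S' P) - vectorFieldApply S' (vectorFieldApply S P) := by
  induction P using MvPolynomial.induction_on with
  | C c =>
    simp only [vectorFieldApply_C]
    simp [vectorFieldApply]
  | add P Q hP hQ =>
    simp only [vectorFieldApply_add, hP, hQ]
    ring
  | mul_X P α hP =>
    simp only [vectorFieldApply_mul, vectorFieldApply_add, vectorFieldApply_X, hP,
      vectorFieldBracket]
    ring

theorem hasDerivAt_eval_line (x v : R → ℂ) (P : MvPolynomial R ℂ) :
    HasDerivAt (fun ε : ℂ => MvPolynomial.eval (fun δ => x δ + ε * v δ) P)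
      (∑ δ, v δ * MvPolynomial.eval x (MvPolynomial.pderiv δ P)) 0 := by
  classical
  induction P using MvPolynomial.induction_on with
  | C c => simpa using hasDerivAt_const (0 : ℂ) c
  | add P Q hP hQ =>
    simp only [map_add, mul_add, Finset.sum_add_distrib]
    exact hP.add hQ
  | mul_X P α hP =>
    simp only [map_mul, MvPolynomial.eval_X, Derivation.leibniz, smul_eq_mul, map_add]
    have h := hP.fun_mul (((hasDerivAt_id (0 : ℂ)).mul_const (v α)).const_add (x α))
    simp only [id_eq, zero_mul, add_zero, one_mul] at h
    refine h.congr_deriv ?_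
    rw [Finset.sum_mul]
    simp only [mul_add, Finset.sum_add_distrib]
    rw [add_comm]
    congr 1
    · rw [Finset.sum_eq_single α]
      · rw [MvPolynomial.pderiv_X_self, map_one]
        ring
      · intro δ _ hδ
        rw [MvPolynomial.pderiv_X_of_ne (Ne.symm hδ)]
        simp
      · simp
    · exact Finset.sum_congr rfl fun δ _ => by ring

theorem eval_vectorFieldApply (S : R → MvPolynomial R ℂ) (P : MvPolynomial R ℂ) (x : R → ℂ) :
    MvPolynomial.eval x (vectorFieldApply S P)
      = ∑ δ, MvPolynomial.eval x (S δ) * MvPolynomial.eval x (MvPolynomial.pderiv δ P) := by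
  simp [vectorFieldApply]

variable {L : Type*} [LieRing L] [LieAlgebra ℂ L] [FiniteDimensional ℂ L] {e : R → L}

theorem eval_vectorFieldApply_of_coeff (he : ∀ i, IsNilpotent (LieAlgebra.ad ℂ L (e i)))
    {l : List R} {φ : Module.Dual ℂ L} {y : L} {P : MvPolynomial R ℂ}
    (hP : ∀ x, MvPolynomial.eval x P = φ (groupElement e l x y)) (V : R → MvPolynomial R ℂ)
    (x : R → ℂ) : MvPolynomial.eval x (vectorFieldApply V P)
      = φ ⁅groupVelocity e l x fun δ => MvPolynomial.eval x (V δ), groupElement e l x y⁆ := by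
  have h1 := hasDerivAt_eval_line x (fun δ => MvPolynomial.eval x (V δ)) P
  simp only [hP] at h1
  rw [eval_vectorFieldApply]
  exact h1.unique (weakDerivAt_groupElement he l x _ φ y)

/-- On the coefficient φ(a y) the field of X acts as -φ([X, a y]). Applying two fields reverses
their order, and the Jacobi identity turns the difference into -φ([[X, X'], a y]). -/
theorem vectorFieldBracket_apply_coeff (he : ∀ i, IsNilpotent (LieAlgebra.ad ℂ L (e i)))
    {l : List R} {S S' : R → MvPolynomial R ℂ} {X X' : L}
    (hS : ∀ x, groupVelocity e l x (fun δ => MvPolynomial.eval x (S δ)) = -X)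
    (hS' : ∀ x, groupVelocity e l x (fun δ => MvPolynomial.eval x (S' δ)) = -X')
    {φ : Module.Dual ℂ L} {y : L} {P : MvPolynomial R ℂ}
    (hP : ∀ x, MvPolynomial.eval x P = φ (groupElement e l x y)) (x : R → ℂ) :
    MvPolynomial.eval x (vectorFieldApply (vectorFieldBracket S S') P)
      = -φ ⁅⁅X, X'⁆, groupElement e l x y⁆ := by
  have key : ∀ {S S' : R → MvPolynomial R ℂ} {X X' : L},
      (∀ x, groupVelocity e l x (fun δ => MvPolynomial.eval x (S δ)) = -X) →
      (∀ x, groupVelocity e l x (fun δ => MvPolynomial.eval x (S' δ)) = -X') →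
      MvPolynomial.eval x (vectorFieldApply S (vectorFieldApply S' P))
        = φ ⁅X', ⁅X, groupElement e l x y⁆⁆ := by
    intro S S' X X' hS hS'
    rw [eval_vectorFieldApply_of_coeff he (φ := -(φ ∘ₗ LieAlgebra.ad ℂ L X')) (y := y) (l := l)]
    · rw [hS, neg_lie, map_neg, LinearMap.neg_apply, neg_neg]
      rfl
    · intro x
      rw [eval_vectorFieldApply_of_coeff he hP, hS', neg_lie, map_neg]
      rfl
  rw [vectorFieldApply_vectorFieldBracket, map_sub, key hS hS', key hS' hS, lie_lie, map_sub]
  ring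

/-- The vector fields with constant velocity `-X` represent the Lie algebra. -/
theorem groupVelocity_vectorFieldBracket (he : ∀ i, IsNilpotent (LieAlgebra.ad ℂ L (e i)))
    (hc : ∀ X : L, LieAlgebra.ad ℂ L X = 0 → X = 0) {l : List R} {S S' : R → MvPolynomial R ℂ}
    {X X' : L} (hS : ∀ x, groupVelocity e l x (fun δ => MvPolynomial.eval x (S δ)) = -X)
    (hS' : ∀ x, groupVelocity e l x (fun δ => MvPolynomial.eval x (S' δ)) = -X') (x : R → ℂ) :
    groupVelocity e l x (fun δ => MvPolynomial.eval x (vectorFieldBracket S S' δ)) = -⁅X, X'⁆ := by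
  refine ad_mul_groupElement_injective he hc l x (LinearMap.ext fun y => ?_)
  refine sub_eq_zero.1 ((Module.forall_dual_apply_eq_zero_iff ℂ _).1 fun φ => ?_)
  -- The matrix coefficients of a(x) are polynomials, so vector fields can be applied to them, and
  -- together they determine the velocity.
  obtain ⟨P, hP⟩ := polyFamily_groupElement (e := e) l φ y
  have h1 := vectorFieldBracket_apply_coeff he hS hS' hP x
  rw [eval_vectorFieldApply_of_coeff he hP] at h1
  rw [map_sub, Module.End.mul_apply, Module.End.mul_apply, LieAlgebra.ad_apply, LieAlgebra.ad_apply,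
    h1, neg_lie, map_neg, sub_self]

end VectorFields

/-! ### The matrix of the velocity -/

section VelocityMatrix

variable {R : Type*} [Fintype R] [DecidableEq R]

/-- The matrix of `exp (xⁱ ad eᵢ)` on the span of the `e_j`, if `[eᵢ, e_j] = ∑ₖ f i j k e_k`. -/
def expMatrix (f : R → R → R → ℂ) (n : ℕ) (i : R) : Matrix R R (MvPolynomial R ℂ) :=
  ∑ p ∈ Finset.range n, (MvPolynomial.X i ^ p * MvPolynomial.C ((p.factorial : ℂ)⁻¹)) •
    (Matrix.of (f i) ^ p).map MvPolynomial.C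

/-- The matrix of the velocity of the group element in the basis `e_j`. -/
def velocityMatrix (f : R → R → R → ℂ) (n : ℕ) : List R → Matrix R R (MvPolynomial R ℂ)
  | [] => 0
  | i :: l => Matrix.single i i 1 + velocityMatrix f n l * expMatrix f n i

variable {L : Type*} [LieRing L] [LieAlgebra ℂ L] {e : R → L}
  {f : R → R → R → ℂ}

theorem ad_pow_apply_sum (hf : ∀ i j, ⁅e i, e j⁆ = ∑ k, f i j k • e k) (i : R) (p : ℕ) (j : R) :
    (LieAlgebra.ad ℂ L (e i) ^ p) (e j) = ∑ k, (Matrix.of (f i) ^ p) j k • e k := by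
  induction p generalizing j with
  | zero => simp [Matrix.one_apply]
  | succ p ih =>
    rw [pow_succ, Module.End.mul_apply, LieAlgebra.ad_apply, hf, map_sum]
    simp only [map_smul, ih, Finset.smul_sum, smul_smul]
    rw [Finset.sum_comm]
    refine Finset.sum_congr rfl fun k _ => ?_
    rw [← Finset.sum_smul, pow_succ', Matrix.mul_apply]
    rfl

theorem expAd_apply_sum (hf : ∀ i j, ⁅e i, e j⁆ = ∑ k, f i j k • e k) (i : R) (x : R → ℂ) (j : R) :
    expAd (x i • e i) (e j)
      = ∑ k, MvPolynomial.eval x (expMatrix f (Module.finrank ℂ L) i j k) • e k := by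
  rw [expAd_smul, LinearMap.sum_apply]
  simp only [LinearMap.smul_apply, ad_pow_apply_sum hf, Finset.smul_sum, smul_smul]
  rw [Finset.sum_comm]
  refine Finset.sum_congr rfl fun k _ => ?_
  rw [← Finset.sum_smul, expMatrix, Matrix.sum_apply, map_sum]
  congr 1
  refine Finset.sum_congr rfl fun p _ => ?_
  simp [mul_assoc]

theorem groupVelocity_eq_sum (hf : ∀ i j, ⁅e i, e j⁆ = ∑ k, f i j k • e k) (l : List R)
    (x v : R → ℂ) : groupVelocity e l x v = ∑ k, (∑ j, v j *
      MvPolynomial.eval x (velocityMatrix f (Module.finrank ℂ L) l j k)) • e k := by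
  induction l with
  | nil => simp [groupVelocity, velocityMatrix]
  | cons i l ih =>
    rw [groupVelocity, ih, map_sum]
    simp only [map_smul, expAd_apply_sum hf, velocityMatrix, Matrix.add_apply, map_add, mul_add,
      Finset.sum_add_distrib, add_smul]
    congr 1
    · rw [Finset.sum_eq_single i]
      · rw [Finset.sum_eq_single i]
        · simp
        · intro j _ hj
          simp [Matrix.single_apply_of_row_ne hj.symm]
        · simp
      · intro k _ hk
        simp [Matrix.single_apply_of_col_ne _ _ hk.symm]
      · simp
    · simp only [Finset.smul_sum, smul_smul, Matrix.mul_apply, map_sum, map_mul, Finset.mul_sum,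
        Finset.sum_mul, Finset.sum_smul]
      rw [Finset.sum_comm]
      refine Finset.sum_congr rfl fun k _ => ?_
      rw [Finset.sum_comm]
      simp only [mul_assoc]

theorem eval_zero_expMatrix (f : R → R → R → ℂ) {n : ℕ} (hn : n ≠ 0) (i j k : R) :
    MvPolynomial.eval 0 (expMatrix f n i j k) = (1 : Matrix R R ℂ) j k := by
  obtain ⟨n, rfl⟩ := Nat.exists_eq_succ_of_ne_zero hn
  rw [expMatrix, Finset.sum_range_succ']
  simp [Matrix.sum_apply, Matrix.one_apply, pow_succ]

/-- At x = 0 every exponential is the identity, so each letter of the list contributes its own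
elementary diagonal matrix. -/
theorem eval_zero_velocityMatrix (f : R → R → R → ℂ) {n : ℕ} (hn : n ≠ 0) (l : List R) (j k : R) :
    MvPolynomial.eval 0 (velocityMatrix f n l j k)
      = (l.map fun i => (Matrix.single i i 1 : Matrix R R ℂ)).sum j k := by
  induction l generalizing j k with
  | nil => simp [velocityMatrix]
  | cons i l ih =>
    rw [velocityMatrix, Matrix.add_apply, map_add, List.map_cons, List.sum_cons, Matrix.add_apply]
    congr 1
    · simp only [Matrix.single_apply]
      split_ifs <;> simp
    · simp only [Matrix.mul_apply, map_sum, map_mul, ih, eval_zero_expMatrix f hn]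
      rw [← Matrix.mul_apply, mul_one]

end VelocityMatrix

end

end GenusOneWard

namespace GenusOneWard

open Complex Filter Topology MvPolynomial

noncomputable section

/-! ### Weighted homogeneity and inversion of the velocity matrix -/

section Homogeneity

variable {R : Type*}

theorem weight_nonneg {ht : R → ℤ} (hpos : ∀ i, 0 < ht i) (s : R →₀ ℕ) :
    0 ≤ Finsupp.weight ht s := by
  rw [Finsupp.weight_apply]
  exact Finset.sum_nonneg fun i _ => nsmul_nonneg (hpos i).le _

theorem weight_pos {ht : R → ℤ} (hpos : ∀ i, 0 < ht i) {s : R →₀ ℕ} (hs : s ≠ 0) :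
    0 < Finsupp.weight ht s := by
  obtain ⟨i, hi⟩ := Finsupp.ne_iff.1 hs
  rw [Finsupp.weight_apply]
  exact Finset.sum_pos' (fun i _ => nsmul_nonneg (hpos i).le _)
    ⟨i, Finsupp.mem_support_iff.2 hi, nsmul_pos (hpos i) hi⟩

theorem eq_zero_of_isWeightedHomogeneous {ht : R → ℤ} (hpos : ∀ i, 0 < ht i)
    {p : MvPolynomial R ℂ} {d : ℤ} (h : IsWeightedHomogeneous ht p d) (hd : d < 0) : p = 0 := by
  ext s
  by_contra hs
  exact (h hs ▸ weight_nonneg hpos s).not_gt hd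

theorem eq_C_of_isWeightedHomogeneous {ht : R → ℤ} (hpos : ∀ i, 0 < ht i) {p : MvPolynomial R ℂ}
    (h : IsWeightedHomogeneous ht p 0) : p = C (eval 0 p) := by
  classical
  ext s
  rw [coeff_C]
  split_ifs with hs
  · rw [← hs, eval_zero, constantCoeff_eq]
  · by_contra hs'
    exact (weight_pos hpos (Ne.symm hs)).ne' (h hs')

/-- The derivative would have negative weight, while all variables have positive weight. -/
theorem pderiv_eq_zero_of_isWeightedHomogeneous {ht : R → ℤ} (hpos : ∀ i, 0 < ht i)
    {p : MvPolynomial R ℂ} {d : ℤ} (h : IsWeightedHomogeneous ht p d) {δ : R} (hd : d < ht δ) :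
    pderiv δ p = 0 :=
  eq_zero_of_isWeightedHomogeneous hpos (h.pderiv (sub_add_cancel d (ht δ))) (sub_neg.2 hd)

theorem isWeightedHomogeneous_vectorFieldApply [Fintype R] {W : Type*} [AddCommGroup W] {wt : R → W}
    {S : R → MvPolynomial R ℂ} {c d : W} (hS : ∀ δ, IsWeightedHomogeneous wt (S δ) (wt δ - c))
    {p : MvPolynomial R ℂ} (hp : IsWeightedHomogeneous wt p d) :
    IsWeightedHomogeneous wt (vectorFieldApply S p) (d - c) :=
  IsWeightedHomogeneous.sum _ _ _ fun δ _ => by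
    have h := (hS δ).mul (hp.pderiv (sub_add_cancel d (wt δ)))
    rwa [show wt δ - c + (d - wt δ) = d - c by abel] at h

/-- The entry `M j k` is homogeneous of weight `wt k - wt j`. -/
def MatrixHomogeneous {W : Type*} [AddCommGroup W] (wt : R → W)
    (M : Matrix R R (MvPolynomial R ℂ)) : Prop :=
  ∀ j k, IsWeightedHomogeneous wt (M j k) (wt k - wt j)

variable {W : Type*} [AddCommGroup W] {wt : R → W}

theorem MatrixHomogeneous.diag {M : Matrix R R (MvPolynomial R ℂ)} (h : ∀ j k, j ≠ k → M j k = 0)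
    (h' : ∀ j, ∃ c, M j j = C c) : MatrixHomogeneous wt M := by
  intro j k
  by_cases hjk : j = k
  · subst hjk
    obtain ⟨c, hc⟩ := h' j
    rw [hc, sub_self]
    exact isWeightedHomogeneous_C _ _
  · rw [h j k hjk]
    exact isWeightedHomogeneous_zero _ _ _

theorem MatrixHomogeneous.mul [Fintype R] {M N : Matrix R R (MvPolynomial R ℂ)} (hM : MatrixHomogeneous wt M)
    (hN : MatrixHomogeneous wt N) : MatrixHomogeneous wt (M * N) := fun j k => by
  rw [Matrix.mul_apply]
  refine IsWeightedHomogeneous.sum _ _ _ fun i _ => ?_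
  have h := (hM j i).mul (hN i k)
  rwa [show wt i - wt j + (wt k - wt i) = wt k - wt j by abel] at h

theorem matrixHomogeneous_one [DecidableEq R] : MatrixHomogeneous wt (1 : Matrix R R (MvPolynomial R ℂ)) :=
  MatrixHomogeneous.diag (fun _ _ h => Matrix.one_apply_ne h)
    fun _ => ⟨1, by rw [Matrix.one_apply_eq, C_1]⟩

theorem MatrixHomogeneous.pow [Fintype R] [DecidableEq R] {M : Matrix R R (MvPolynomial R ℂ)} (hM : MatrixHomogeneous wt M)
    (p : ℕ) : MatrixHomogeneous wt (M ^ p) := by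
  induction p with
  | zero => exact matrixHomogeneous_one
  | succ p ih => exact ih.mul hM

variable {f : R → R → R → ℂ}

theorem weight_of_pow_ne_zero [Fintype R] [DecidableEq R] (hf : ∀ i j k, f i j k ≠ 0 → wt k = wt i + wt j) (i : R) (p : ℕ)
    (j k : R) (h : (Matrix.of (f i) ^ p) j k ≠ 0) : wt k - wt j = p • wt i := by
  induction p generalizing k with
  | zero =>
    rw [pow_zero] at h
    by_cases hjk : j = k
    · simp [hjk]
    · exact absurd (Matrix.one_apply_ne hjk) h
  | succ p ih =>
    rw [pow_succ, Matrix.mul_apply] at h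
    obtain ⟨m, -, hm⟩ := Finset.exists_ne_zero_of_sum_ne_zero h
    have h1 := ih m (left_ne_zero_of_mul hm)
    have h2 := hf i m k (right_ne_zero_of_mul hm)
    rw [succ_nsmul, ← h1, h2]
    abel

theorem matrixHomogeneous_expMatrix [Fintype R] [DecidableEq R] (hf : ∀ i j k, f i j k ≠ 0 → wt k = wt i + wt j) (n : ℕ)
    (i : R) : MatrixHomogeneous wt (expMatrix f n i) := fun j k => by
  rw [expMatrix, Matrix.sum_apply]
  refine IsWeightedHomogeneous.sum _ _ _ fun p _ => ?_
  rw [Matrix.smul_apply, Matrix.map_apply, smul_eq_mul]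
  by_cases h : (Matrix.of (f i) ^ p) j k = 0
  · rw [h, C_0, mul_zero]
    exact isWeightedHomogeneous_zero _ _ _
  · rw [weight_of_pow_ne_zero hf i p j k h]
    have h1 := ((isWeightedHomogeneous_X ℂ wt i).pow p).mul
      (isWeightedHomogeneous_C wt ((p.factorial : ℂ)⁻¹))
    have h2 := h1.mul (isWeightedHomogeneous_C wt ((Matrix.of (f i) ^ p) j k))
    rwa [add_zero, add_zero] at h2

theorem matrixHomogeneous_velocityMatrix [Fintype R] [DecidableEq R]
    (hf : ∀ i j k, f i j k ≠ 0 → wt k = wt i + wt j) (n : ℕ)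
    (l : List R) : MatrixHomogeneous wt (velocityMatrix f n l) := by
  induction l with
  | nil => exact fun j k => isWeightedHomogeneous_zero _ _ _
  | cons i l ih =>
    refine fun j k => IsWeightedHomogeneous.add ?_ ((ih.mul (matrixHomogeneous_expMatrix hf n i)) j k)
    refine MatrixHomogeneous.diag (M := Matrix.single i i 1) (fun j k h => ?_) (fun j => ?_) j k
    · rw [Matrix.single_apply, if_neg]
      rintro ⟨rfl, rfl⟩
      exact h rfl
    · rw [Matrix.single_apply]
      split_ifs
      · exact ⟨1, C_1.symm⟩
      · exact ⟨0, C_0.symm⟩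

/-- The inverse of a unitriangular matrix, as a truncated geometric series. -/
def unipotentInverse [Fintype R] [DecidableEq R] (N : ℕ) (M : Matrix R R (MvPolynomial R ℂ)) :
    Matrix R R (MvPolynomial R ℂ) :=
  ∑ p ∈ Finset.range N, (1 - M) ^ p

theorem MatrixHomogeneous.unipotentInverse [Fintype R] [DecidableEq R] {M : Matrix R R (MvPolynomial R ℂ)}
    (hM : MatrixHomogeneous wt M) (N : ℕ) : MatrixHomogeneous wt (unipotentInverse N M) :=
  fun j k => by
    rw [GenusOneWard.unipotentInverse, Matrix.sum_apply]
    exact IsWeightedHomogeneous.sum _ _ _ fun p _ =>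
      MatrixHomogeneous.pow (fun j k => (matrixHomogeneous_one j k).sub (hM j k)) p j k

/-- An entry (j, k) of M has weight ht k - ht j: it vanishes if this is negative and is constant,
given by the value at 0, if this is zero. So 1 - M strictly raises the height and is nilpotent. -/
theorem unipotentInverse_mul [Fintype R] [DecidableEq R] {ht : R → ℤ} (hpos : ∀ i, 0 < ht i) {N : ℕ} (hN : ∀ i, ht i ≤ N)
    {M : Matrix R R (MvPolynomial R ℂ)} (hM : MatrixHomogeneous ht M)
    (h0 : ∀ j k, eval 0 (M j k) = (1 : Matrix R R ℂ) j k) :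
    GenusOneWard.unipotentInverse N M * M = 1 := by
  have h1 : ∀ j k, (1 - M) j k ≠ 0 → ht j < ht k := by
    intro j k h
    by_contra! hle
    rcases hle.lt_or_eq with hlt | heq
    · refine h ?_
      rw [Matrix.sub_apply, eq_zero_of_isWeightedHomogeneous hpos (hM j k) (sub_neg.2 hlt),
        Matrix.one_apply_ne (by rintro rfl; exact hlt.ne rfl), sub_zero]
    · have h2 := hM j k
      rw [heq, sub_self] at h2
      refine h ?_
      rw [Matrix.sub_apply, eq_C_of_isWeightedHomogeneous hpos h2, h0]
      by_cases hjk : j = k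
      · subst hjk
        simp
      · simp [Matrix.one_apply_ne hjk]
  have h2 : ∀ (p : ℕ) j k, ((1 - M) ^ p) j k ≠ 0 → ht j + p ≤ ht k := by
    intro p
    induction p with
    | zero =>
      intro j k h
      by_cases hjk : j = k
      · simp [hjk]
      · exact absurd (Matrix.one_apply_ne hjk) h
    | succ p ih =>
      intro j k h
      rw [pow_succ, Matrix.mul_apply] at h
      obtain ⟨m, -, hm⟩ := Finset.exists_ne_zero_of_sum_ne_zero h
      have h3 := ih j m (left_ne_zero_of_mul hm)
      have h4 := h1 m k (right_ne_zero_of_mul hm)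
      push_cast
      omega
  -- A nonzero entry would need ht k ≥ ht j + N > N, above the bound on heights.
  have h3 : (1 - M) ^ N = 0 := by
    ext1 j k
    by_contra h
    have h4 := h2 N j k h
    have h5 := hpos j
    have h6 := hN k
    omega
  have h4 := geom_sum_mul_neg (1 - M) N
  rwa [sub_sub_cancel, h3, sub_zero] at h4

end Homogeneity

end

end GenusOneWard

namespace GenusOneWard

open Complex Filter Topology MvPolynomial

noncomputable section

/-! ### Left action fields as solutions of a linear system -/

section LeftField

variable {L : Type*} [LieRing L] [LieAlgebra ℂ L] {R : Type*} {e : R → L}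

theorem leftAction_iff_groupVelocity [FiniteDimensional ℂ L]
    (he : ∀ i, IsNilpotent (LieAlgebra.ad ℂ L (e i)))
    (hc : ∀ X : L, LieAlgebra.ad ℂ L X = 0 → X = 0) {l : List R} {X : L}
    {S : R → MvPolynomial R ℂ} :
    (∀ (x : R → ℂ) (y : L) (φ : Module.Dual ℂ L), HasDerivAt
        (fun ε : ℂ => φ (groupElement e l (fun δ => x δ + ε * eval x (S δ)) y))
        (φ (-⁅X, groupElement e l x y⁆)) 0) ↔
      ∀ x, groupVelocity e l x (fun δ => eval x (S δ)) = -X := by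
  constructor
  · intro h x
    refine ad_mul_groupElement_injective he hc l x
      ((weakDerivAt_groupElement he l x _).unique fun φ y => ?_)
    rw [Module.End.mul_apply, LieAlgebra.ad_apply, neg_lie]
    exact h x y φ
  · intro h x y φ
    have h1 := weakDerivAt_groupElement he l x (fun δ => eval x (S δ)) φ y
    rwa [h, Module.End.mul_apply, LieAlgebra.ad_apply, neg_lie] at h1

/-- By independence of the e_k the condition is the linear system S M = c over polynomials, with M
the velocity matrix; N inverts it. -/
theorem groupVelocity_eq_iff [Fintype R] [DecidableEq R] (hli : LinearIndependent ℂ e)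
    {f : R → R → R → ℂ} (hf : ∀ i j, ⁅e i, e j⁆ = ∑ k, f i j k • e k) {l : List R}
    {N : Matrix R R (MvPolynomial R ℂ)} (hN : N * velocityMatrix f (Module.finrank ℂ L) l = 1)
    {S : R → MvPolynomial R ℂ} {c : R → ℂ} :
    (∀ x, groupVelocity e l x (fun δ => eval x (S δ)) = ∑ k, c k • e k) ↔
      ∀ i, S i = ∑ k, C (c k) * N k i := by
  set M := velocityMatrix f (Module.finrank ℂ L) l with hM
  have h1 : (∀ x, groupVelocity e l x (fun δ => eval x (S δ)) = ∑ k, c k • e k) ↔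
      Matrix.vecMul S M = fun k => C (c k) := by
    constructor
    · intro h
      funext k
      refine MvPolynomial.funext fun x => ?_
      have h2 := h x
      rw [groupVelocity_eq_sum hf, ← hM, ← sub_eq_zero, ← Finset.sum_sub_distrib] at h2
      simp only [← sub_smul] at h2
      have h3 := Fintype.linearIndependent_iff.1 hli _ h2 k
      simp only [Matrix.vecMul, dotProduct, map_sum, map_mul, eval_C]
      exact sub_eq_zero.1 h3
    · intro h x
      rw [groupVelocity_eq_sum hf, ← hM]
      refine Finset.sum_congr rfl fun k _ => ?_
      have h2 := congrArg (eval x) (congrFun h k)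
      simp only [Matrix.vecMul, dotProduct, map_sum, map_mul, eval_C] at h2
      rw [h2]
  rw [h1]
  constructor
  · intro h i
    have h2 : Matrix.vecMul (Matrix.vecMul S M) N = S := by
      -- For square matrices over a commutative ring the left inverse is also a right inverse.
      rw [Matrix.vecMul_vecMul, mul_eq_one_comm.1 hN, Matrix.vecMul_one]
    rw [← congrFun h2 i, h]
    rfl
  · intro h
    have h2 : S = Matrix.vecMul (fun k => C (c k)) N := funext h
    rw [h2, Matrix.vecMul_vecMul, hN, Matrix.vecMul_one]

theorem sum_map_single_ofFn [Fintype R] [DecidableEq R] {s : ℕ} (ord : Fin s ≃ R) :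
    ((List.ofFn ord).map fun i => (Matrix.single i i 1 : Matrix R R ℂ)).sum = 1 := by
  rw [List.map_ofFn, List.sum_ofFn]
  simp only [Function.comp_apply]
  rw [Equiv.sum_comp ord fun i => (Matrix.single i i 1 : Matrix R R ℂ)]
  ext j k
  rw [Matrix.sum_apply, Finset.sum_eq_single j]
  · simp [Matrix.single_apply, Matrix.one_apply]
  · intro i _ hi
    simp [hi]
  · simp

end LeftField

/-! ### Positive roots, heights and structure constants -/

section Roots

open LieAlgebra LieAlgebra.IsKilling

theorem eq_zero_of_ad_eq_zero {L : Type*} [LieRing L] [LieAlgebra ℂ L]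
    [LieAlgebra.IsSimple ℂ L] {X : L} (h : LieAlgebra.ad ℂ L X = 0) : X = 0 := by
  have h1 : X ∈ LieAlgebra.center ℂ L := by
    rw [← LieAlgebra.self_module_ker_eq_center, LieModule.mem_ker]
    exact fun m => LinearMap.congr_fun h m
  rwa [LieAlgebra.center_eq_bot, LieSubmodule.mem_bot] at h1

variable {L : Type*} [LieRing L] [LieAlgebra ℂ L] [FiniteDimensional ℂ L] [LieAlgebra.IsSimple ℂ L]
  {𝔥 : LieSubalgebra ℂ L} [𝔥.IsCartanSubalgebra] {b : (rootSystem 𝔥).Base}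

/-- The height of a positive root. -/
def PosRoot.height (α : PosRoot b) : ℤ := b.height α.1

theorem PosRoot.height_pos (α : PosRoot b) : 0 < α.height := α.2

theorem PosRoot.isNonZero (α : PosRoot b) : (α.1 : LieModule.Weight ℂ 𝔥 L).IsNonZero := by
  exact (Finset.mem_filter.1 α.1.2).2

theorem PosRoot.toDual_injective : Function.Injective (PosRoot.toDual (b := b)) :=
  fun _ _ h => Subtype.ext ((rootSystem 𝔥).root.injective h)

theorem PosRoot.height_add {α β γ : PosRoot b} (h : γ.toDual = α.toDual + β.toDual) :
    γ.height = α.height + β.height := b.height_add h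

theorem isNilpotent_ad_rootVector {e : PosRoot b → L} (he : IsRootVectors e) (α : PosRoot b) :
    IsNilpotent (LieAlgebra.ad ℂ L (e α)) := by
  refine LieAlgebra.isNilpotent_ad_of_mem_rootSpace 𝔥 ?_ (he α).1
  simp

theorem linearIndependent_rootVectors {e : PosRoot b → L} (he : IsRootVectors e) :
    LinearIndependent ℂ e := by
  have h1 := LieSubmodule.iSupIndep_toSubmodule.2 (LieModule.iSupIndep_genWeightSpace' ℂ 𝔥 L)
  have h2 := h1.comp (f := fun α : PosRoot b => (α.1 : LieModule.Weight ℂ 𝔥 L))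
    fun α β h => Subtype.ext (Subtype.ext h)
  exact h2.linearIndependent _ (fun α => (he α).1) fun α => (he α).2

/-- The bracket lies in the weight space of α + β. This is the line of e_γ if α + β = γ is a
positive root, and zero otherwise. -/
theorem lie_rootVectors {e : PosRoot b → L} (he : IsRootVectors e) (α β : PosRoot b) :
    ⁅e α, e β⁆ = ∑ γ, structureConstant e α β γ • e γ := by
  classical
  have hmem := LieAlgebra.lie_mem_genWeightSpace_of_mem_genWeightSpace (he α).1 (he β).1
  by_cases h : ∃ γ : PosRoot b, γ.toDual = α.toDual + β.toDual
  · obtain ⟨γ, hγ⟩ := h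
    rw [Finset.sum_eq_single γ]
    · rw [structureConstant, if_pos hγ]
      refine Classical.epsilon_spec (p := fun c : ℂ => ⁅e α, e β⁆ = c • e γ) ?_
      have hw : ((α.1 : LieModule.Weight ℂ 𝔥 L) : 𝔥 → ℂ) + (β.1 : LieModule.Weight ℂ 𝔥 L)
          = (γ.1 : LieModule.Weight ℂ 𝔥 L) := funext fun H => (LinearMap.congr_fun hγ H).symm
      rw [hw] at hmem
      have h1 := finrank_rootSpace_eq_one (γ.1 : LieModule.Weight ℂ 𝔥 L) γ.isNonZero
      obtain ⟨c, hc⟩ := (finrank_eq_one_iff_of_nonzero' (⟨e γ, (he γ).1⟩ :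
        rootSpace 𝔥 (γ.1 : LieModule.Weight ℂ 𝔥 L))
        (fun h => (he γ).2 (congrArg Subtype.val h))).1 h1 ⟨_, hmem⟩
      exact ⟨c, (congrArg Subtype.val hc).symm⟩
    · intro δ _ hδ
      rw [structureConstant, if_neg, zero_smul]
      exact fun h => hδ (PosRoot.toDual_injective (h.trans hγ.symm))
    · simp
  · rw [Finset.sum_eq_zero]
    · by_contra hne
      refine h ?_
      have hbot : LieModule.genWeightSpace L (((α.1 : LieModule.Weight ℂ 𝔥 L) : 𝔥 → ℂ)
          + ((β.1 : LieModule.Weight ℂ 𝔥 L) : 𝔥 → ℂ)) ≠ ⊥ := fun h0 => hne (by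
        rw [h0] at hmem
        exact hmem)
      let χ : LieModule.Weight ℂ 𝔥 L := ⟨_, hbot⟩
      -- A zero sum would force α = -β, contradicting the positivity of both heights.
      have hχ : χ.IsNonZero := by
        intro h0
        have h1 : (rootSystem 𝔥).root α.1
            = (rootSystem 𝔥).root ((rootSystem 𝔥).reflectionPerm β.1 β.1) := by
          rw [RootPairing.root_reflectionPerm, RootPairing.reflection_apply_self]
          exact LinearMap.ext fun H => eq_neg_of_add_eq_zero_left (congrFun h0 H)
        have h2 := b.height_reflectionPerm_self β.1
        have h3 := (rootSystem 𝔥).root.injective h1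
        have h4 := α.height_pos
        have h5 := β.height_pos
        unfold PosRoot.height at h4 h5
        rw [h3] at h4
        exact absurd h4 (by
          refine not_lt.2 (h2.le.trans ?_)
          omega)
      have hmem' : χ ∈ 𝔥.root := by
        exact Finset.mem_filter.2 ⟨Finset.mem_univ _, hχ⟩
      have hadd : (rootSystem 𝔥).root ⟨χ, hmem'⟩ = (rootSystem 𝔥).root α.1
          + (rootSystem 𝔥).root β.1 := LinearMap.ext fun H => rfl
      exact ⟨⟨⟨χ, hmem'⟩, α.2.add β.2 hadd⟩, hadd⟩
    · intro γ _
      rw [structureConstant, if_neg fun hγ => h ⟨γ, hγ⟩, zero_smul]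

end Roots

end

end GenusOneWard

namespace GenusOneWard

open Complex Filter Topology MvPolynomial

noncomputable section

/-! ### The screening vector fields and their currents -/

section ScreeningFields

open LieAlgebra LieAlgebra.IsKilling

variable {L : Type*} [LieRing L] [LieAlgebra ℂ L] [FiniteDimensional ℂ L] [LieAlgebra.IsSimple ℂ L]
  {𝔥 : LieSubalgebra ℂ L} [𝔥.IsCartanSubalgebra] {b : (rootSystem 𝔥).Base} {e : PosRoot b → L}
  {s : ℕ}

theorem nilpotentGroupElement_eq (ord : Fin s ≃ PosRoot b) (x : PosRoot b → ℂ) :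
    nilpotentGroupElement e ord x = groupElement e (List.ofFn ord) x := by
  rw [groupElement, List.map_ofFn]
  rfl

theorem isLeftActionField_iff (he : IsRootVectors e) (ord : Fin s ≃ PosRoot b) {X : L}
    {S : PosRoot b → MvPolynomial (PosRoot b) ℂ} : IsLeftActionField e ord X S ↔
      ∀ x, groupVelocity e (List.ofFn ord) x (fun δ => eval x (S δ)) = -X := by
  rw [← leftAction_iff_groupVelocity (isNilpotent_ad_rootVector he)
    (fun _ => eq_zero_of_ad_eq_zero), IsLeftActionField]
  simp only [nilpotentGroupElement_eq]

theorem toDual_eq_of_structureConstant_ne_zero {α β γ : PosRoot b}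
    (h : structureConstant e α β γ ≠ 0) : γ.toDual = α.toDual + β.toDual := by
  by_contra h'
  exact h (if_neg h')

/-- A weight on the positive roots which is additive. -/
def IsAdditiveWeight {W : Type*} [AddCommGroup W] (wt : PosRoot b → W) : Prop :=
  ∀ α β γ : PosRoot b, γ.toDual = α.toDual + β.toDual → wt γ = wt α + wt β

theorem isAdditiveWeight_height : IsAdditiveWeight (PosRoot.height (b := b)) :=
  fun _ _ _ => PosRoot.height_add

open Classical in
/-- The inverse of the matrix of the velocity. -/
def leftFieldMatrix (e : PosRoot b → L) (ord : Fin s ≃ PosRoot b) :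
    Matrix (PosRoot b) (PosRoot b) (MvPolynomial (PosRoot b) ℂ) :=
  unipotentInverse (∑ α : PosRoot b, α.height.toNat)
    (velocityMatrix (structureConstant e) (Module.finrank ℂ L) (List.ofFn ord))

-- The truncation order is the sum of all heights, which bounds each of them; at the origin the
-- matrix is the identity since `ord` lists every positive root once.
open Classical in
theorem leftFieldMatrix_mul (he : IsRootVectors e) (ord : Fin s ≃ PosRoot b) :
    leftFieldMatrix e ord *
      velocityMatrix (structureConstant e) (Module.finrank ℂ L) (List.ofFn ord) = 1 := by
  refine unipotentInverse_mul (ht := PosRoot.height) PosRoot.height_pos (fun α => ?_)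
    (matrixHomogeneous_velocityMatrix (fun α β γ h =>
      PosRoot.height_add (toDual_eq_of_structureConstant_ne_zero h)) _ _) fun α β => ?_
  · refine (Int.self_le_toNat _).trans ?_
    exact_mod_cast Finset.single_le_sum (f := fun α : PosRoot b => α.height.toNat)
      (fun _ _ => Nat.zero_le _) (Finset.mem_univ α)
  · have : Nontrivial L := ⟨e α, 0, (he α).2⟩
    rw [eval_zero_velocityMatrix _ Module.finrank_pos.ne', sum_map_single_ofFn]

theorem isWeightedHomogeneous_leftFieldMatrix {W : Type*} [AddCommGroup W] {wt : PosRoot b → W}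
    (hwt : IsAdditiveWeight wt) (ord : Fin s ≃ PosRoot b) (α δ : PosRoot b) :
    IsWeightedHomogeneous wt (leftFieldMatrix e ord α δ) (wt δ - wt α) := by
  classical
  refine MatrixHomogeneous.unipotentInverse (matrixHomogeneous_velocityMatrix (fun α β γ h =>
    hwt α β γ (toDual_eq_of_structureConstant_ne_zero h)) _ _) _ α δ

theorem groupVelocity_eq_iff_leftFieldMatrix (he : IsRootVectors e) (ord : Fin s ≃ PosRoot b)
    {S : PosRoot b → MvPolynomial (PosRoot b) ℂ} {c : PosRoot b → ℂ} :
    (∀ x, groupVelocity e (List.ofFn ord) x (fun δ => eval x (S δ)) = ∑ γ, c γ • e γ) ↔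
      ∀ δ, S δ = ∑ γ, C (c γ) * leftFieldMatrix e ord γ δ := by
  classical
  exact groupVelocity_eq_iff (linearIndependent_rootVectors he) (lie_rootVectors he)
    (leftFieldMatrix_mul he ord)

theorem isLeftActionField_iff_leftFieldMatrix (he : IsRootVectors e) (ord : Fin s ≃ PosRoot b)
    {α : PosRoot b} {S : PosRoot b → MvPolynomial (PosRoot b) ℂ} :
    IsLeftActionField e ord (e α) S ↔ ∀ δ, S δ = -leftFieldMatrix e ord α δ := by
  classical
  rw [isLeftActionField_iff he]
  have h := groupVelocity_eq_iff_leftFieldMatrix he ord (S := S) (c := -Pi.single α 1)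
  have h1 : ∑ γ, (-Pi.single α 1 : PosRoot b → ℂ) γ • e γ = -e α := by
    rw [Finset.sum_eq_single α]
    · simp
    · intro γ _ hγ
      simp [hγ]
    · simp
  have h2 : ∀ δ, ∑ γ, C ((-Pi.single α 1 : PosRoot b → ℂ) γ) * leftFieldMatrix e ord γ δ
      = -leftFieldMatrix e ord α δ := by
    intro δ
    rw [Finset.sum_eq_single α]
    · simp
    · intro γ _ hγ
      simp [hγ]
    · simp
  rw [h1] at h
  simp only [h2] at h
  exact h

/-- The defining condition has exactly one solution, so the chosen field can only be the row of the
inverse matrix. -/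
theorem screeningField_apply (he : IsRootVectors e) (ord : Fin s ≃ PosRoot b) (α δ : PosRoot b) :
    screeningField e ord (e α) δ = -leftFieldMatrix e ord α δ :=
  (isLeftActionField_iff_leftFieldMatrix he ord).1 (Classical.epsilon_spec
    (p := IsLeftActionField e ord (e α)) ⟨fun δ => -leftFieldMatrix e ord α δ,
      (isLeftActionField_iff_leftFieldMatrix he ord).2 fun _ => rfl⟩) δ

theorem isLeftActionField_screeningField (he : IsRootVectors e) (ord : Fin s ≃ PosRoot b)
    (α : PosRoot b) : IsLeftActionField e ord (e α) (screeningField e ord (e α)) :=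
  (isLeftActionField_iff_leftFieldMatrix he ord).2 (screeningField_apply he ord α)

theorem isWeightedHomogeneous_screeningField (he : IsRootVectors e) (ord : Fin s ≃ PosRoot b)
    {W : Type*} [AddCommGroup W] {wt : PosRoot b → W} (hwt : IsAdditiveWeight wt)
    (α δ : PosRoot b) :
    IsWeightedHomogeneous wt (screeningField e ord (e α) δ) (wt δ - wt α) := by
  rw [screeningField_apply he]
  exact (isWeightedHomogeneous_leftFieldMatrix hwt ord α δ).neg

/-- Both fields have the constant velocity -[e_α, e_β], and the velocity determines the field. -/
theorem vectorFieldBracket_screeningField (he : IsRootVectors e) (ord : Fin s ≃ PosRoot b)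
    (α β : PosRoot b) :
    vectorFieldBracket (screeningField e ord (e α)) (screeningField e ord (e β))
      = fun δ => ∑ γ, structureConstant e α β γ • screeningField e ord (e γ) δ := by
  have h := groupVelocity_vectorFieldBracket (isNilpotent_ad_rootVector he)
    (fun _ => eq_zero_of_ad_eq_zero)
    ((isLeftActionField_iff he ord).1 (isLeftActionField_screeningField he ord α))
    ((isLeftActionField_iff he ord).1 (isLeftActionField_screeningField he ord β))
  rw [lie_rootVectors he, ← Finset.sum_neg_distrib] at h
  simp only [← neg_smul] at h
  funext δ
  rw [(groupVelocity_eq_iff_leftFieldMatrix he ord).1 h δ]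
  refine Finset.sum_congr rfl fun γ _ => ?_
  rw [screeningField_apply he, MvPolynomial.smul_eq_C_mul, map_neg, neg_mul, mul_neg]

/-- The coefficient of ∂/∂x^ε has weight ht ε - ht α < ht δ, too small to involve x^δ. -/
theorem pderiv_screeningField_of_height_le (he : IsRootVectors e) (ord : Fin s ≃ PosRoot b)
    (α : PosRoot b) {δ ε : PosRoot b} (h : ε.height ≤ δ.height) :
    pderiv δ (screeningField e ord (e α) ε) = 0 :=
  pderiv_eq_zero_of_isWeightedHomogeneous PosRoot.height_pos
    (isWeightedHomogeneous_screeningField he ord isAdditiveWeight_height α ε)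
    (by have := α.height_pos; omega)

theorem pderiv_vectorFieldApply_screeningField (he : IsRootVectors e) (ord : Fin s ≃ PosRoot b)
    (α β δ : PosRoot b) : pderiv δ (vectorFieldApply (screeningField e ord (e α))
      (screeningField e ord (e β) δ)) = 0 :=
  pderiv_eq_zero_of_isWeightedHomogeneous PosRoot.height_pos
    (isWeightedHomogeneous_vectorFieldApply
      (isWeightedHomogeneous_screeningField he ord isAdditiveWeight_height α)
      (isWeightedHomogeneous_screeningField he ord isAdditiveWeight_height β δ))
    (by have := α.height_pos; have := β.height_pos; omega)

theorem isAdditiveWeight_rootValues {l : ℕ} (hb : Module.Basis (Fin l) ℂ 𝔥) (ξ : Fin l → ℂ) :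
    IsAdditiveWeight (rootValues b hb ξ) := fun α β γ h => by
  simp only [rootValues, h, LinearMap.add_apply]

/-- The current of a root vector. -/
def screeningCurrent (e : PosRoot b → L) (ord : Fin s ≃ PosRoot b) (α : PosRoot b) :
    ℤ → Module.End ℂ (GhostFock (PosRoot b)) := currentField (screeningField e ord (e α))

theorem screeningCurrent_apply (he : IsRootVectors e) (ord : Fin s ≃ PosRoot b) (α : PosRoot b)
    (r : ℤ) (v : GhostFock (PosRoot b)) :
    screeningCurrent e ord α r v = currentMode (screeningField e ord (e α)) r v :=
  currentField_apply (fun _ => pderiv_screeningField_of_height_le he ord α le_rfl) r v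

theorem fieldBracket_screeningCurrent_gammaField (he : IsRootVectors e) (ord : Fin s ≃ PosRoot b)
    (α : PosRoot b) (r : ℤ) (P : MvPolynomial (PosRoot b) ℂ) :
    FieldBracket (screeningCurrent e ord α r) r (gammaField P)
      (gammaField (vectorFieldApply (screeningField e ord (e α)) P)) :=
  fieldBracket_currentField_gammaField
    (fun _ => pderiv_screeningField_of_height_le he ord α le_rfl) r P

theorem fieldBracket_screeningCurrent (he : IsRootVectors e) (ord : Fin s ≃ PosRoot b)
    (α β : PosRoot b) (r : ℤ) :
    FieldBracket (screeningCurrent e ord α r) r (screeningCurrent e ord β)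
      (∑ γ, structureConstant e α β γ • screeningCurrent e ord γ) := by
  have hS := fun (α δ : PosRoot b) =>
    pderiv_screeningField_of_height_le he ord α (le_refl δ.height)
  have h := fieldBracket_currentField (hS α) (hS β)
    (pderiv_vectorFieldApply_screeningField he ord α β) (fun δ ε => by
      -- Of two roots one has the smaller height, so one of the two derivatives in a double
      -- contraction always vanishes.
      rcases le_total ε.height δ.height with h | h
      · exact Or.inl (pderiv_screeningField_of_height_le he ord α h)
      · exact Or.inr (pderiv_screeningField_of_height_le he ord β h)) r
  rw [vectorFieldBracket_screeningField he ord α β, currentField_sum_smul Finset.univ _ hS] at h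
  exact h

theorem homogeneous_screeningCurrent (he : IsRootVectors e) (ord : Fin s ≃ PosRoot b)
    {q : ℂ} (hq : q ≠ 0) {wt : PosRoot b → ℂ} (hwt : IsAdditiveWeight wt) (α : PosRoot b) :
    Homogeneous q (gradingOp (modeWeight q wt)) (cexp (wt α)) (screeningCurrent e ord α) :=
  homogeneous_currentField hq (fun _ => pderiv_screeningField_of_height_le he ord α le_rfl)
    (isWeightedHomogeneous_screeningField he ord hwt α)

theorem radialBound_screeningCurrent (he : IsRootVectors e) (ord : Fin s ≃ PosRoot b)
    (α : PosRoot b) (x : NNReal) : RadialBound (fun k v => screeningCurrent e ord α k v) x := by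
  simp only [screeningCurrent_apply he]
  exact radialBound_currentMode _ x

end ScreeningFields

end

end GenusOneWard

namespace GenusOneWard

open Complex Filter Topology

open LieAlgebra LieAlgebra.IsKilling

noncomputable section

/-! ### The domain of the correlators -/

section GhostDomain

variable {R : Type*}

theorem inGhostDomain_append {q : ℂ} {wt : R → ℂ} {n m : ℕ} {z : Fin n → ℂ} {t : Fin m → ℂ} :
    InGhostDomain q wt (Fin.append z t) ↔ InGhostDomain q wt z ∧ InGhostDomain q wt t ∧
      ∀ a j, ∀ k : ℤ, z a ≠ q ^ k * t j ∧ t j ≠ q ^ k * z a := by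
  constructor
  · rintro ⟨h1, h2, h3⟩
    refine ⟨⟨h1, fun a => ?_, fun a a' h k => ?_⟩, ⟨h1, fun j => ?_, fun j j' h k => ?_⟩,
      fun a j k => ⟨?_, ?_⟩⟩
    · simpa using h2 (Fin.castAdd m a)
    · simpa using h3 (Fin.castAdd m a) (Fin.castAdd m a') (by simpa using h) k
    · simpa using h2 (Fin.natAdd n j)
    · simpa using h3 (Fin.natAdd n j) (Fin.natAdd n j') (by simpa using h) k
    · simpa using h3 (Fin.castAdd m a) (Fin.natAdd n j) (castAdd_lt_natAdd a j).ne k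
    · simpa using h3 (Fin.natAdd n j) (Fin.castAdd m a) (castAdd_lt_natAdd a j).ne' k
  · rintro ⟨⟨h1, h2, h3⟩, ⟨-, h4, h5⟩, h6⟩
    refine ⟨h1, fun i => ?_, fun i i' h k => ?_⟩
    · induction i using Fin.addCases with
      | left a => simpa using h2 a
      | right j => simpa using h4 j
    · induction i using Fin.addCases with
      | left a =>
        induction i' using Fin.addCases with
        | left a' => simpa using h3 a a' (by simpa using h) k
        | right j => simpa using (h6 a j k).1
      | right j =>
        induction i' using Fin.addCases with
        | left a => simpa using (h6 a j k).2
        | right j' => simpa using h5 j j' (by simpa using h) k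

theorem InGhostDomain.tail {q : ℂ} {wt : R → ℂ} {m : ℕ} {t : Fin (m + 1) → ℂ}
    (h : InGhostDomain q wt t) : InGhostDomain q wt (Fin.tail t) :=
  ⟨h.1, fun i => h.2.1 i.succ, fun i j hij => h.2.2 i.succ j.succ (by simpa using hij)⟩

theorem InGhostDomain.append_tail {q : ℂ} {wt : R → ℂ} {n m : ℕ} {z : Fin n → ℂ}
    {t : Fin (m + 1) → ℂ} (h : InGhostDomain q wt (Fin.append z t)) :
    InGhostDomain q wt (Fin.append z (Fin.tail t)) := by
  rw [inGhostDomain_append] at h ⊢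
  exact ⟨h.1, h.2.1.tail, fun a j => h.2.2 a j.succ⟩

theorem InGhostDomain.exp_neg_ne {q : ℂ} {wt : R → ℂ} {N : ℕ} {p : Fin N → ℂ}
    (h : InGhostDomain q wt p) (α : R) (k : ℤ) : cexp (-wt α) ≠ q ^ k := fun h' =>
  h.1 α (-k) (by rw [zpow_neg, ← h', Complex.exp_neg, inv_inv])

/-- The relevant ratios lie strictly between |q| and 1 in modulus, and no power of q does. -/
theorem InConvergenceRegion.inGhostDomain {τ : ℂ} (hτ : 0 < τ.im) {wt : R → ℂ} {N : ℕ}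
    {p : Fin N → ℂ} (h : InConvergenceRegion (nome τ) wt p) : InGhostDomain (nome τ) wt p := by
  obtain ⟨h1, h2, h3⟩ := h
  have hlt : ∀ i j, i < j → ∀ k : ℤ, p j ≠ nome τ ^ k * p i := fun i j hij k h => by
    obtain ⟨h4, h5⟩ := h3 i j hij
    have hi : 0 < ‖p i‖ := norm_pos_iff.2 (h2 i)
    refine zpow_ne_of_annulus hτ (a := p j / p i) ?_ ?_ k (by rw [h, mul_div_cancel_right₀ _ (h2 i)])
    · rwa [norm_div, lt_div_iff₀ hi, ← norm_mul]
    · rwa [norm_div, div_lt_one hi]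
  refine ⟨fun α k h => ?_, h2, fun i j hij k h => ?_⟩
  · obtain ⟨h4, h5⟩ := h1 α
    have h0 : 0 < ‖cexp (wt α)‖ := zero_lt_one.trans h4
    refine zpow_ne_of_annulus hτ (a := (cexp (wt α))⁻¹) ?_ ?_ (-k) (by rw [h, zpow_neg])
    · rw [norm_inv, lt_inv_comm₀ (norm_nome_pos τ) h0, ← one_div, lt_div_iff₀ (norm_nome_pos τ),
        mul_comm, ← norm_mul]
      exact h5
    · rw [norm_inv]
      exact inv_lt_one_of_one_lt₀ h4
  · rcases hij.lt_or_gt with hlt' | hlt'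
    · refine hlt i j hlt' (-k) ?_
      rw [h, ← mul_assoc, ← zpow_add₀ (nome_ne_zero τ), neg_add_cancel, zpow_zero, one_mul]
    · exact hlt j i hlt' k h

end GhostDomain

/-! ### The Ward identity as a recursion -/

section WardRecursion

variable {R : Type*} [Fintype R]

/-- The function defined by the Ward identity as a recursion on the number of currents. -/
def wardCorrelator (τ : ℂ) (S : R → R → MvPolynomial R ℂ) (f : R → R → R → ℂ) (wt : R → ℂ)
    {n : ℕ} (z : Fin n → ℂ) : {m : ℕ} → (Fin n → MvPolynomial R ℂ) → (Fin m → R) →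
      (Fin m → ℂ) → ℂ
  | 0, P, _, _ => (∏ a, (P a).coeff 0) * partitionFunction (nome τ) wt
  | _ + 1, P, α, t =>
    (∑ a, negKernel τ (cexp (-wt (α 0))) (t 0) (z a) *
      wardCorrelator τ S f wt z (Function.update P a (vectorFieldApply (S (α 0)) (P a)))
        (Fin.tail α) (Fin.tail t)) +
    ∑ j, negKernel τ (cexp (-wt (α 0))) (t 0) (Fin.tail t j) *
      ∑ γ, f (α 0) (Fin.tail α j) γ *
        wardCorrelator τ S f wt z P (Function.update (Fin.tail α) j γ) (Fin.tail t)

theorem analyticAt_partitionFunction {q : ℂ} (hq0 : q ≠ 0) (hq : ‖q‖ < 1) {E : Type*}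
    [NormedAddCommGroup E] [NormedSpace ℂ E] {wt : E → R → ℂ} {x : E}
    (hwt : ∀ α, AnalyticAt ℂ (fun y => wt y α) x) (h : ∀ α, ∀ k : ℤ, cexp (wt x α) ≠ q ^ k) :
    AnalyticAt ℂ (fun y => partitionFunction q (wt y)) x := by
  refine AnalyticAt.inv ?_ (Finset.prod_ne_zero_iff.2 fun α _ =>
    oscProduct_ne_zero hq0 hq (Complex.exp_ne_zero _) (h α))
  exact Finset.analyticAt_fun_prod _ fun α _ =>
    AnalyticAt.fun_comp (f := fun y => cexp (wt y α))
      (analyticAt_oscProduct hq (Complex.exp_ne_zero _)) (hwt α).cexp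

/-- Induction on the number of currents: on the domain, the theta functions in the denominators of
the kernels and the product in the partition function have no zeros. -/
theorem analyticAt_wardCorrelator {τ : ℂ} (hτ : 0 < τ.im) (S : R → R → MvPolynomial R ℂ)
    (f : R → R → R → ℂ) {E : Type*} [NormedAddCommGroup E] [NormedSpace ℂ E] {n m : ℕ}
    {wt : E → R → ℂ} {z : E → Fin n → ℂ} {t : E → Fin m → ℂ} {x : E}
    (hwt : ∀ α, AnalyticAt ℂ (fun y => wt y α) x) (hz : ∀ a, AnalyticAt ℂ (fun y => z y a) x)
    (ht : ∀ j, AnalyticAt ℂ (fun y => t y j) x) (P : Fin n → MvPolynomial R ℂ)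
    (α : Fin m → R) (hx : InGhostDomain (nome τ) (wt x) (Fin.append (z x) (t x))) :
    AnalyticAt ℂ (fun y => wardCorrelator τ S f (wt y) (z y) P α (t y)) x := by
  induction m generalizing P with
  | zero =>
    simp only [wardCorrelator]
    exact analyticAt_const.mul (analyticAt_partitionFunction (nome_ne_zero τ)
      (norm_nome_lt_one hτ) hwt hx.1)
  | succ m ih =>
    simp only [wardCorrelator]
    have hW := fun (P : Fin n → MvPolynomial R ℂ) (β : Fin m → R) =>
      ih (t := fun y => Fin.tail (t y)) (fun j => ht j.succ) P β hx.append_tail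
    have hc : AnalyticAt ℂ (fun y => cexp (-wt y (α 0))) x := (hwt (α 0)).neg.cexp
    obtain ⟨⟨-, hz0, -⟩, ⟨-, ht0, htt⟩, hzt⟩ := inGhostDomain_append.1 hx
    refine AnalyticAt.add ?_ ?_
    · refine Finset.analyticAt_fun_sum _ fun a _ => AnalyticAt.mul ?_ (hW _ _)
      refine analyticAt_negKernel hτ hc (ht 0) (hz a) (Complex.exp_ne_zero _) (ht0 0) (hz0 a)
        (hx.exp_neg_ne (α 0)) fun k h => (hzt a 0 k).1 ?_
      rwa [div_eq_iff (ht0 0)] at h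
    · refine Finset.analyticAt_fun_sum _ fun j _ => AnalyticAt.mul ?_
        (Finset.analyticAt_fun_sum _ fun γ _ => analyticAt_const.mul (hW _ _))
      refine analyticAt_negKernel hτ hc (ht 0) (ht j.succ) (Complex.exp_ne_zero _) (ht0 0)
        (ht0 j.succ) (hx.exp_neg_ne (α 0)) fun k h => htt j.succ 0 (Fin.succ_ne_zero j) k ?_
      rwa [div_eq_iff (ht0 0)] at h

theorem fieldProd_update {V : Type*} [AddCommGroup V] [Module ℂ V] {N : ℕ}
    (O : Fin N → ℤ → Module.End ℂ V) (j : Fin N) (X : ℤ → Module.End ℂ V) (κ : Fin N → ℤ) :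
    fieldProd (Function.update O j X) κ = MultilinearMap.mkPiAlgebraFin ℂ N (Module.End ℂ V)
      (Function.update (fun i => O i (κ i)) j (X (κ j))) := by
  rw [MultilinearMap.mkPiAlgebraFin_apply, fieldProd]
  congr 2
  funext i
  by_cases h : i = j
  · subst h
    simp
  · simp [h]

theorem fieldProd_update_sum_smul {V ι : Type*} [AddCommGroup V] [Module ℂ V] {N : ℕ}
    (O : Fin N → ℤ → Module.End ℂ V) (j : Fin N) (A : Finset ι) (c : ι → ℂ)
    (X : ι → ℤ → Module.End ℂ V) (κ : Fin N → ℤ) :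
    fieldProd (Function.update O j (∑ i ∈ A, c i • X i)) κ
      = ∑ i ∈ A, c i • fieldProd (Function.update O j (X i)) κ := by
  simp only [fieldProd_update, Finset.sum_apply, Pi.smul_apply]
  rw [MultilinearMap.map_update_sum]
  simp only [MultilinearMap.map_update_smul]

theorem wtraceTerm_mul_sum_smul {ι ι' : Type*} (w : ι → ℂ) (A : Finset ι') (c : ι' → ℂ)
    (M : Module.End ℂ (MvPolynomial ι ℂ)) (X : ι' → Module.End ℂ (MvPolynomial ι ℂ))
    (s : ι →₀ ℕ) : wtraceTerm w (M * ∑ i ∈ A, c i • X i) s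
      = ∑ i ∈ A, c i * wtraceTerm w (M * X i) s := by
  simp only [wtraceTerm, Finset.mul_sum, mul_smul_comm, LinearMap.sum_apply, LinearMap.smul_apply,
    MvPolynomial.coeff_sum, MvPolynomial.coeff_smul, Finset.sum_mul, smul_eq_mul, mul_assoc]

theorem hasSum_fieldTerm_update_sum_smul {ι ι' : Type*} {w : ι → ℂ} {n m : ℕ}
    {A : Fin n → ℤ → Module.End ℂ (MvPolynomial ι ℂ)}
    {B : Fin m → ℤ → Module.End ℂ (MvPolynomial ι ℂ)} {z : Fin n → ℂ} {t : Fin m → ℂ}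
    (j : Fin m) (T : Finset ι') (c : ι' → ℂ) {X : ι' → ℤ → Module.End ℂ (MvPolynomial ι ℂ)}
    {y : ι' → ℂ} (h : ∀ i, HasSum (fieldTerm w A (Function.update B j (X i)) z t) (y i)) :
    HasSum (fieldTerm w A (Function.update B j (∑ i ∈ T, c i • X i)) z t)
      (∑ i ∈ T, c i * y i) := by
  refine (hasSum_sum fun i (_ : i ∈ T) => (h i).mul_left (c i)).congr_fun fun x => ?_
  simp only [fieldTerm, fieldProd_update_sum_smul, wtraceTerm_mul_sum_smul, Finset.sum_mul,
    mul_assoc]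

end WardRecursion

end

end GenusOneWard

namespace GenusOneWard

open Complex Filter Topology

open LieAlgebra LieAlgebra.IsKilling

noncomputable section

/-! ### The recursion computes the traces -/

section CorrelatorTraces

theorem hasSum_fieldTerm_gammaField {R : Type*} [Fintype R] {q : ℂ} {wt : R → ℂ} (hq : ‖q‖ < 1)
    (hwt : ∀ α, 1 < ‖cexp (wt α)‖ ∧ ‖q * cexp (wt α)‖ < 1) {n : ℕ}
    (P : Fin n → MvPolynomial R ℂ) (B : Fin 0 → ℤ → Module.End ℂ (GhostFock R)) (z : Fin n → ℂ)
    (t : Fin 0 → ℂ) :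
    HasSum (fieldTerm (modeWeight q wt) (fun a => gammaField (P a)) B z t)
      ((∏ a, (P a).coeff 0) * partitionFunction q wt) := by
  have hinj : Function.Injective fun s : R × ℤ →₀ ℕ =>
      ((s, 0, 0) : (R × ℤ →₀ ℕ) × (Fin n → ℤ) × (Fin 0 → ℤ)) := fun _ _ h => (Prod.mk.inj h).1
  have hterm : ∀ x, fieldTerm (modeWeight q wt) (fun a => gammaField (P a)) B z t x
      = (if x.2.1 = 0 then ∏ a, (P a).coeff 0 else 0) * expProd (modeWeight q wt) x.1
        * ((∏ a, z a ^ (-x.2.1 a)) * ∏ j, t j ^ (-x.2.2 j - 1)) := by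
    intro x
    have h1 : fieldProd B x.2.2 = 1 := by simp [fieldProd]
    have h2 := coeff_composeFin_gammaPoly P x.2.1 x.1
    rw [show (fun a => gammaPoly (P a) (x.2.1 a)) = fun a => ⇑(gammaField (P a) (x.2.1 a)) from
      funext fun a => funext fun v => (gammaField_apply _ _ v).symm, composeFin_coe] at h2
    rw [fieldTerm, wtraceTerm, h1, mul_one, fieldProd, h2]
  refine (hinj.hasSum_iff fun x hx => ?_).1 ?_
  · rw [hterm, if_neg, zero_mul, zero_mul]
    rintro h
    exact hx ⟨x.1, Prod.ext rfl (Prod.ext h.symm (Subsingleton.elim _ _))⟩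
  · refine ((hasSum_partitionFunction hq hwt).mul_left _).congr_fun fun s => ?_
    rw [Function.comp_apply, hterm]
    simp

variable {L : Type*} [LieRing L] [LieAlgebra ℂ L] [FiniteDimensional ℂ L] [LieAlgebra.IsSimple ℂ L]
  {𝔥 : LieSubalgebra ℂ L} [𝔥.IsCartanSubalgebra] {b : (rootSystem 𝔥).Base} {e : PosRoot b → L}
  {s : ℕ}

/-- Splitting off the first current reproduces the recursion. The polynomials P vary in the
induction because commutators replace P_a by its image under the vector field. -/
theorem hasSum_fieldTerm_wardCorrelator (he : IsRootVectors e) (ord : Fin s ≃ PosRoot b) {τ : ℂ}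
    (hτ : 0 < τ.im) {wt : PosRoot b → ℂ} (hwt : IsAdditiveWeight wt) {n m : ℕ}
    (P : Fin n → MvPolynomial (PosRoot b) ℂ) (α : Fin m → PosRoot b) {z : Fin n → ℂ}
    {t : Fin m → ℂ} (hp : InConvergenceRegion (nome τ) wt (Fin.append z t)) :
    HasSum (fieldTerm (modeWeight (nome τ) wt) (fun a => gammaField (P a))
        (fun j => screeningCurrent e ord (α j)) z t)
      (wardCorrelator τ (fun β => screeningField e ord (e β)) (structureConstant e) wt z P α t) := by
  induction m generalizing P with
  | zero =>
    rw [wardCorrelator]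
    exact hasSum_fieldTerm_gammaField (norm_nome_lt_one hτ) hp.1 P _ z t
  | succ m ih =>
    have ht : Fin.cons (t 0) (Fin.tail t) = t := Fin.cons_self_tail t
    have hp' : InConvergenceRegion (nome τ) wt (Fin.append z (Fin.tail t)) := by
      rw [← ht, inConvergenceRegion_append, inConvergenceRegion_cons] at hp
      exact inConvergenceRegion_append.2 ⟨hp.1, hp.2.1.1, fun a j => by
        simpa using hp.2.2 a j.succ⟩
    have hJ : (Fin.cons (screeningCurrent e ord (α 0))
        (fun j => screeningCurrent e ord (Fin.tail α j)) :
          Fin (m + 1) → ℤ → Module.End ℂ (GhostFock (PosRoot b)))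
        = fun j => screeningCurrent e ord (α j) :=
      Fin.cons_self_tail fun j => screeningCurrent e ord (α j)
    have key := hasSum_fieldTerm_cons (t₀ := t 0) (t := Fin.tail t) (z := z) hτ
      (A := fun a => gammaField (P a))
      (B := fun j => screeningCurrent e ord (Fin.tail α j))
      (A' := fun a =>
        gammaField (vectorFieldApply (screeningField e ord (e (α 0))) (P a)))
      (B' := fun j => ∑ γ, structureConstant e (α 0) (Fin.tail α j) γ • screeningCurrent e ord γ)
      (fun a x => by simpa only [gammaField_apply] using radialBound_gammaPoly (P a) x)
      (fun j x => radialBound_screeningCurrent he ord _ x)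
      (radialBound_screeningCurrent he ord (α 0))
      (fun r a => fieldBracket_screeningCurrent_gammaField he ord (α 0) r (P a))
      (fun r j => fieldBracket_screeningCurrent he ord (α 0) (Fin.tail α j) r)
      ((hp.inGhostDomain hτ).exp_neg_ne (α 0))
      (homogeneous_screeningCurrent he ord (nome_ne_zero τ) hwt (α 0)) (by rwa [ht])
      (y := fun a => wardCorrelator τ (fun β => screeningField e ord (e β)) (structureConstant e)
        wt z (Function.update P a (vectorFieldApply (screeningField e ord (e (α 0))) (P a)))
        (Fin.tail α) (Fin.tail t))
      (fun a => by
        have h := ih (Function.update P a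
          (vectorFieldApply (screeningField e ord (e (α 0))) (P a))) (Fin.tail α) hp'
        have h1 : (fun a' => gammaField (Function.update P a
            (vectorFieldApply (screeningField e ord (e (α 0))) (P a)) a'))
            = Function.update (fun a => gammaField (P a)) a
              (gammaField (vectorFieldApply (screeningField e ord (e (α 0))) (P a))) :=
          Function.comp_update (fun Q => gammaField Q) P a _
        rwa [h1] at h)
      (y' := fun j => ∑ γ, structureConstant e (α 0) (Fin.tail α j) γ *
        wardCorrelator τ (fun β => screeningField e ord (e β)) (structureConstant e) wt z P
          (Function.update (Fin.tail α) j γ) (Fin.tail t))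
      (fun j => hasSum_fieldTerm_update_sum_smul j _ _ fun γ => by
        have h := ih P (Function.update (Fin.tail α) j γ) hp'
        have h1 : (fun j' => screeningCurrent e ord (Function.update (Fin.tail α) j γ j'))
            = Function.update (fun j => screeningCurrent e ord (Fin.tail α j)) j
              (screeningCurrent e ord γ) :=
          Function.comp_update (screeningCurrent e ord) (Fin.tail α) j γ
        rwa [h1] at h)
    rw [hJ, ht] at key
    rw [wardCorrelator]
    exact key

theorem traceTerm_eq_fieldTerm (he : IsRootVectors e) (ord : Fin s ≃ PosRoot b) (q : ℂ)
    (wt : PosRoot b → ℂ) {n m : ℕ} (P : Fin n → MvPolynomial (PosRoot b) ℂ)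
    (α : Fin m → PosRoot b) (z : Fin n → ℂ) (t : Fin m → ℂ)
    (x : (PosRoot b × ℤ →₀ ℕ) × (Fin n → ℤ) × (Fin m → ℤ)) :
    traceTerm q wt P (fun j => screeningField e ord (e (α j))) z t x.1 x.2.1 x.2.2
      = fieldTerm (modeWeight q wt) (fun a => gammaField (P a))
        (fun j => screeningCurrent e ord (α j)) z t x := by
  have h1 : composeFin (fun a => gammaPoly (P a) (x.2.1 a))
      = fieldProd (fun a => gammaField (P a)) x.2.1 := by
    rw [fieldProd, ← composeFin_coe]
    congr 1
    exact funext fun a => funext fun v => (gammaField_apply _ _ v).symm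
  have h2 : composeFin (fun j => currentMode (screeningField e ord (e (α j))) (x.2.2 j))
      = fieldProd (fun j => screeningCurrent e ord (α j)) x.2.2 := by
    rw [fieldProd, ← composeFin_coe]
    congr 1
    exact funext fun j => funext fun v => (screeningCurrent_apply he ord _ _ v).symm
  rw [traceTerm, h1, h2, fieldTerm, wtraceTerm, expProd_modeWeight, Module.End.mul_apply]
  ring

theorem isGhostCorrelator_wardCorrelator (he : IsRootVectors e) (ord : Fin s ≃ PosRoot b) {l : ℕ}
    (hb : Module.Basis (Fin l) ℂ 𝔥) {τ : ℂ} (hτ : 0 < τ.im) {n m : ℕ}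
    (P : Fin n → MvPolynomial (PosRoot b) ℂ) (α : Fin m → PosRoot b) :
    IsGhostCorrelator (nome τ) (rootValues b hb) P (fun j => screeningField e ord (e (α j)))
      fun x => wardCorrelator τ (fun β => screeningField e ord (e β)) (structureConstant e)
        (rootValues b hb x.1) x.2.1 P α x.2.2 := by
  refine ⟨fun x hx => ?_, fun x hx => ?_⟩
  · have hfst : ∀ i, AnalyticAt ℂ
        (fun y : (Fin l → ℂ) × (Fin n → ℂ) × (Fin m → ℂ) => y.1 i) x := fun i =>
      ((ContinuousLinearMap.proj i).comp (ContinuousLinearMap.fst ℂ (Fin l → ℂ)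
        ((Fin n → ℂ) × (Fin m → ℂ)))).analyticAt x
    refine analyticAt_wardCorrelator hτ _ _ (fun β => ?_) (fun a => ?_) (fun j => ?_) P α hx
    · simp only [rootValues, map_sum, map_smul, smul_eq_mul]
      exact Finset.analyticAt_fun_sum _ fun i _ => (hfst i).mul analyticAt_const
    · exact ((ContinuousLinearMap.proj a).comp ((ContinuousLinearMap.fst ℂ _ _).comp
        (ContinuousLinearMap.snd ℂ (Fin l → ℂ) ((Fin n → ℂ) × (Fin m → ℂ))))).analyticAt x
    · exact ((ContinuousLinearMap.proj j).comp ((ContinuousLinearMap.snd ℂ _ _).comp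
        (ContinuousLinearMap.snd ℂ (Fin l → ℂ) ((Fin n → ℂ) × (Fin m → ℂ))))).analyticAt x
  · exact (hasSum_fieldTerm_wardCorrelator he ord hτ (isAdditiveWeight_rootValues hb x.1) P α
      hx).congr_fun fun y => traceTerm_eq_fieldTerm he ord (nome τ) _ P α x.2.1 x.2.2 y

end CorrelatorTraces

end

end GenusOneWard

namespace GenusOneWard

open Complex Filter Topology

open LieAlgebra LieAlgebra.IsKilling

noncomputable section

/-! ### Connectedness of the domain -/

section Domain

theorem countable_setOf_exp_eq (v : ℂ) : {w : ℂ | cexp w = v}.Countable := by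
  rcases Set.eq_empty_or_nonempty {w : ℂ | cexp w = v} with h | ⟨w₀, hw₀⟩
  · rw [h]
    exact Set.countable_empty
  · refine (Set.countable_range fun n : ℤ => w₀ + n * (2 * Real.pi * I)).mono fun w hw => ?_
    obtain ⟨n, hn⟩ := Complex.exp_eq_exp_iff_exists_int.1 (hw.trans hw₀.symm)
    exact ⟨n, hn.symm⟩

/-- The complement of countably many complex affine hyperplanes is connected. -/
theorem isPreconnected_setOf_linear_notMem {E ι : Type*} [NormedAddCommGroup E] [NormedSpace ℂ E]
    [Countable ι] (f : ι → E →ₗ[ℂ] ℂ) {T : ι → Set ℂ} (hT : ∀ i, (T i).Countable) :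
    IsPreconnected {x | ∀ i, f i x ∉ T i} := by
  refine isPreconnected_of_forall_pair fun x hx y hy => ?_
  -- Restrict to the complex line through the two points: the excluded parameters form a countable
  -- set, whose complement in the plane is connected.
  let g : ℂ → E := fun c => x + c • (y - x)
  have hg : Continuous g := by fun_prop
  let Z : Set ℂ := ⋃ i, {c | f i (g c) ∈ T i}
  have hZ : Z.Countable := by
    refine Set.countable_iUnion fun i => ?_
    have hfg : ∀ c, f i (g c) = f i x + c * f i (y - x) := fun c => by simp [g]
    -- A functional constant along the line keeps its admissible value at x; otherwise it is
    -- injective in the parameter and excludes countably many values.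
    by_cases h : f i (y - x) = 0
    · convert Set.countable_empty
      refine Set.eq_empty_of_forall_notMem fun c hc => hx i ?_
      rw [Set.mem_ofPred_eq, hfg, h, mul_zero, add_zero] at hc
      exact hc
    · refine (hT i).preimage_of_injOn fun c _ c' _ hcc => ?_
      simp only [hfg] at hcc
      exact mul_right_cancel₀ h (add_left_cancel hcc)
  have hcon : IsPreconnected Zᶜ := (hZ.isPathConnected_compl_of_one_lt_rank (by
    rw [Complex.rank_real_complex]
    exact Cardinal.one_lt_two)).isConnected.isPreconnected
  have hmem : ∀ c, c ∈ Zᶜ ↔ ∀ i, f i (g c) ∉ T i := fun c => by simp [Z]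
  refine ⟨g '' Zᶜ, ?_, ⟨0, (hmem 0).2 (by simpa [g] using hx), by simp [g]⟩,
    ⟨1, (hmem 1).2 (by simpa [g] using hy), by simp [g]⟩, hcon.image g hg.continuousOn⟩
  rintro _ ⟨c, hc, rfl⟩
  exact (hmem c).1 hc

/-- All conditions exclude values of linear functionals: countably many logarithms of each q^k for
the roots, and zero for p_i and p_i - q^k p_j. -/
theorem isPreconnected_inGhostDomain {E R : Type*} [Countable R] [NormedAddCommGroup E]
    [NormedSpace ℂ E] (q : ℂ) (wt : E →ₗ[ℂ] R → ℂ) {N : ℕ} (p : E →ₗ[ℂ] Fin N → ℂ) :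
    IsPreconnected {x | InGhostDomain q (wt x) (p x)} := by
  have h := isPreconnected_setOf_linear_notMem (E := E)
    (ι := (R × ℤ) ⊕ Fin N ⊕ {x : Fin N × Fin N // x.1 ≠ x.2} × ℤ)
    (Sum.elim (fun x => (LinearMap.proj x.1).comp wt) (Sum.elim (fun i => (LinearMap.proj i).comp p)
      fun x => (LinearMap.proj x.1.1.1).comp p - q ^ x.2 • (LinearMap.proj x.1.1.2).comp p))
    (T := Sum.elim (fun x => {w | cexp w = q ^ x.2}) fun _ => {0}) (by
      rintro (x | x)
      · exact countable_setOf_exp_eq _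
      · exact Set.countable_singleton _)
  convert h using 3 with x
  simp [InGhostDomain, sub_eq_zero]

end Domain

/-! ### The convergence region is open and nonempty -/

section Region

variable {E R : Type*} [TopologicalSpace E]

theorem isOpen_inConvergenceRegion [Finite R] (q : ℂ) {wt : E → R → ℂ} (hwt : Continuous wt)
    {N : ℕ} {p : E → Fin N → ℂ} (hp : Continuous p) :
    IsOpen {x | InConvergenceRegion q (wt x) (p x)} := by
  have h1 : ∀ α, Continuous fun x => wt x α := fun α => (continuous_apply α).comp hwt
  have h2 : ∀ i, Continuous fun x => p x i := fun i => (continuous_apply i).comp hp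
  simp only [InConvergenceRegion, Set.ofPred_and, Set.ofPred_forall]
  refine (isOpen_iInter_of_finite fun α => ?_).inter ((isOpen_iInter_of_finite fun i => ?_).inter
    (isOpen_iInter_of_finite fun i => isOpen_iInter_of_finite fun j =>
      isOpen_iInter_of_finite fun _ => ?_))
  · have := h1 α
    exact (isOpen_lt (by fun_prop) (by fun_prop)).inter (isOpen_lt (by fun_prop) (by fun_prop))
  · exact isOpen_ne_fun (h2 i) continuous_const
  · have := h2 i
    have := h2 j
    exact (isOpen_lt (by fun_prop) (by fun_prop)).inter (isOpen_lt (by fun_prop) (by fun_prop))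

theorem exists_radially_ordered {q : ℂ} (hq0 : q ≠ 0) (hq : ‖q‖ < 1) (N : ℕ) :
    ∃ p : Fin N → ℂ, (∀ i, p i ≠ 0) ∧ ∀ i j, i < j → ‖p j‖ < ‖p i‖ ∧ ‖q * p i‖ < ‖p j‖ := by
  have hlog : Real.log ‖q‖ < 0 := Real.log_neg (norm_pos_iff.2 hq0) hq
  have hN : (0 : ℝ) < N + 1 := by positivity
  -- The N points sit at equal logarithmic distances ε, so together they span less than the period
  -- -log |q| = (N + 1) ε.
  set ε : ℝ := -Real.log ‖q‖ / (N + 1) with hε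
  have hε0 : 0 < ε := div_pos (neg_pos.2 hlog) hN
  have hq' : ‖q‖ = Real.exp (-((N + 1) * ε)) := by
    rw [hε, mul_div_cancel₀ _ hN.ne', neg_neg, Real.exp_log (norm_pos_iff.2 hq0)]
  refine ⟨fun i => cexp ((-(i.1 * ε) : ℝ)), fun i => Complex.exp_ne_zero _, fun i j hij => ?_⟩
  have hij' : (i.1 : ℝ) < j.1 := by exact_mod_cast hij
  have hj : (j.1 : ℝ) < N := by exact_mod_cast j.2
  rw [norm_mul, hq', Complex.norm_exp_ofReal, Complex.norm_exp_ofReal, ← Real.exp_add,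
    Real.exp_lt_exp, Real.exp_lt_exp]
  have hi : (0 : ℝ) ≤ i.1 := Nat.cast_nonneg _
  constructor <;> nlinarith

theorem exists_exp_mul_height {R : Type*} [Finite R] {q : ℂ} (hq0 : q ≠ 0) (hq : ‖q‖ < 1)
    {h : R → ℤ} (hh : ∀ α, 0 < h α) :
    ∃ ε : ℝ, ∀ α, 1 < ‖cexp (ε * h α)‖ ∧ ‖q * cexp (ε * h α)‖ < 1 := by
  obtain ⟨M, hM⟩ := (Set.finite_range h).bddAbove
  have hlog : Real.log ‖q‖ < 0 := Real.log_neg (norm_pos_iff.2 hq0) hq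
  have hN : (0 : ℝ) < |(M : ℝ)| + 1 := by positivity
  -- With M bounding the heights, 0 < ε h α < -log |q| for every α.
  set ε : ℝ := -Real.log ‖q‖ / (|(M : ℝ)| + 1) with hε
  have hε0 : 0 < ε := div_pos (neg_pos.2 hlog) hN
  have hq' : ‖q‖ = Real.exp (-((|(M : ℝ)| + 1) * ε)) := by
    rw [hε, mul_div_cancel₀ _ hN.ne', neg_neg, Real.exp_log (norm_pos_iff.2 hq0)]
  refine ⟨ε, fun α => ?_⟩
  have h1 : (0 : ℝ) < h α := by exact_mod_cast hh α
  have h2 : (h α : ℝ) ≤ |(M : ℝ)| := le_trans (by exact_mod_cast hM ⟨α, rfl⟩) (le_abs_self _)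
  have h3 : ((ε : ℂ) * (h α : ℂ)) = ((ε * h α : ℝ) : ℂ) := by push_cast; rfl
  rw [h3, norm_mul, hq', Complex.norm_exp_ofReal, ← Real.exp_add, Real.one_lt_exp_iff,
    Real.exp_lt_one_iff]
  exact ⟨mul_pos hε0 h1, by nlinarith⟩

end Region

/-! ### Uniqueness of the analytic continuation -/

section Uniqueness

variable {L : Type*} [LieRing L] [LieAlgebra ℂ L] [FiniteDimensional ℂ L] [LieAlgebra.IsSimple ℂ L]
  {𝔥 : LieSubalgebra ℂ L} [𝔥.IsCartanSubalgebra] {b : (rootSystem 𝔥).Base}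

/-- The simple roots form a basis of the dual, so some H takes the value 1 on each of them. It
provides a point of the convergence region. -/
theorem PosRoot.exists_toDual_eq_height (b : (rootSystem 𝔥).Base) :
    ∃ H : 𝔥, ∀ α : PosRoot b, α.toDual H = α.height := by
  obtain ⟨H, hH⟩ := (Module.evalEquiv ℂ 𝔥).surjective
    (b.toWeightBasis.constr ℂ fun _ => (1 : ℂ))
  refine ⟨H, fun α => ?_⟩
  have hsimple : ∀ j ∈ b.support, (rootSystem 𝔥).root j H = 1 := fun j hj => by
    have h1 := LinearMap.congr_fun hH ((rootSystem 𝔥).root j)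
    rw [Module.evalEquiv_apply, Module.Dual.eval_apply] at h1
    rw [h1, ← b.toWeightBasis_apply ⟨j, hj⟩, Module.Basis.constr_basis]
  obtain ⟨f, hf, heq⟩ := b.exists_root_eq_sum_int α.1
  rw [PosRoot.height, b.height_eq_sum heq.2, PosRoot.toDual, heq.2, LinearMap.sum_apply]
  push_cast
  refine Finset.sum_congr rfl fun j hj => ?_
  rw [LinearMap.smul_apply, hsimple j hj]
  simp

/-- The values of the positive roots as a linear map. -/
def rootValuesLinear (b : (rootSystem 𝔥).Base) {l : ℕ} (hb : Module.Basis (Fin l) ℂ 𝔥) :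
    (Fin l → ℂ) →ₗ[ℂ] PosRoot b → ℂ :=
  LinearMap.pi fun α => α.toDual.comp hb.equivFun.symm.toLinearMap

theorem rootValuesLinear_apply {l : ℕ} (hb : Module.Basis (Fin l) ℂ 𝔥) (ξ : Fin l → ℂ) :
    rootValuesLinear b hb ξ = rootValues b hb ξ := by
  funext α
  simp [rootValuesLinear, rootValues, Module.Basis.equivFun_symm_apply]

/-- Juxtaposition of tuples as a linear map. -/
def appendLinear (n m : ℕ) : (Fin n → ℂ) × (Fin m → ℂ) →ₗ[ℂ] Fin (n + m) → ℂ where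
  toFun x := Fin.append x.1 x.2
  map_add' x y := by
    funext i
    induction i using Fin.addCases <;> simp
  map_smul' c x := by
    funext i
    induction i using Fin.addCases <;> simp

/-- Two correlators agree with the trace on a nonempty open set, hence with each other on the
connected domain by the identity theorem. -/
theorem IsGhostCorrelator.eqOn {l : ℕ} (hb : Module.Basis (Fin l) ℂ 𝔥) {τ : ℂ} (hτ : 0 < τ.im)
    {n m : ℕ} {P : Fin n → MvPolynomial (PosRoot b) ℂ}
    {S : Fin m → PosRoot b → MvPolynomial (PosRoot b) ℂ}
    {F G : (Fin l → ℂ) × (Fin n → ℂ) × (Fin m → ℂ) → ℂ}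
    (hF : IsGhostCorrelator (nome τ) (rootValues b hb) P S F)
    (hG : IsGhostCorrelator (nome τ) (rootValues b hb) P S G) :
    Set.EqOn F G
      {x | InGhostDomain (nome τ) (rootValues b hb x.1) (Fin.append x.2.1 x.2.2)} := by
  let wt := (rootValuesLinear b hb).comp
    (LinearMap.fst ℂ (Fin l → ℂ) ((Fin n → ℂ) × (Fin m → ℂ)))
  let p := (appendLinear n m).comp (LinearMap.snd ℂ (Fin l → ℂ) ((Fin n → ℂ) × (Fin m → ℂ)))
  have hwt : ∀ x, wt x = rootValues b hb x.1 := fun x => rootValuesLinear_apply hb x.1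
  have hp : ∀ x, p x = Fin.append x.2.1 x.2.2 := fun x => rfl
  have hcon := isPreconnected_inGhostDomain (nome τ) wt p
  have hopen := isOpen_inConvergenceRegion (nome τ) wt.continuous_of_finiteDimensional
    p.continuous_of_finiteDimensional
  simp only [hwt, hp] at hcon hopen
  obtain ⟨H, hH⟩ := PosRoot.exists_toDual_eq_height b
  obtain ⟨ε, hε⟩ := exists_exp_mul_height (nome_ne_zero τ) (norm_nome_lt_one hτ)
    (PosRoot.height_pos (b := b))
  obtain ⟨u, hu⟩ := exists_radially_ordered (nome_ne_zero τ) (norm_nome_lt_one hτ) (n + m)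
  let x₀ : (Fin l → ℂ) × (Fin n → ℂ) × (Fin m → ℂ) :=
    (hb.equivFun ((ε : ℂ) • H), fun a => u (Fin.castAdd m a), fun j => u (Fin.natAdd n j))
  have hx₀ : InConvergenceRegion (nome τ) (rootValues b hb x₀.1)
      (Fin.append x₀.2.1 x₀.2.2) := by
    have h1 : Fin.append x₀.2.1 x₀.2.2 = u := Fin.append_castAdd_natAdd
    have h2 : ∀ α : PosRoot b, rootValues b hb x₀.1 α = ε * α.height := fun α => by
      rw [rootValues, ← Module.Basis.equivFun_symm_apply, LinearEquiv.symm_apply_apply, map_smul,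
        hH, smul_eq_mul]
    rw [h1]
    exact ⟨fun α => by rw [h2]; exact hε α, hu⟩
  refine hF.1.eqOn_of_preconnected_of_eventuallyEq hG.1 hcon (z₀ := x₀) (hx₀.inGhostDomain hτ) ?_
  filter_upwards [hopen.mem_nhds hx₀] with x hx
  exact (hF.2 x hx).unique (hG.2 x hx)

end Uniqueness

end

end GenusOneWard

/-! ### The Ward identity -/

open GenusOneWard in
theorem mainTheorem4 {L : Type*} [LieRing L] [LieAlgebra ℂ L] [FiniteDimensional ℂ L]
    [LieAlgebra.IsSimple ℂ L] (𝔥 : LieSubalgebra ℂ L) [𝔥.IsCartanSubalgebra]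
    (b : (LieAlgebra.IsKilling.rootSystem 𝔥).Base) (e : PosRoot b → L) (he : IsRootVectors e)
    {s : ℕ} (ord : Fin s ≃ PosRoot b) {l : ℕ} (hb : Module.Basis (Fin l) ℂ 𝔥)
    (τ : ℂ) (hτ : 0 < τ.im) :
    (∀ α : PosRoot b, IsLeftActionField e ord (e α) (screeningField e ord (e α))) ∧
    (∀ (n m : ℕ) (P : Fin n → MvPolynomial (PosRoot b) ℂ) (α : Fin m → PosRoot b),
      IsGhostCorrelator (Complex.exp (2 * Real.pi * Complex.I * τ)) (rootValues b hb) P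
        (fun j => screeningField e ord (e (α j))) (screeningCorrelator e ord hb τ P α)) ∧
    ∀ (n m : ℕ) (P : Fin n → MvPolynomial (PosRoot b) ℂ) (α₀ : PosRoot b)
      (α : Fin m → PosRoot b) (ξ : Fin l → ℂ) (z : Fin n → ℂ) (t₀ : ℂ) (t : Fin m → ℂ),
      InGhostDomain (Complex.exp (2 * Real.pi * Complex.I * τ)) (rootValues b hb ξ)
        (Fin.append z (Fin.cons t₀ t : Fin (m + 1) → ℂ)) →
      screeningCorrelator e ord hb τ P (Fin.cons α₀ α : Fin (m + 1) → PosRoot b)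
          (ξ, z, Fin.cons t₀ t) =
        (∑ a : Fin n, -wardKernel τ (rootValues b hb ξ α₀) t₀ (z a) *
          screeningCorrelator e ord hb τ
            (Function.update P a (vectorFieldApply (screeningField e ord (e α₀)) (P a)))
            α (ξ, z, t)) +
        ∑ j : Fin m, -wardKernel τ (rootValues b hb ξ α₀) t₀ (t j) *
          ∑ γ : PosRoot b, structureConstant e α₀ (α j) γ *
            screeningCorrelator e ord hb τ P (Function.update α j γ) (ξ, z, t) := by
  have hW : ∀ (n m : ℕ) (P : Fin n → MvPolynomial (PosRoot b) ℂ) (α : Fin m → PosRoot b),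
      IsGhostCorrelator (nome τ) (rootValues b hb) P
        (fun j => screeningField e ord (e (α j))) (screeningCorrelator e ord hb τ P α) :=
    -- The recursively defined function witnesses existence, so the chosen correlator is a genuine
    -- one.
    fun n m P α => Classical.epsilon_spec ⟨_, isGhostCorrelator_wardCorrelator he ord hb hτ P α⟩
  have heq : ∀ (n m : ℕ) (P : Fin n → MvPolynomial (PosRoot b) ℂ) (α : Fin m → PosRoot b)
      (ξ : Fin l → ℂ) (z : Fin n → ℂ) (t : Fin m → ℂ),
      InGhostDomain (nome τ) (rootValues b hb ξ) (Fin.append z t) →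
      screeningCorrelator e ord hb τ P α (ξ, z, t) =
        wardCorrelator τ (fun β => screeningField e ord (e β)) (structureConstant e)
          (rootValues b hb ξ) z P α t := fun n m P α ξ z t h =>
    (hW n m P α).eqOn hb hτ (isGhostCorrelator_wardCorrelator he ord hb hτ P α)
      (show (ξ, z, t) ∈ {x : (Fin l → ℂ) × (Fin n → ℂ) × (Fin m → ℂ) | InGhostDomain (nome τ)
        (rootValues b hb x.1) (Fin.append x.2.1 x.2.2)} from h)
  refine ⟨isLeftActionField_screeningField he ord, hW, fun n m P α₀ α ξ z t₀ t h => ?_⟩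
  have htail : InGhostDomain (nome τ) (rootValues b hb ξ) (Fin.append z t) := by
    have h' := h.append_tail
    rwa [Fin.tail_cons] at h'
  obtain ⟨⟨-, hz0, -⟩, ⟨-, ht0, -⟩, -⟩ := inGhostDomain_append.1 h
  have ht₀ : t₀ ≠ 0 := ht0 0
  have ht : ∀ j, t j ≠ 0 := fun j => by simpa using ht0 j.succ
  -- All correlators are replaced by the recursive function, for which the claim is its defining
  -- equation; the kernels are matched by `neg_wardKernel`.
  rw [heq _ _ _ _ _ _ _ h, wardCorrelator]
  simp only [Fin.cons_zero, Fin.tail_cons]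
  congr 1
  · refine Finset.sum_congr rfl fun a _ => ?_
    rw [neg_wardKernel hτ ht₀ (hz0 a), heq _ _ _ _ _ _ _ htail]
  · refine Finset.sum_congr rfl fun j _ => ?_
    rw [neg_wardKernel hτ ht₀ (ht j)]
    simp only [heq _ _ _ _ _ _ _ htail]
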